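/- **Theorem 1.4.** Let $P_L=\{(p,q)\in\mathbb R^2\times\mathbb R^2 : |p|\le 1,\ |q|\le 1\}\subset\mathbb R^4$ be the Lagrangian bidisk with the symplectic form $\omega=dp_1\wedge dq_1+dp_2\wedge dq_2$, let $\mu(p,q)=2\pi(p_1q_2-p_2q_1)$, and for $|m|\le 2\pi$ put $$\mathcal A(m)=\frac1\pi\left(\sqrt{4\pi^2-m^2}-m\arctan\frac{\sqrt{4\pi^2-m^2}}{m}\right),\qquad \mathcal A(0)=2 .$$ Let $B_{P_L}=\{(m,a)\in\mathbb R^2 : |m|\le 2\pi,\ 0\le a\le\mathcal A(m)\}$ be the region bounded by the curve $m\mapsto(m,\mathcal A(m))$ and the horizontal axis. An *almost toric fibration* of an open set $M\subset\mathbb R^4$ is a smooth map $F:M\to\mathbb R^2$, proper onto its base $F(M)$, with connected fibres, such that every point of $M$ either is a regular point at which the fibre of $F$ is Lagrangian, or has a Darboux chart $(x_1,x_2,y_1,y_2)$ (symplectic form $dx_1\wedge dy_1+dx_2\wedge dy_2$) centred at it in which $F$ is, up to a local diffeomorphism of $\mathbb R^2$, one of $(x_1,\,x_2^2+y_2^2)$,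 $(x_1^2+y_1^2,\,x_2^2+y_2^2)$ (elliptic points) or $(x_1y_1+x_2y_2,\,x_1y_2-x_2y_1)$ (a *nodal* point). Then there is a continuous surjection $f:P_L\to B_{P_L}$ with connected fibres and first component $\mu$ such that $f(z)$ lies on the curve $\{(m,\mathcal A(m)):|m|\le2\pi\}$ if and only if $z\in\partial P_L$, and such that, on the interior $M$ of $P_L$, $f$ is an almost toric fibration with exactly one nodal point, presented by its base diagram. That is, there is an almost toric fibration $F$ of $M$ with exactly one nodal point $x_0$, and: 1. $f|_M=\psi\circ F$ for a homeomorphism $\psi:F(M)\to f(M)$; 2. $f(x_0)=(0,a_0)$ with $0<a_0<\mathcal A(0)=2$; 3. off the branch cut $C=\{0\}\times[a_0,\mathcal A(0)]$, $f$ is given by action coordinates: $f$ is smooth on $M\setminus f^{-1}(C)$, and every interior point of $f(M)$ not on $C$ has an open neighbourhood $V$ for which there is a symplectomorphism from $(V\times(\mathbb R/\mathbb Z)^2,\ dI_1\wedge d\theta_1+dI_2\wedge d\theta_2)$ onto $M\cap f^{-1}(V)$ that carries the projection $(I,\theta)\mapsto I$ to $f$. -/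

import Mathlib

open scoped ContDiff

noncomputable section

namespace LagBidisk

/-- The Euclidean plane. -/
abbrev Plane : Type := EuclideanSpace ℝ (Fin 2)

/-- Four-dimensional phase space, with points `z = (p, q)`, `p = (p₁, p₂)`, `q = (q₁, q₂)`. -/
abbrev Phase : Type := Plane × Plane

/-- The standard symplectic form `dp₁ ∧ dq₁ + dp₂ ∧ dq₂`, evaluated on two vectors. -/
def omega (v w : Phase) : ℝ :=
  (v.1 0 * w.2 0 - v.2 0 * w.1 0) + (v.1 1 * w.2 1 - v.2 1 * w.1 1)

/-- The (closed) Lagrangian bidisk `{|p| ≤ 1, |q| ≤ 1}`. -/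
def bidisk : Set Phase := {z | ‖z.1‖ ≤ 1 ∧ ‖z.2‖ ≤ 1}

/-- The interior of the Lagrangian bidisk. -/
def openBidisk : Set Phase := {z | ‖z.1‖ < 1 ∧ ‖z.2‖ < 1}

/-- The moment map `2π (p₁ q₂ - p₂ q₁)` of the circle action of period one which rotates
`p` and `q` simultaneously. -/
def moment (z : Phase) : ℝ := 2 * Real.pi * (z.1 0 * z.2 1 - z.1 1 * z.2 0)

/-- The height of the boundary curve. At `m = 0` the second term vanishes (whatever value is given
to the arctangent) and the height is `2`, which is also the limit as `m → 0`. -/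
def height (m : ℝ) : ℝ :=
  (√(4 * Real.pi ^ 2 - m ^ 2) - m * Real.arctan (√(4 * Real.pi ^ 2 - m ^ 2) / m)) / Real.pi

/-- The region between the horizontal axis and the curve `m ↦ (m, height m)`, `|m| ≤ 2π`. -/
def region : Set (ℝ × ℝ) :=
  {b | |b.1| ≤ 2 * Real.pi ∧ 0 ≤ b.2 ∧ b.2 ≤ height b.1}

/-! ### Almost toric fibrations on open subsets of phase space -/

/-- `x` is a regular point of `F` at which the fibre of `F` is Lagrangian: the differential is onto
`ℝ²`, and its kernel (the two-dimensional tangent space of the fibre) is isotropic. -/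
def IsRegularLagrangianAt (F : Phase → ℝ × ℝ) (x : Phase) : Prop :=
  Function.Surjective (fderiv ℝ F x) ∧
    ∀ v w : Phase, fderiv ℝ F x v = 0 → fderiv ℝ F x w = 0 → omega v w = 0

/-- `F` has at `x` the local form `G`: there are a Darboux chart `κ` of `M` centred at `x` and a
smooth chart `χ` of the base near `F x` such that `χ ∘ F = G ∘ κ` near `x`. -/
def HasLocalForm (M : Set Phase) (F G : Phase → ℝ × ℝ) (x : Phase) : Prop :=
  ∃ (κ : OpenPartialHomeomorph Phase Phase) (χ : OpenPartialHomeomorph (ℝ × ℝ) (ℝ × ℝ)),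
    x ∈ κ.source ∧ κ.source ⊆ M ∧ κ x = 0 ∧
    ContDiffOn ℝ ∞ κ κ.source ∧ ContDiffOn ℝ ∞ κ.symm κ.target ∧
    (∀ z ∈ κ.source, ∀ v w : Phase,
      omega (fderiv ℝ κ z v) (fderiv ℝ κ z w) = omega v w) ∧
    ContDiffOn ℝ ∞ χ χ.source ∧ ContDiffOn ℝ ∞ χ.symm χ.target ∧
    (∀ z ∈ κ.source, F z ∈ χ.source ∧ χ (F z) = G (κ z))

/-- The elliptic model of corank one, `(x₁, x₂² + y₂²)`, where `z = (x, y)`. -/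
def ellipticOne (z : Phase) : ℝ × ℝ := (z.1 0, z.1 1 ^ 2 + z.2 1 ^ 2)

/-- The elliptic model of corank two, `(x₁² + y₁², x₂² + y₂²)`, where `z = (x, y)`. -/
def ellipticTwo (z : Phase) : ℝ × ℝ := (z.1 0 ^ 2 + z.2 0 ^ 2, z.1 1 ^ 2 + z.2 1 ^ 2)

/-- The nodal (focus-focus) model, `(x₁ y₁ + x₂ y₂, x₁ y₂ - x₂ y₁)`, where `z = (x, y)`. -/
def nodal (z : Phase) : ℝ × ℝ :=
  (z.1 0 * z.2 0 + z.1 1 * z.2 1, z.1 0 * z.2 1 - z.1 1 * z.2 0)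

/-- `F : M → F(M) ⊆ ℝ²` is an almost toric fibration of the open subset `M` of phase space: a
smooth map, proper onto its base `F(M)`, with connected (and, by properness, compact) fibres, all
of whose points are either regular with Lagrangian fibre, or toric (elliptic of corank one or two),
or nodal. -/
structure IsAlmostToric (M : Set Phase) (F : Phase → ℝ × ℝ) : Prop where
  isOpen : IsOpen M
  smooth : ContDiffOn ℝ ∞ F M
  proper : ∀ K : Set (ℝ × ℝ), K ⊆ F '' M → IsCompact K → IsCompact (M ∩ F ⁻¹' K)
  connected : ∀ b ∈ F '' M, IsConnected (M ∩ F ⁻¹' {b})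
  local_form : ∀ x ∈ M, IsRegularLagrangianAt F x ∨ HasLocalForm M F ellipticOne x ∨
    HasLocalForm M F ellipticTwo x ∨ HasLocalForm M F nodal x

/-! ### Action coordinates and base diagrams -/

/-- `Ψ` gives action-angle coordinates for `f` over the open set `V` of `ℝ²`: it induces a
symplectomorphism from `V × (ℝ/ℤ)²`, with the form `dI₁ ∧ dθ₁ + dI₂ ∧ dθ₂`, onto the part
of `M` over `V`, and carries the projection `(I, θ) ↦ I` to `f`. -/
structure IsActionAngle (M : Set Phase) (f : Phase → ℝ × ℝ) (V : Set (ℝ × ℝ))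
    (Ψ : (ℝ × ℝ) × (ℝ × ℝ) → Phase) : Prop where
  smooth : ContDiffOn ℝ ∞ Ψ (V ×ˢ Set.univ)
  maps : ∀ I ∈ V, ∀ θ : ℝ × ℝ, Ψ (I, θ) ∈ M ∧ f (Ψ (I, θ)) = I
  onto : ∀ x ∈ M, f x ∈ V → ∃ θ : ℝ × ℝ, Ψ (f x, θ) = x
  periods : ∀ I ∈ V, ∀ θ θ' : ℝ × ℝ,
    Ψ (I, θ) = Ψ (I, θ') ↔ ∃ k l : ℤ, θ' = θ + ((k : ℝ), (l : ℝ))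
  symplectic : ∀ I ∈ V, ∀ θ : ℝ × ℝ, ∀ v w : (ℝ × ℝ) × (ℝ × ℝ),
    omega (fderiv ℝ Ψ (I, θ) v) (fderiv ℝ Ψ (I, θ) w) =
      (v.1.1 * w.2.1 - v.2.1 * w.1.1) + (v.1.2 * w.2.2 - v.2.2 * w.1.2)

/-- `f(M)` is a base diagram with branch cut `C` of the fibration `F` on `M`, realised by
`f : M → ℝ²`: the map `f` is `F` followed by a homeomorphism of the base `F(M)` onto `f(M)`, and
away from the cut this homeomorphism is a global integral affine coordinate of the base, i.e. `f`
is smooth there and its two components are action coordinates of the regular fibres. -/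
structure IsBaseDiagram (M : Set Phase) (F f : Phase → ℝ × ℝ) (C : Set (ℝ × ℝ)) : Prop where
  homeo : ∃ ψ : ↥(F '' M) ≃ₜ ↥(f '' M), ∀ x (hx : x ∈ M),
    ψ ⟨F x, Set.mem_image_of_mem F hx⟩ = ⟨f x, Set.mem_image_of_mem f hx⟩
  isClosed_cut : IsClosed C
  smooth : ContDiffOn ℝ ∞ f (M \ f ⁻¹' C)
  action : ∀ b ∈ interior (f '' M), b ∉ C →
    ∃ (V : Set (ℝ × ℝ)) (Ψ : (ℝ × ℝ) × (ℝ × ℝ) → Phase),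
      IsOpen V ∧ b ∈ V ∧ IsActionAngle M f V Ψ

/-- The vertical branch cut from `(0, a)` up to the boundary curve. -/
def cut (a : ℝ) : Set (ℝ × ℝ) := {b | b.1 = 0 ∧ a ≤ b.2 ∧ b.2 ≤ height 0}

end LagBidisk

end

/-!
The circle acts on the bidisk by simultaneous rotation of `p` and `q`, with the angular momentum
`j = p₁ q₂ - p₂ q₁` as moment map. The reduced space at `|j| < 1` is a disk (with a singular point
when `j = 0`, the image of the origin), with the coordinates `C = p · q` and
`X = (|p|² - |q|²) / 2`; in the normalised coordinates `n = C / √(1 - j²)` and `u = X / (1 - j²)` it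
is the fixed region `n² + 2 |u| < 1` (`mem_reduced_iff`). The fibration is `F = (j, H)` for an
explicit rotation-invariant Hamiltonian `H` (`ham`). It interpolates between

* the sum of squares `ξ² + η²` of Darboux coordinates of the reduced space near the point
  `n = -1/2`, `u = 0`, which is the only minimum of `H` on every reduced disk (`ham_model`);
* `1/2 + 17/8 p · q + 15/16 (|p|² + |q|²)` near the origin, which a linear symplectic map turns
  into `1/2 + p · q`: this is a nodal point, with value `H = 1/2`;
* a function which tends to infinity at the boundary of the bidisk, which makes `F` proper.

On the slices `n = const` the function `H` increases with `|u|`, and on the axis `u = 0` it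
decreases up to the minimum and increases after it. Therefore the minima and the origin are the only
critical points, and the level curves of `H` in the reduced disks are connected.

The map `f` consists of the moment map `2 π j` and the symplectic area of the sublevel set of `H`
in the reduced disk (`area`). This area depends continuously and strictly monotonically on `H`, so
that `f` and `F` have the same fibres; the area vanishes at the minima and, on the boundary of the
bidisk, is the total area of the reduced disk, which is `height (2 π j)` (`area_zero`).

Wherever `C < 0` or `j ≠ 0`, in particular off the preimage of the branch cut, there are Darboux
coordinates `(x, y, j, α)` with `y = C`, `x = log (|p| / |q|) / 2` and `α` the angle of rotation
(`lift`, `omega_fderiv_lift`). There `H` is the sum of the squares of two functions that serve as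
coordinates on the reduced disk (`lam`, `pii`), which parametrises the level curves by an angle `φ`,
smoothly in `(j, h, φ)`. If `σ` is the primitive of `x dy` along the level curves and `A` its value
after one turn, then `dσ = x dy + T dA + s dj` defines functions `T` and `s`; taking the exterior
derivative gives `dx ∧ dy = dA ∧ dT + dj ∧ ds` (`exact_decomp`, `wedge_eq`). Since `T` increases by
`1` and `s` does not change in one turn, the form `ω = dx ∧ dy + dα ∧ dj` becomes
`dI₁ ∧ dθ₁ + dI₂ ∧ dθ₂` for `I = (2 π j, A)`, `θ₂ = T` and `θ₁ = (s - α) / 2 π`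
(`isActionAngle`). As `A` is the area of the sublevel set (`area_eq_action`), these are action-angle
coordinates for `f` on the complement of the branch cut and of the elliptic points.
-/

open scoped ContDiff

noncomputable section

namespace LagBidisk

open Set Filter Topology MeasureTheory

/-! ### Parametric integrals and fibrewise inverse functions -/

/-- A parametric integral over `[0, 1]` is as smooth as its integrand, by induction on the order:
its derivative is the integral of the derivative. -/
theorem contDiffOn_integral_unit_aux {E : Type} [NormedAddCommGroup E] [NormedSpace ℝ E]
    [FiniteDimensional ℝ E] {U : Set E} (hU : IsOpen U) (n : ℕ) :
    ∀ {G : Type} [NormedAddCommGroup G] [NormedSpace ℝ G] [CompleteSpace G] {g : E → ℝ → G},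
      ContDiffOn ℝ n (Function.uncurry g) (U ×ˢ univ) →
      ContDiffOn ℝ n (fun a => ∫ t in (0:ℝ)..1, g a t) U := by
  induction n with
  | zero =>
    intro G _ _ _ g hg
    simp only [Nat.cast_zero, contDiffOn_zero] at hg ⊢
    rw [continuousOn_iff_continuous_domRestrict]
    refine intervalIntegral.continuous_parametric_intervalIntegral_of_continuous'
      (f := fun (a : U) t => g a t) ?_ 0 1
    exact hg.comp_continuous (f := fun q : U × ℝ => ((q.1 : E), q.2)) (by fun_prop)
      (fun q => ⟨q.1.2, mem_univ _⟩)
  | succ n ih =>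
    intro G _ _ _ g hg
    have hUo : IsOpen (U ×ˢ (univ : Set ℝ)) := hU.prod isOpen_univ
    set g' : E → ℝ → E →L[ℝ] G := fun a t =>
      (fderiv ℝ (Function.uncurry g) (a, t)).comp (ContinuousLinearMap.inl ℝ E ℝ) with hg'def
    have hg' : ContDiffOn ℝ n (Function.uncurry g') (U ×ˢ univ) := by
      have h1 : ContDiffOn ℝ n (fderiv ℝ (Function.uncurry g)) (U ×ˢ univ) :=
        hg.fderiv_of_isOpen hUo (by norm_cast)
      exact h1.clm_comp contDiffOn_const
    have hcont : ContinuousOn (Function.uncurry g) (U ×ˢ univ) := hg.continuousOn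
    have hcont' : ContinuousOn (Function.uncurry g') (U ×ˢ univ) := hg'.continuousOn
    have hslice : ∀ a ∈ U, Continuous (g a) := fun a ha =>
      hcont.comp_continuous (f := fun t : ℝ => (a, t)) (by fun_prop) (fun t => ⟨ha, mem_univ _⟩)
    have hslice' : ∀ a ∈ U, Continuous (g' a) := fun a ha =>
      hcont'.comp_continuous (f := fun t : ℝ => (a, t)) (by fun_prop) (fun t => ⟨ha, mem_univ _⟩)
    have hd : ∀ a ∈ U, ∀ t, HasFDerivAt (fun a => g a t) (g' a t) a := by
      intro a ha t
      have h1 : HasFDerivAt (Function.uncurry g) (fderiv ℝ (Function.uncurry g) (a, t)) (a, t) :=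
        ((hg.contDiffAt (hUo.mem_nhds ⟨ha, mem_univ _⟩)).differentiableAt
          (by norm_cast)).hasFDerivAt
      have h2 : HasFDerivAt (fun e : E => (e, t)) (ContinuousLinearMap.inl ℝ E ℝ) a :=
        hasFDerivAt_prodMk_left a t
      exact HasFDerivAt.comp (f := fun e : E => (e, t)) (g := Function.uncurry g) a h1 h2
    have key : ∀ a ∈ U, HasFDerivAt (fun a => ∫ t in (0:ℝ)..1, g a t)
        (∫ t in (0:ℝ)..1, g' a t) a := by
      intro a ha
      obtain ⟨K, hK, hKa, hKU⟩ := exists_compact_subset hU ha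
      obtain ⟨M, hM⟩ := (hK.prod (isCompact_Icc (a := (0:ℝ)) (b := 1))).exists_bound_of_continuousOn
        (hcont'.mono (prod_mono hKU (subset_univ _)))
      refine intervalIntegral.hasFDerivAt_integral_of_dominated_of_fderiv_le
        (s := K) (bound := fun _ => M) (mem_interior_iff_mem_nhds.1 hKa) ?_ ?_ ?_ ?_ ?_ ?_
      · filter_upwards [hU.mem_nhds ha] with x hx
        exact (hslice x hx).aestronglyMeasurable
      · exact (hslice a ha).intervalIntegrable _ _
      · exact (hslice' a ha).aestronglyMeasurable
      · refine Eventually.of_forall fun t ht x hx => ?_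
        rw [uIoc_of_le zero_le_one] at ht
        exact hM (x, t) ⟨hx, ht.1.le, ht.2⟩
      · exact intervalIntegrable_const
      · exact Eventually.of_forall fun t _ x hx => hd x (hKU hx) t
    have h2 := ih hg'
    push_cast
    rw [contDiffOn_succ_iff_fderiv_of_isOpen hU]
    refine ⟨fun a ha => (key a ha).differentiableAt.differentiableWithinAt, by simp, ?_⟩
    exact h2.congr fun a ha => (key a ha).fderiv

theorem contDiffOn_integral_unit {E : Type} [NormedAddCommGroup E] [NormedSpace ℝ E]
    [FiniteDimensional ℝ E] {U : Set E} (hU : IsOpen U) {g : E → ℝ → ℝ}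
    (hg : ContDiffOn ℝ ∞ (Function.uncurry g) (U ×ˢ univ)) :
    ContDiffOn ℝ ∞ (fun a => ∫ t in (0:ℝ)..1, g a t) U := by
  rw [contDiffOn_infty]
  intro n
  exact contDiffOn_integral_unit_aux hU n (hg.of_le (by exact_mod_cast le_top))

/-- The substitution `t = s T` reduces a primitive to a parametric integral over `[0, 1]`. -/
theorem contDiffOn_primitive {E : Type} [NormedAddCommGroup E] [NormedSpace ℝ E]
    [FiniteDimensional ℝ E] {U : Set E} (hU : IsOpen U) {g : E → ℝ → ℝ}
    (hg : ContDiffOn ℝ ∞ (Function.uncurry g) (U ×ˢ univ)) :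
    ContDiffOn ℝ ∞ (fun p : E × ℝ => ∫ t in (0:ℝ)..p.2, g p.1 t) (U ×ˢ univ) := by
  have h1 : ContDiffOn ℝ ∞ (fun p : E × ℝ => ∫ s in (0:ℝ)..1, p.2 * g p.1 (p.2 * s))
      (U ×ˢ univ) := by
    refine contDiffOn_integral_unit (hU.prod isOpen_univ) ?_
    have : Function.uncurry (fun (p : E × ℝ) (s : ℝ) => p.2 * g p.1 (p.2 * s)) =
      fun q : (E × ℝ) × ℝ => q.1.2 * Function.uncurry g (q.1.1, q.1.2 * q.2) := by
      ext q; rfl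
    rw [this]
    refine ContDiffOn.mul (by fun_prop) (hg.comp (by fun_prop) ?_)
    rintro ⟨⟨a, b⟩, c⟩ ⟨⟨ha, -⟩, -⟩
    exact ⟨ha, mem_univ _⟩
  refine h1.congr ?_
  rintro ⟨a, b⟩ -
  simp [intervalIntegral.integral_const_mul]

/-- The inverse function theorem in fibres: if `∂g/∂t` does not vanish, then an inverse
`(a, r) ↦ (a, k (a, r))` of the map `(a, t) ↦ (a, g (a, t))` is smooth on an open set. -/
theorem fiber_inverse {E : Type} [NormedAddCommGroup E] [NormedSpace ℝ E] [CompleteSpace E]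
    {O O' : Set (E × ℝ)} (hO : IsOpen O) {g k : E × ℝ → ℝ} (hg : ContDiffOn ℝ ∞ g O)
    (hg' : ∀ a t, (a, t) ∈ O → fderiv ℝ g (a, t) (0, 1) ≠ 0)
    (hk : ∀ a r, (a, r) ∈ O' → (a, k (a, r)) ∈ O ∧ g (a, k (a, r)) = r)
    (hu : ∀ a t, (a, t) ∈ O → (a, g (a, t)) ∈ O' ∧ k (a, g (a, t)) = t) :
    IsOpen O' ∧ ContDiffOn ℝ ∞ k O' := by
  have key : ∀ q ∈ O', O' ∈ 𝓝 q ∧ ContDiffAt ℝ ∞ k q := by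
    rintro ⟨a, r⟩ hq
    obtain ⟨h1, h2⟩ := hk a r hq
    set t := k (a, r) with ht
    have hga : ContDiffAt ℝ ∞ g (a, t) := hg.contDiffAt (hO.mem_nhds h1)
    set L := fderiv ℝ g (a, t) with hL
    have hLd : HasFDerivAt g L (a, t) := (hga.differentiableAt (by simp)).hasFDerivAt
    set d := L (0, 1) with hd
    have hd0 : d ≠ 0 := hg' a t h1
    have hsplit : ∀ v : E × ℝ, L v = L (v.1, 0) + v.2 * d := by
      intro v
      have : v = (v.1, 0) + v.2 • ((0 : E), (1:ℝ)) := by ext <;> simp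
      conv_lhs => rw [this, map_add, map_smul]
      simp [hd]
    let e : (E × ℝ) ≃L[ℝ] (E × ℝ) := ContinuousLinearEquiv.equivOfInverse
      ((ContinuousLinearMap.fst ℝ E ℝ).prod L)
      ((ContinuousLinearMap.fst ℝ E ℝ).prod
        (d⁻¹ • (ContinuousLinearMap.snd ℝ E ℝ -
          (L.comp (ContinuousLinearMap.inl ℝ E ℝ)).comp (ContinuousLinearMap.fst ℝ E ℝ))))
      (fun v => by
        refine Prod.ext rfl ?_
        simp only [ContinuousLinearMap.prod_apply, _root_.smul_apply,
          _root_.sub_apply, ContinuousLinearMap.coe_snd', ContinuousLinearMap.comp_apply,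
          ContinuousLinearMap.coe_fst', ContinuousLinearMap.inl_apply, smul_eq_mul]
        rw [hsplit v]; field_simp; ring)
      (fun v => by
        refine Prod.ext rfl ?_
        simp only [ContinuousLinearMap.prod_apply, _root_.smul_apply,
          _root_.sub_apply, ContinuousLinearMap.coe_snd', ContinuousLinearMap.comp_apply,
          ContinuousLinearMap.coe_fst', ContinuousLinearMap.inl_apply, smul_eq_mul]
        rw [hsplit]; field_simp; ring)
    have hG : ContDiffAt ℝ ∞ (fun q : E × ℝ => (q.1, g q)) (a, t) := contDiffAt_fst.prodMk hga
    have hGd : HasFDerivAt (fun q : E × ℝ => (q.1, g q)) (e : (E × ℝ) →L[ℝ] (E × ℝ)) (a, t) :=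
      (hasFDerivAt_fst).prodMk hLd
    set Φ := hG.toOpenPartialHomeomorph _ hGd (by simp) with hΦ
    have hsrc : (a, t) ∈ Φ.source := hG.mem_toOpenPartialHomeomorph_source hGd (by simp)
    have hcoe : ∀ q, Φ q = (q.1, g q) := fun q => rfl
    have htgt : (a, r) ∈ Φ.target := by
      have := Φ.map_source hsrc
      rwa [hcoe, h2] at this
    have hsymm : Φ.symm (a, r) = (a, t) := by
      have := Φ.left_inv hsrc
      rwa [hcoe, h2] at this
    have hinv : ContDiffAt ℝ ∞ Φ.symm (a, r) := by
      refine Φ.contDiffAt_symm (f₀' := e) htgt ?_ ?_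
      · rw [hsymm]; exact hGd
      · rw [hsymm]; exact hG
    have hev : ∀ᶠ q in 𝓝 (a, r), q ∈ Φ.target ∧ Φ.symm q ∈ O := by
      refine Filter.Eventually.and (Φ.open_target.mem_nhds htgt) ?_
      refine hinv.continuousAt.preimage_mem_nhds ?_
      rw [hsymm]; exact hO.mem_nhds h1
    have hev2 : ∀ᶠ q in 𝓝 (a, r), q ∈ O' ∧ k q = (Φ.symm q).2 := by
      filter_upwards [hev] with q hq
      have h3 := Φ.right_inv hq.1
      rw [hcoe] at h3
      have h4 := hu (Φ.symm q).1 (Φ.symm q).2 hq.2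
      rw [Prod.mk.eta, h3] at h4
      exact h4
    refine ⟨hev2.mono fun q hq => hq.1, ?_⟩
    exact (contDiffAt_snd.comp _ hinv).congr_of_eventuallyEq (hev2.mono fun q hq => hq.2)
  exact ⟨isOpen_iff_mem_nhds.2 fun q hq => (key q hq).1,
    fun q hq => (key q hq).2.contDiffWithinAt⟩

/-! ### Rotation invariants and Darboux coordinates on the regular part of phase space -/

/-- The inner product `p · q`. -/
def dot (z : Phase) : ℝ := z.1 0 * z.2 0 + z.1 1 * z.2 1

/-- The angular momentum `p₁ q₂ - p₂ q₁`. -/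
def ang (z : Phase) : ℝ := z.1 0 * z.2 1 - z.1 1 * z.2 0

/-- The squared length of `p`. -/
def sqP (z : Phase) : ℝ := z.1 0 ^ 2 + z.1 1 ^ 2

/-- The squared length of `q`. -/
def sqQ (z : Phase) : ℝ := z.2 0 ^ 2 + z.2 1 ^ 2

theorem ang_sq_add_dot_sq (z : Phase) : ang z ^ 2 + dot z ^ 2 = sqP z * sqQ z := by
  simp only [ang, dot, sqP, sqQ]; ring

theorem sqP_nonneg (z : Phase) : 0 ≤ sqP z := by unfold sqP; positivity

theorem sqQ_nonneg (z : Phase) : 0 ≤ sqQ z := by unfold sqQ; positivity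

theorem norm_fst_sq (z : Phase) : ‖z.1‖ ^ 2 = sqP z := by
  rw [EuclideanSpace.real_norm_sq_eq, Fin.sum_univ_two]; rfl

theorem norm_snd_sq (z : Phase) : ‖z.2‖ ^ 2 = sqQ z := by
  rw [EuclideanSpace.real_norm_sq_eq, Fin.sum_univ_two]; rfl

theorem mem_bidisk_iff {z : Phase} : z ∈ bidisk ↔ sqP z ≤ 1 ∧ sqQ z ≤ 1 := by
  rw [← norm_fst_sq, ← norm_snd_sq, sq_le_one_iff₀ (norm_nonneg _), sq_le_one_iff₀ (norm_nonneg _)]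
  rfl

theorem mem_openBidisk_iff {z : Phase} : z ∈ openBidisk ↔ sqP z < 1 ∧ sqQ z < 1 := by
  rw [← norm_fst_sq, ← norm_snd_sq, sq_lt_one_iff₀ (norm_nonneg _), sq_lt_one_iff₀ (norm_nonneg _)]
  rfl

theorem contDiff_fst_coord (i : Fin 2) : ContDiff ℝ ∞ fun z : Phase => z.1 i :=
  (contDiff_euclidean.1 contDiff_fst) i

theorem contDiff_snd_coord (i : Fin 2) : ContDiff ℝ ∞ fun z : Phase => z.2 i :=
  (contDiff_euclidean.1 contDiff_snd) i

theorem contDiff_dot : ContDiff ℝ ∞ dot :=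
  ((contDiff_fst_coord 0).mul (contDiff_snd_coord 0)).add
    ((contDiff_fst_coord 1).mul (contDiff_snd_coord 1))

theorem contDiff_ang : ContDiff ℝ ∞ ang :=
  ((contDiff_fst_coord 0).mul (contDiff_snd_coord 1)).sub
    ((contDiff_fst_coord 1).mul (contDiff_snd_coord 0))

theorem contDiff_sqP : ContDiff ℝ ∞ sqP :=
  ((contDiff_fst_coord 0).pow 2).add ((contDiff_fst_coord 1).pow 2)

theorem contDiff_sqQ : ContDiff ℝ ∞ sqQ :=
  ((contDiff_snd_coord 0).pow 2).add ((contDiff_snd_coord 1).pow 2)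

theorem isOpen_openBidisk : IsOpen openBidisk := by
  have : openBidisk = {z | sqP z < 1} ∩ {z | sqQ z < 1} := by
    ext z; exact mem_openBidisk_iff
  rw [this]
  exact (isOpen_lt contDiff_sqP.continuous continuous_const).inter
    (isOpen_lt contDiff_sqQ.continuous continuous_const)

theorem isCompact_bidisk : IsCompact bidisk := by
  have : bidisk = Metric.closedBall (0 : Plane) 1 ×ˢ Metric.closedBall (0 : Plane) 1 := by
    ext z; simp [bidisk]
  rw [this]
  exact (isCompact_closedBall _ _).prod (isCompact_closedBall _ _)

/-- The point of phase space with given coordinates. -/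
def mkPhase (p₀ p₁ q₀ q₁ : ℝ) : Phase := (!₂[p₀, p₁], !₂[q₀, q₁])

@[simp] theorem mkPhase_p0 (a b c d : ℝ) : (mkPhase a b c d).1 0 = a := rfl
@[simp] theorem mkPhase_p1 (a b c d : ℝ) : (mkPhase a b c d).1 1 = b := rfl
@[simp] theorem mkPhase_q0 (a b c d : ℝ) : (mkPhase a b c d).2 0 = c := rfl
@[simp] theorem mkPhase_q1 (a b c d : ℝ) : (mkPhase a b c d).2 1 = d := rfl

theorem phase_ext {z w : Phase} (h1 : z.1 0 = w.1 0) (h2 : z.1 1 = w.1 1) (h3 : z.2 0 = w.2 0)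
    (h4 : z.2 1 = w.2 1) : z = w := by
  refine Prod.ext ?_ ?_ <;> ext i <;> fin_cases i <;> assumption

section
variable {E : Type} [NormedAddCommGroup E] [NormedSpace ℝ E]

theorem contDiffWithinAt_mkPhase {a b c d : E → ℝ} {s : Set E} {e : E} {n : WithTop ℕ∞}
    (ha : ContDiffWithinAt ℝ n a s e)
    (hb : ContDiffWithinAt ℝ n b s e) (hc : ContDiffWithinAt ℝ n c s e)
    (hd : ContDiffWithinAt ℝ n d s e) :
    ContDiffWithinAt ℝ n (fun e => mkPhase (a e) (b e) (c e) (d e)) s e := by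
  refine ContDiffWithinAt.prodMk ?_ ?_ <;> rw [contDiffWithinAt_euclidean] <;> intro i <;>
    fin_cases i <;> assumption

theorem fderiv_fst_coord {Ψ : E → Phase} {e : E} (h : DifferentiableAt ℝ Ψ e) (i : Fin 2) (v : E) :
    (fderiv ℝ Ψ e v).1 i = fderiv ℝ (fun e => (Ψ e).1 i) e v := by
  have h1 : HasFDerivAt (fun z : Phase => z.1 i)
      ((EuclideanSpace.proj i).comp (ContinuousLinearMap.fst ℝ Plane Plane)) (Ψ e) :=
    ((EuclideanSpace.proj (𝕜 := ℝ) (ι := Fin 2) i).comp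
      (ContinuousLinearMap.fst ℝ Plane Plane)).hasFDerivAt
  have h2 := h1.comp e h.hasFDerivAt
  exact (congrArg (fun L => L v) h2.fderiv).symm

theorem fderiv_snd_coord {Ψ : E → Phase} {e : E} (h : DifferentiableAt ℝ Ψ e) (i : Fin 2) (v : E) :
    (fderiv ℝ Ψ e v).2 i = fderiv ℝ (fun e => (Ψ e).2 i) e v := by
  have h1 : HasFDerivAt (fun z : Phase => z.2 i)
      ((EuclideanSpace.proj i).comp (ContinuousLinearMap.snd ℝ Plane Plane)) (Ψ e) :=
    ((EuclideanSpace.proj (𝕜 := ℝ) (ι := Fin 2) i).comp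
      (ContinuousLinearMap.snd ℝ Plane Plane)).hasFDerivAt
  have h2 := h1.comp e h.hasFDerivAt
  exact (congrArg (fun L => L v) h2.fderiv).symm

/-- The real part of the square root of `-(y + i j)`, where `y + i j` avoids the half line
`y ≥ 0, j = 0`. -/
def rootRe (y j : ℝ) : ℝ := √((√(y ^ 2 + j ^ 2) - y) / 2)

/-- The imaginary part of the square root of `-(y + i j)`. -/
def rootIm (y j : ℝ) : ℝ := -j / (2 * rootRe y j)

theorem slit_pos {y j : ℝ} (h : y < 0 ∨ j ≠ 0) : 0 < y ^ 2 + j ^ 2 := by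
  rcases h with h | h
  · have := mul_pos_of_neg_of_neg h h; nlinarith [sq_nonneg j]
  · have := pow_pos (abs_pos.2 h) 2; rw [sq_abs] at this; nlinarith [sq_nonneg y]

theorem slit_sub_pos {y j : ℝ} (h : y < 0 ∨ j ≠ 0) : 0 < √(y ^ 2 + j ^ 2) - y := by
  rcases h with h | h
  · have := Real.sqrt_nonneg (y ^ 2 + j ^ 2); linarith
  · have : y < √(y ^ 2 + j ^ 2) := by
      refine Real.lt_sqrt_of_sq_lt ?_
      have := pow_pos (abs_pos.2 h) 2; rw [sq_abs] at this; linarith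
    linarith

theorem rootRe_pos {y j : ℝ} (h : y < 0 ∨ j ≠ 0) : 0 < rootRe y j :=
  Real.sqrt_pos.2 (half_pos (slit_sub_pos h))

theorem rootRe_sq {y j : ℝ} (h : y < 0 ∨ j ≠ 0) : rootRe y j ^ 2 = (√(y ^ 2 + j ^ 2) - y) / 2 :=
  Real.sq_sqrt (half_pos (slit_sub_pos h)).le

theorem rootRe_mul_rootIm {y j : ℝ} (h : y < 0 ∨ j ≠ 0) : -2 * rootRe y j * rootIm y j = j := by
  have := rootRe_pos h
  unfold rootIm; field_simp

theorem rootIm_sq {y j : ℝ} (h : y < 0 ∨ j ≠ 0) : rootIm y j ^ 2 = (√(y ^ 2 + j ^ 2) + y) / 2 := by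
  have h1 := rootRe_mul_rootIm h
  have h2 := rootRe_sq h
  have h3 := Real.sq_sqrt (slit_pos h).le
  have h4 := slit_sub_pos h
  have h5 : rootRe y j ^ 2 * rootIm y j ^ 2 * 4 = j ^ 2 := by
    calc _ = (-2 * rootRe y j * rootIm y j) ^ 2 := by ring
      _ = _ := by rw [h1]
  rw [h2] at h5
  have : (√(y ^ 2 + j ^ 2) - y) * (rootIm y j ^ 2 - (√(y ^ 2 + j ^ 2) + y) / 2) = 0 := by
    nlinarith
  rcases mul_eq_zero.1 this with h6 | h6 <;> linarith

theorem rootIm_sq_sub {y j : ℝ} (h : y < 0 ∨ j ≠ 0) : rootIm y j ^ 2 - rootRe y j ^ 2 = y := by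
  rw [rootIm_sq h, rootRe_sq h]; ring

theorem isOpen_slit : IsOpen {q : ℝ × ℝ | q.1 < 0 ∨ q.2 ≠ 0} :=
  (isOpen_lt continuous_fst continuous_const).union
    (isOpen_ne_fun continuous_snd continuous_const)

theorem contDiffWithinAt_rootRe {y j : E → ℝ} {s : Set E} {e : E} (hy : ContDiffWithinAt ℝ ∞ y s e)
    (hj : ContDiffWithinAt ℝ ∞ j s e) (h : y e < 0 ∨ j e ≠ 0) :
    ContDiffWithinAt ℝ ∞ (fun e => rootRe (y e) (j e)) s e := by
  unfold rootRe
  refine ContDiffWithinAt.sqrt (((ContDiffWithinAt.sqrt ((hy.pow 2).add (hj.pow 2))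
    (slit_pos h).ne').sub hy).div_const 2) (half_pos (slit_sub_pos h)).ne'

theorem contDiffWithinAt_rootIm {y j : E → ℝ} {s : Set E} {e : E} (hy : ContDiffWithinAt ℝ ∞ y s e)
    (hj : ContDiffWithinAt ℝ ∞ j s e) (h : y e < 0 ∨ j e ≠ 0) :
    ContDiffWithinAt ℝ ∞ (fun e => rootIm (y e) (j e)) s e := by
  unfold rootIm
  exact hj.neg.div (contDiffWithinAt_const.mul (contDiffWithinAt_rootRe hy hj h))
    (mul_pos two_pos (rootRe_pos h)).ne'

/-- The point `p = eˣ ζ̄ e^{iα}`, `q = -e⁻ˣ ζ e^{iα}` for `ζ = a + i d`. -/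
def liftRoot (x a d α : ℝ) : Phase :=
  mkPhase (Real.exp x * (a * Real.cos α + d * Real.sin α))
    (Real.exp x * (a * Real.sin α - d * Real.cos α))
    (-(Real.exp (-x) * (a * Real.cos α - d * Real.sin α)))
    (-(Real.exp (-x) * (a * Real.sin α + d * Real.cos α)))

/-- Darboux coordinates `(x, y, j, α)` on the set where `p · q < 0` or the angular momentum does not
vanish: `y = p · q`, `j` is the angular momentum, `x = log (|p| / |q|) / 2`, and `α` is the angle
of the simultaneous rotation. -/
def lift (x y j α : ℝ) : Phase := liftRoot x (rootRe y j) (rootIm y j) α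

theorem contDiffWithinAt_lift {x y j α : E → ℝ} {s : Set E} {e : E}
    (hx : ContDiffWithinAt ℝ ∞ x s e) (hy : ContDiffWithinAt ℝ ∞ y s e)
    (hj : ContDiffWithinAt ℝ ∞ j s e) (hα : ContDiffWithinAt ℝ ∞ α s e)
    (h : y e < 0 ∨ j e ≠ 0) :
    ContDiffWithinAt ℝ ∞ (fun e => lift (x e) (y e) (j e) (α e)) s e := by
  have ha := contDiffWithinAt_rootRe hy hj h
  have hd := contDiffWithinAt_rootIm hy hj h
  unfold lift liftRoot
  refine contDiffWithinAt_mkPhase ?_ ?_ ?_ ?_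
  · exact hx.exp.mul ((ha.mul hα.cos).add (hd.mul hα.sin))
  · exact hx.exp.mul ((ha.mul hα.sin).sub (hd.mul hα.cos))
  · exact (hx.neg.exp.mul ((ha.mul hα.cos).sub (hd.mul hα.sin))).neg
  · exact (hx.neg.exp.mul ((ha.mul hα.sin).add (hd.mul hα.cos))).neg

/-- The map `liftRoot` pulls back `ω` to `dx ∧ dy + dα ∧ dj`, where `y + i j = -ζ²`. -/
theorem omega_fderiv_liftRoot {x a d α : E → ℝ} {e : E} (hx : DifferentiableAt ℝ x e)
    (ha : DifferentiableAt ℝ a e) (hd : DifferentiableAt ℝ d e) (hα : DifferentiableAt ℝ α e)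
    (hΨ : DifferentiableAt ℝ (fun e => liftRoot (x e) (a e) (d e) (α e)) e) (v w : E) :
    omega (fderiv ℝ (fun e => liftRoot (x e) (a e) (d e) (α e)) e v)
      (fderiv ℝ (fun e => liftRoot (x e) (a e) (d e) (α e)) e w) =
    (fderiv ℝ x e v * (2 * d e * fderiv ℝ d e w - 2 * a e * fderiv ℝ a e w) -
      fderiv ℝ x e w * (2 * d e * fderiv ℝ d e v - 2 * a e * fderiv ℝ a e v)) +
    (fderiv ℝ α e v * (-2 * (a e * fderiv ℝ d e w + d e * fderiv ℝ a e w)) -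
      fderiv ℝ α e w * (-2 * (a e * fderiv ℝ d e v + d e * fderiv ℝ a e v))) := by
  have hx' := hx.hasFDerivAt
  have ha' := ha.hasFDerivAt
  have hd' := hd.hasFDerivAt
  have hα' := hα.hasFDerivAt
  have e1 := (hx'.exp.mul ((ha'.mul hα'.cos).add (hd'.mul hα'.sin))).fderiv
  have e2 := (hx'.exp.mul ((ha'.mul hα'.sin).sub (hd'.mul hα'.cos))).fderiv
  have e3 := (hx'.neg.exp.mul ((ha'.mul hα'.cos).sub (hd'.mul hα'.sin))).neg.fderiv
  have e4 := (hx'.neg.exp.mul ((ha'.mul hα'.sin).add (hd'.mul hα'.cos))).neg.fderiv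
  unfold omega
  rw [fderiv_fst_coord hΨ, fderiv_fst_coord hΨ, fderiv_fst_coord hΨ, fderiv_fst_coord hΨ,
    fderiv_snd_coord hΨ, fderiv_snd_coord hΨ, fderiv_snd_coord hΨ, fderiv_snd_coord hΨ]
  simp only [liftRoot, mkPhase_p0, mkPhase_p1, mkPhase_q0, mkPhase_q1]
  have f1 : fderiv ℝ (fun e => Real.exp (x e) * (a e * Real.cos (α e) + d e * Real.sin (α e))) e =
    _ := e1
  have f2 : fderiv ℝ (fun e => Real.exp (x e) * (a e * Real.sin (α e) - d e * Real.cos (α e))) e =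
    _ := e2
  have f3 : fderiv ℝ (fun e => -(Real.exp (-x e) * (a e * Real.cos (α e) - d e * Real.sin (α e))))
    e = _ := e3
  have f4 : fderiv ℝ (fun e => -(Real.exp (-x e) * (a e * Real.sin (α e) + d e * Real.cos (α e))))
    e = _ := e4
  rw [f1, f2, f3, f4]
  simp only [_root_.add_apply, _root_.smul_apply, _root_.sub_apply, _root_.neg_apply, smul_eq_mul,
    Pi.add_apply, Pi.mul_apply, Pi.sub_apply, Pi.neg_apply]
  have hE : Real.exp (x e) * Real.exp (-x e) = 1 := by rw [← Real.exp_add]; simp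
  have hcs := Real.sin_sq_add_cos_sq (α e)
  generalize Real.exp (x e) = X at *
  generalize Real.exp (-x e) = Y at *
  generalize Real.cos (α e) = c at *
  generalize Real.sin (α e) = s at *
  set R := (fderiv ℝ x e v * (2 * d e * fderiv ℝ d e w - 2 * a e * fderiv ℝ a e w) -
      fderiv ℝ x e w * (2 * d e * fderiv ℝ d e v - 2 * a e * fderiv ℝ a e v)) +
    (fderiv ℝ α e v * (-2 * (a e * fderiv ℝ d e w + d e * fderiv ℝ a e w)) -
      fderiv ℝ α e w * (-2 * (a e * fderiv ℝ d e v + d e * fderiv ℝ a e v))) with hR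
  linear_combination R * (s ^ 2 + c ^ 2) * hE + R * hcs

/-- The Darboux property of `lift`: it pulls `ω` back to `dx ∧ dy + dα ∧ dj`. -/
theorem omega_fderiv_lift {x y j α : E → ℝ} {e : E} (hx : ContDiffAt ℝ ∞ x e)
    (hy : ContDiffAt ℝ ∞ y e) (hj : ContDiffAt ℝ ∞ j e) (hα : ContDiffAt ℝ ∞ α e)
    (h : y e < 0 ∨ j e ≠ 0) (v w : E) :
    omega (fderiv ℝ (fun e => lift (x e) (y e) (j e) (α e)) e v)
      (fderiv ℝ (fun e => lift (x e) (y e) (j e) (α e)) e w) =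
    (fderiv ℝ x e v * fderiv ℝ y e w - fderiv ℝ x e w * fderiv ℝ y e v) +
    (fderiv ℝ α e v * fderiv ℝ j e w - fderiv ℝ α e w * fderiv ℝ j e v) := by
  have ha : ContDiffAt ℝ ∞ (fun e => rootRe (y e) (j e)) e := contDiffWithinAt_rootRe hy hj h
  have hd : ContDiffAt ℝ ∞ (fun e => rootIm (y e) (j e)) e := contDiffWithinAt_rootIm hy hj h
  have hΨ : ContDiffAt ℝ ∞ (fun e => lift (x e) (y e) (j e) (α e)) e :=
    contDiffWithinAt_lift hx hy hj hα h
  have hev : ∀ᶠ e' in 𝓝 e, y e' < 0 ∨ j e' ≠ 0 :=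
    (hy.continuousAt.prodMk hj.continuousAt).preimage_mem_nhds (isOpen_slit.mem_nhds h)
  have ha' := ha.differentiableAt (by simp)
  have hd' := hd.differentiableAt (by simp)
  have e1 : fderiv ℝ y e = fderiv ℝ (fun e => rootIm (y e) (j e) ^ 2 - rootRe (y e) (j e) ^ 2) e :=
    Filter.EventuallyEq.fderiv_eq (hev.mono fun e' h' => (rootIm_sq_sub h').symm)
  have e2 : fderiv ℝ j e = fderiv ℝ (fun e => -2 * (rootRe (y e) (j e) * rootIm (y e) (j e))) e :=
    Filter.EventuallyEq.fderiv_eq (hev.mono fun e' h' => by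
      have := rootRe_mul_rootIm h'; simp only; linarith)
  have e3 := ((hd'.hasFDerivAt.pow 2).sub (ha'.hasFDerivAt.pow 2)).fderiv
  have e4 := ((ha'.hasFDerivAt.mul hd'.hasFDerivAt).const_mul (-2)).fderiv
  have e5 : fderiv ℝ y e = _ := e1.trans e3
  have e6 : fderiv ℝ j e = _ := e2.trans e4
  have := omega_fderiv_liftRoot (hx.differentiableAt (by simp)) ha' hd'
    (hα.differentiableAt (by simp)) (hΨ.differentiableAt (by simp)) v w
  unfold lift
  rw [this, e5, e6]
  simp only [_root_.add_apply, _root_.smul_apply, _root_.sub_apply, smul_eq_mul]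
  norm_num

end

theorem dot_liftRoot (x a d α : ℝ) : dot (liftRoot x a d α) = d ^ 2 - a ^ 2 := by
  have hE : Real.exp x * Real.exp (-x) = 1 := by rw [← Real.exp_add]; simp
  have hcs := Real.sin_sq_add_cos_sq α
  simp only [dot, liftRoot, mkPhase_p0, mkPhase_p1, mkPhase_q0, mkPhase_q1]
  linear_combination (d ^ 2 - a ^ 2) * (Real.sin α ^ 2 + Real.cos α ^ 2) * hE +
    (d ^ 2 - a ^ 2) * hcs

theorem ang_liftRoot (x a d α : ℝ) : ang (liftRoot x a d α) = -2 * a * d := by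
  have hE : Real.exp x * Real.exp (-x) = 1 := by rw [← Real.exp_add]; simp
  have hcs := Real.sin_sq_add_cos_sq α
  simp only [ang, liftRoot, mkPhase_p0, mkPhase_p1, mkPhase_q0, mkPhase_q1]
  linear_combination (-2 * a * d) * (Real.sin α ^ 2 + Real.cos α ^ 2) * hE +
    (-2 * a * d) * hcs

theorem dot_lift {y j : ℝ} (h : y < 0 ∨ j ≠ 0) (x α : ℝ) : dot (lift x y j α) = y := by
  rw [lift, dot_liftRoot, rootIm_sq_sub h]

theorem ang_lift {y j : ℝ} (h : y < 0 ∨ j ≠ 0) (x α : ℝ) : ang (lift x y j α) = j := by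
  rw [lift, ang_liftRoot, rootRe_mul_rootIm h]

theorem rootRe_sq_add {y j : ℝ} (h : y < 0 ∨ j ≠ 0) :
    rootRe y j ^ 2 + rootIm y j ^ 2 = √(y ^ 2 + j ^ 2) := by
  rw [rootRe_sq h, rootIm_sq h]; ring

theorem sqP_lift {y j : ℝ} (h : y < 0 ∨ j ≠ 0) (x α : ℝ) :
    sqP (lift x y j α) = √(y ^ 2 + j ^ 2) * Real.exp (2 * x) := by
  have hE : Real.exp (2 * x) = Real.exp x ^ 2 := by rw [← Real.exp_nat_mul]; norm_num
  have hcs := Real.sin_sq_add_cos_sq α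
  rw [← rootRe_sq_add h, hE]
  simp only [sqP, lift, liftRoot, mkPhase_p0, mkPhase_p1]
  linear_combination (rootRe y j ^ 2 + rootIm y j ^ 2) * Real.exp x ^ 2 * hcs

theorem sqQ_lift {y j : ℝ} (h : y < 0 ∨ j ≠ 0) (x α : ℝ) :
    sqQ (lift x y j α) = √(y ^ 2 + j ^ 2) * Real.exp (-(2 * x)) := by
  have hE : Real.exp (-(2 * x)) = Real.exp (-x) ^ 2 := by
    rw [← Real.exp_nat_mul]; norm_num
  have hcs := Real.sin_sq_add_cos_sq α
  rw [← rootRe_sq_add h, hE]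
  simp only [sqQ, lift, liftRoot, mkPhase_q0, mkPhase_q1]
  linear_combination (rootRe y j ^ 2 + rootIm y j ^ 2) * Real.exp (-x) ^ 2 * hcs

/-- Two points with the same `p ≠ 0`, inner product and angular momentum coincide. -/
theorem eq_of_fst_eq {z w : Phase} (h0 : z.1 0 = w.1 0) (h1 : z.1 1 = w.1 1) (hp : sqP z ≠ 0)
    (hd : dot z = dot w) (ha : ang z = ang w) : z = w := by
  unfold dot ang at *
  rw [← h0, ← h1] at hd ha
  unfold sqP at hp
  refine phase_ext h0 h1 ?_ ?_ <;> refine mul_left_cancel₀ hp ?_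
  · linear_combination z.1 0 * hd - z.1 1 * ha
  · linear_combination z.1 1 * hd + z.1 0 * ha

theorem exists_cos_sin {c s : ℝ} (h : c ^ 2 + s ^ 2 = 1) :
    ∃ α, Real.cos α = c ∧ Real.sin α = s := by
  have hn : ‖(⟨c, s⟩ : ℂ)‖ = 1 := by
    rw [Complex.norm_def, Complex.normSq_mk, Real.sqrt_eq_one]; linarith
  refine ⟨Complex.arg ⟨c, s⟩, ?_, ?_⟩
  · rw [Complex.cos_arg (by intro h0; simp [h0] at hn), hn, div_one]
  · rw [Complex.sin_arg, hn, div_one]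

/-- The map `lift` is onto the set where `p · q < 0` or the angular momentum does not vanish: there
`x` is a function of the rotation invariants, and a point is determined by these up to a rotation.
-/
theorem exists_lift_eq {z : Phase} (h : dot z < 0 ∨ ang z ≠ 0) : ∃ α,
    lift (Real.arsinh ((sqP z - sqQ z) / 2 / √(dot z ^ 2 + ang z ^ 2)) / 2) (dot z) (ang z) α
      = z := by
  set k := √(dot z ^ 2 + ang z ^ 2) with hk
  have hkpos : 0 < k := Real.sqrt_pos.2 (slit_pos h)
  have hk2 : k ^ 2 = sqP z * sqQ z := by
    rw [← ang_sq_add_dot_sq, hk, Real.sq_sqrt (slit_pos h).le]; ring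
  set x := Real.arsinh ((sqP z - sqQ z) / 2 / k) / 2 with hx
  have hE : Real.exp (2 * x) = sqP z / k := by
    rw [hx, mul_div_cancel₀ _ two_ne_zero, Real.exp_arsinh]
    have h1 : 1 + ((sqP z - sqQ z) / 2 / k) ^ 2 = ((sqP z + sqQ z) / 2 / k) ^ 2 := by
      field_simp; rw [hk2]; ring
    rw [h1, Real.sqrt_sq (by have := sqP_nonneg z; have := sqQ_nonneg z; positivity)]
    field_simp; ring
  have hE2 : Real.exp x ^ 2 = sqP z / k := by rw [← hE, ← Real.exp_nat_mul]; norm_num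
  have hEpos := Real.exp_pos x
  have hP : sqP z ≠ 0 := by
    intro h0; rw [h0, zero_mul] at hk2; exact hkpos.ne' (pow_eq_zero_iff two_ne_zero |>.1 hk2)
  set a := rootRe (dot z) (ang z)
  set d := rootIm (dot z) (ang z)
  have had : a ^ 2 + d ^ 2 = k := rootRe_sq_add h
  obtain ⟨α, hc, hs⟩ := exists_cos_sin (c := (a * z.1 0 - d * z.1 1) / (Real.exp x * k))
    (s := (d * z.1 0 + a * z.1 1) / (Real.exp x * k)) (by
      rw [div_pow, div_pow, ← add_div, div_eq_one_iff_eq (by positivity), mul_pow, hE2,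
        show (a * z.1 0 - d * z.1 1) ^ 2 + (d * z.1 0 + a * z.1 1) ^ 2 = (a ^ 2 + d ^ 2) * sqP z by
          unfold sqP; ring, had]
      field_simp)
  refine ⟨α, (eq_of_fst_eq ?_ ?_ hP ?_ ?_).symm⟩
  · simp only [lift, liftRoot, mkPhase_p0, hc, hs]
    change _ = Real.exp x * (a * _ + d * _)
    field_simp
    rw [← had]; ring
  · simp only [lift, liftRoot, mkPhase_p1, hc, hs]
    change _ = Real.exp x * (a * _ - d * _)
    field_simp
    rw [← had]; ring
  · rw [dot_lift h]
  · rw [ang_lift h]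

theorem lift_eq_lift_iff {y j : ℝ} (h : y < 0 ∨ j ≠ 0) (x α α' : ℝ) :
    lift x y j α = lift x y j α' ↔ ∃ n : ℤ, α' = α + 2 * Real.pi * n := by
  constructor
  · intro he
    have h0 : (lift x y j α).1 0 = (lift x y j α').1 0 := by rw [he]
    have h1 : (lift x y j α).1 1 = (lift x y j α').1 1 := by rw [he]
    simp only [lift, liftRoot, mkPhase_p0, mkPhase_p1] at h0 h1
    have h2 := mul_left_cancel₀ (Real.exp_pos x).ne' h0
    have h3 := mul_left_cancel₀ (Real.exp_pos x).ne' h1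
    have hk : rootRe y j ^ 2 + rootIm y j ^ 2 ≠ 0 := by
      rw [rootRe_sq_add h]; exact (Real.sqrt_pos.2 (slit_pos h)).ne'
    have hc : Real.cos α' = Real.cos α := by
      refine mul_left_cancel₀ hk ?_
      linear_combination rootIm y j * h3 - rootRe y j * h2
    have hs : Real.sin α' = Real.sin α := by
      refine mul_left_cancel₀ hk ?_
      linear_combination -rootIm y j * h2 - rootRe y j * h3
    obtain ⟨n, hn⟩ := Real.Angle.angle_eq_iff_two_pi_dvd_sub.1 (Real.Angle.cos_sin_inj hc hs)
    exact ⟨n, by linarith⟩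
  · rintro ⟨n, rfl⟩
    have hc : Real.cos (α + 2 * Real.pi * n) = Real.cos α := by
      rw [mul_comm (2 * Real.pi)]; exact Real.cos_add_int_mul_two_pi α n
    have hs : Real.sin (α + 2 * Real.pi * n) = Real.sin α := by
      rw [mul_comm (2 * Real.pi)]; exact Real.sin_add_int_mul_two_pi α n
    simp only [lift, liftRoot, hc, hs]

/-! ### The Hamiltonian on the reduced spaces -/

/-- The half-width `√(1 - j²)` of the reduced disk at angular momentum `j`. -/
def bb (j : ℝ) : ℝ := √(1 - j ^ 2)

/-- `|p| |q| = √(C² + j²)`, where `C = p · q = bb j * n`. -/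
def kk (j n : ℝ) : ℝ := √((bb j * n) ^ 2 + j ^ 2)

/-- `(|p|² + |q|²) / 2 = √(X² + C² + j²)`, where `C = bb j * n` and `X = (bb j)² * u`. -/
def zz (j n u : ℝ) : ℝ := √((bb j ^ 2 * u) ^ 2 + (bb j * n) ^ 2 + j ^ 2)

/-- A function which is positive inside the reduced disk and vanishes on its boundary. -/
def tau (n u : ℝ) : ℝ := (1 - n ^ 2) ^ 2 - 4 * u ^ 2

/-- A penalty, which vanishes near the minimum and near the node and blows up at the boundary. It is
smooth, since `expNegInvGlue` is. -/
def pen (n u : ℝ) : ℝ :=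
  (expNegInvGlue (n ^ 2 - 1 / 3) + u ^ 2 * expNegInvGlue (u ^ 2 - 1 / 64)) / tau n u

/-- The cutoff between the neighbourhood of the minimum and that of the node. -/
def cutoff (n : ℝ) : ℝ := Real.smoothTransition (8 * n + 3)

/-- The model near the minimum: `ξ² + η²` in the Darboux coordinates `ξ = X / (2k)`,
`η = (C + bb j / 2) k / Z` of the reduced space. -/
def inner (j n u : ℝ) : ℝ :=
  (bb j ^ 2 * u) ^ 2 / (4 * kk j n ^ 2) + bb j ^ 2 * (n + 1 / 2) ^ 2 * kk j n ^ 2 / zz j n u ^ 2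

/-- The model near the node: up to a linear symplectic map, this is `1/2 + p · q`. -/
def outer (j n u : ℝ) : ℝ := 1 / 2 + 17 / 8 * (bb j * n) + 15 / 8 * zz j n u

/-- The Hamiltonian on the reduced space at angular momentum `j`, in the coordinates
`n = p · q / √(1 - j²)` and `u = (|p|² - |q|²) / (2 (1 - j²))`. -/
def ham (j n u : ℝ) : ℝ := (1 - cutoff n) * inner j n u + cutoff n * outer j n u + pen n u

theorem bb_sq {j : ℝ} (hj : |j| < 1) : bb j ^ 2 = 1 - j ^ 2 :=
  Real.sq_sqrt (by have := (sq_lt_one_iff_abs_lt_one j).2 hj; linarith)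

theorem bb_pos {j : ℝ} (hj : |j| < 1) : 0 < bb j :=
  Real.sqrt_pos.2 (by have := (sq_lt_one_iff_abs_lt_one j).2 hj; linarith)

theorem bb_nonneg (j : ℝ) : 0 ≤ bb j := Real.sqrt_nonneg _

theorem bb_le_one (j : ℝ) : bb j ≤ 1 := by
  exact Real.sqrt_le_iff.2 ⟨zero_le_one, by nlinarith [sq_nonneg j]⟩

theorem kk_sq (j n : ℝ) : kk j n ^ 2 = (bb j * n) ^ 2 + j ^ 2 := Real.sq_sqrt (by positivity)

theorem kk_nonneg (j n : ℝ) : 0 ≤ kk j n := Real.sqrt_nonneg _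

theorem kk_pos {j n : ℝ} (hj : |j| < 1) (h : n ≠ 0 ∨ j ≠ 0) : 0 < kk j n := by
  have := bb_pos hj
  refine Real.sqrt_pos.2 ?_
  rcases h with h | h <;> positivity

theorem kk_le_one {j n : ℝ} (hj : |j| < 1) (hn : |n| ≤ 1) : kk j n ≤ 1 := by
  refine Real.sqrt_le_iff.2 ⟨zero_le_one, ?_⟩
  rw [mul_pow, bb_sq hj]
  have h1 := (sq_le_one_iff_abs_le_one n).2 hn
  have h2 := (sq_lt_one_iff_abs_lt_one j).2 hj
  nlinarith

theorem abs_mul_le_kk (j n : ℝ) : |bb j * n| ≤ kk j n := by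
  refine Real.abs_le_sqrt ?_; nlinarith [sq_nonneg j]

theorem zz_sq (j n u : ℝ) : zz j n u ^ 2 = (bb j ^ 2 * u) ^ 2 + kk j n ^ 2 := by
  rw [kk_sq, zz, Real.sq_sqrt (by positivity)]; ring

theorem zz_nonneg (j n u : ℝ) : 0 ≤ zz j n u := Real.sqrt_nonneg _

theorem kk_le_zz (j n u : ℝ) : kk j n ≤ zz j n u := by
  refine Real.sqrt_le_sqrt ?_; nlinarith [sq_nonneg (bb j ^ 2 * u)]

theorem zz_zero (j n : ℝ) : zz j n 0 = kk j n := by simp [zz, kk]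

theorem zz_pos {j n u : ℝ} (hj : |j| < 1) (h : n ≠ 0 ∨ j ≠ 0 ∨ u ≠ 0) : 0 < zz j n u := by
  have := bb_pos hj
  refine Real.sqrt_pos.2 ?_
  rcases h with h | h | h <;> positivity

theorem abs_lt_one_of_mem {n u : ℝ} (h : n ^ 2 + 2 * |u| < 1) : |n| < 1 :=
  (sq_lt_one_iff_abs_lt_one n).1 (by have := abs_nonneg u; linarith)

theorem tau_eq (n u : ℝ) : tau n u = (1 - n ^ 2 - 2 * |u|) * (1 - n ^ 2 + 2 * |u|) := by
  unfold tau; nlinarith [sq_abs u]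

theorem tau_pos {n u : ℝ} (h : n ^ 2 + 2 * |u| < 1) : 0 < tau n u := by
  rw [tau_eq]; have := abs_nonneg u
  exact mul_pos (by linarith) (by linarith)

theorem cutoff_eq_zero {n : ℝ} (h : n ≤ -3 / 8) : cutoff n = 0 :=
  Real.smoothTransition.zero_of_nonpos (by linarith)

theorem cutoff_eq_one {n : ℝ} (h : -1 / 4 ≤ n) : cutoff n = 1 :=
  Real.smoothTransition.one_of_one_le (by linarith)

theorem cutoff_nonneg (n : ℝ) : 0 ≤ cutoff n := Real.smoothTransition.nonneg _

theorem cutoff_le_one (n : ℝ) : cutoff n ≤ 1 := Real.smoothTransition.le_one _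

theorem contDiff_cutoff : ContDiff ℝ ∞ cutoff :=
  Real.smoothTransition.contDiff.comp (by fun_prop)

theorem monotone_cutoff : Monotone cutoff := fun a b h =>
  Real.smoothTransition.monotone (by linarith)

theorem pen_nonneg {n u : ℝ} (h : n ^ 2 + 2 * |u| < 1) : 0 ≤ pen n u := by
  have := tau_pos h
  have h1 := expNegInvGlue.nonneg (n ^ 2 - 1 / 3)
  have h2 := expNegInvGlue.nonneg (u ^ 2 - 1 / 64)
  unfold pen; positivity

theorem pen_eq_zero {n u : ℝ} (h : n ^ 2 ≤ 1 / 3) (h' : u ^ 2 ≤ 1 / 64) : pen n u = 0 := by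
  unfold pen
  rw [expNegInvGlue.zero_of_nonpos (by linarith), expNegInvGlue.zero_of_nonpos (by linarith)]
  simp

/-- Near the boundary of the reduced disk the penalty is at least a multiple of `1 / tau`, so that
the Hamiltonian tends to infinity there. -/
theorem exists_pen_bound : ∃ c > 0, ∀ n u : ℝ, n ^ 2 + 2 * |u| < 1 → tau n u ≤ 1 / 8 →
    c ≤ pen n u * tau n u := by
  have g1 := expNegInvGlue.pos_of_pos (x := 1 / 64) (by norm_num)
  refine ⟨expNegInvGlue (1 / 64) / 32, by positivity, fun n u h ht => ?_⟩
  have hτ := tau_pos h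
  have h1 := expNegInvGlue.nonneg (n ^ 2 - 1 / 3)
  have h2 := expNegInvGlue.nonneg (u ^ 2 - 1 / 64)
  rw [pen, div_mul_cancel₀ _ hτ.ne']
  rcases le_total (1 / 2) (n ^ 2) with hn | hn
  · have := expNegInvGlue.monotone (show (1 / 64 : ℝ) ≤ n ^ 2 - 1 / 3 by linarith)
    nlinarith [mul_nonneg (sq_nonneg u) h2]
  · have hu : 1 / 32 ≤ u ^ 2 := by unfold tau at ht; nlinarith
    have := expNegInvGlue.monotone (show (1 / 64 : ℝ) ≤ u ^ 2 - 1 / 64 by linarith)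
    nlinarith [mul_le_mul hu this g1.le (by positivity)]

theorem inner_nonneg (j n u : ℝ) : 0 ≤ inner j n u := by unfold inner; positivity

theorem outer_ge {j n : ℝ} (hn : |n| ≤ 1) (u : ℝ) : 1 / 4 ≤ outer j n u := by
  have h1 := abs_mul_le_kk j n
  have h2 := kk_le_zz j n u
  have h3 : |bb j * n| ≤ 1 := by
    rw [abs_mul, abs_of_nonneg (bb_nonneg j)]
    exact mul_le_one₀ (bb_le_one j) (abs_nonneg _) hn
  have h4 := neg_abs_le (bb j * n)
  unfold outer; linarith

theorem outer_ge_of_nonneg {j n : ℝ} (hn : 0 ≤ n) (u : ℝ) : 1 / 2 ≤ outer j n u := by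
  have := mul_nonneg (bb_nonneg j) hn
  have := zz_nonneg j n u
  unfold outer; linarith

theorem ham_nonneg {j n u : ℝ} (h : n ^ 2 + 2 * |u| < 1) : 0 ≤ ham j n u := by
  have h1 := pen_nonneg h
  have h2 := inner_nonneg j n u
  have h3 := outer_ge (j := j) (abs_lt_one_of_mem h).le u
  have h4 := cutoff_nonneg n
  have h5 := cutoff_le_one n
  unfold ham
  have := mul_nonneg (sub_nonneg.2 h5) h2
  have := mul_nonneg h4 (by linarith : 0 ≤ outer j n u)
  linarith

theorem pen_le_ham {j n u : ℝ} (h : n ^ 2 + 2 * |u| < 1) : pen n u ≤ ham j n u := by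
  have h2 := inner_nonneg j n u
  have h3 := outer_ge (j := j) (abs_lt_one_of_mem h).le u
  have := mul_nonneg (sub_nonneg.2 (cutoff_le_one n)) h2
  have := mul_nonneg (cutoff_nonneg n) (by linarith : 0 ≤ outer j n u)
  unfold ham; linarith

theorem ham_eq_outer {n : ℝ} (h : -1 / 4 ≤ n) (j u : ℝ) : ham j n u = outer j n u + pen n u := by
  simp [ham, cutoff_eq_one h]

theorem ham_eq_inner {n : ℝ} (h : n ≤ -3 / 8) (j u : ℝ) : ham j n u = inner j n u + pen n u := by
  simp [ham, cutoff_eq_zero h]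

theorem neg_of_ham_lt {j n u : ℝ} (h : n ^ 2 + 2 * |u| < 1) (hh : ham j n u < 1 / 2) : n < 0 := by
  by_contra! hn
  rw [ham_eq_outer (by linarith)] at hh
  have := outer_ge_of_nonneg (j := j) hn u
  have := pen_nonneg h
  linarith

theorem ham_even (j n u : ℝ) : ham j n (-u) = ham j n u := by
  simp [ham, inner, outer, pen, tau, zz]

theorem ham_abs (j n u : ℝ) : ham j n |u| = ham j n u := by
  rcases abs_choice u with h | h <;> rw [h]
  exact ham_even j n u

theorem ham_center (j : ℝ) : ham j (-1 / 2) 0 = 0 := by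
  rw [ham_eq_inner (by norm_num), pen_eq_zero (by norm_num) (by norm_num)]
  norm_num [inner]

section smooth
variable {E : Type} [NormedAddCommGroup E] [NormedSpace ℝ E] {j n u : E → ℝ} {e : E}

theorem contDiffAt_bb (hj : ContDiffAt ℝ ∞ j e) (h1 : |j e| < 1) :
    ContDiffAt ℝ ∞ (fun e => bb (j e)) e := by
  have := (sq_lt_one_iff_abs_lt_one (j e)).2 h1
  exact ContDiffAt.sqrt (contDiffAt_const.sub (hj.pow 2)) (by linarith)

theorem contDiffAt_kk (hj : ContDiffAt ℝ ∞ j e) (hn : ContDiffAt ℝ ∞ n e) (h1 : |j e| < 1)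
    (h : n e ≠ 0 ∨ j e ≠ 0) : ContDiffAt ℝ ∞ (fun e => kk (j e) (n e)) e :=
  ContDiffAt.sqrt ((((contDiffAt_bb hj h1).mul hn).pow 2).add (hj.pow 2))
    (Real.sqrt_pos.1 (kk_pos h1 h)).ne'

theorem contDiffAt_zz (hj : ContDiffAt ℝ ∞ j e) (hn : ContDiffAt ℝ ∞ n e)
    (hu : ContDiffAt ℝ ∞ u e) (h1 : |j e| < 1) (h : n e ≠ 0 ∨ j e ≠ 0 ∨ u e ≠ 0) :
    ContDiffAt ℝ ∞ (fun e => zz (j e) (n e) (u e)) e :=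
  ContDiffAt.sqrt ((((((contDiffAt_bb hj h1).pow 2).mul hu).pow 2).add
    (((contDiffAt_bb hj h1).mul hn).pow 2)).add (hj.pow 2)) (Real.sqrt_pos.1 (zz_pos h1 h)).ne'

theorem contDiffAt_tau (hn : ContDiffAt ℝ ∞ n e) (hu : ContDiffAt ℝ ∞ u e) :
    ContDiffAt ℝ ∞ (fun e => tau (n e) (u e)) e :=
  ((contDiffAt_const.sub (hn.pow 2)).pow 2).sub (contDiffAt_const.mul (hu.pow 2))

theorem contDiffAt_glue (hn : ContDiffAt ℝ ∞ n e) (c : ℝ) :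
    ContDiffAt ℝ ∞ (fun e => expNegInvGlue (n e ^ 2 - c)) e :=
  expNegInvGlue.contDiff.contDiffAt.comp e ((hn.pow 2).sub contDiffAt_const)

theorem contDiffAt_pen (hn : ContDiffAt ℝ ∞ n e) (hu : ContDiffAt ℝ ∞ u e)
    (h : n e ^ 2 + 2 * |u e| < 1) : ContDiffAt ℝ ∞ (fun e => pen (n e) (u e)) e :=
  ((contDiffAt_glue hn _).add ((hu.pow 2).mul (contDiffAt_glue hu _))).div
    (contDiffAt_tau hn hu) (tau_pos h).ne'

theorem contDiffAt_cutoff (hn : ContDiffAt ℝ ∞ n e) : ContDiffAt ℝ ∞ (fun e => cutoff (n e)) e :=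
  contDiff_cutoff.contDiffAt.comp e hn

theorem contDiffAt_inner (hj : ContDiffAt ℝ ∞ j e) (hn : ContDiffAt ℝ ∞ n e)
    (hu : ContDiffAt ℝ ∞ u e) (h1 : |j e| < 1) (h : n e ≠ 0 ∨ j e ≠ 0) :
    ContDiffAt ℝ ∞ (fun e => inner (j e) (n e) (u e)) e := by
  have hb := contDiffAt_bb hj h1
  have hk := contDiffAt_kk hj hn h1 h
  have hz := contDiffAt_zz hj hn hu h1 (by tauto)
  have hk0 := kk_pos h1 h
  have hz0 := zz_pos (u := u e) h1 (by tauto : n e ≠ 0 ∨ j e ≠ 0 ∨ u e ≠ 0)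
  exact ((((hb.pow 2).mul hu).pow 2).div (contDiffAt_const.mul (hk.pow 2)) (by positivity)).add
    ((((hb.pow 2).mul ((hn.add contDiffAt_const).pow 2)).mul (hk.pow 2)).div (hz.pow 2)
      (by positivity))

/-- The Hamiltonian is smooth away from the node, inside the reduced disks. -/
theorem contDiffAt_ham (hj : ContDiffAt ℝ ∞ j e) (hn : ContDiffAt ℝ ∞ n e)
    (hu : ContDiffAt ℝ ∞ u e) (h1 : |j e| < 1) (h2 : n e ^ 2 + 2 * |u e| < 1)
    (h : n e ≠ 0 ∨ j e ≠ 0 ∨ u e ≠ 0) :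
    ContDiffAt ℝ ∞ (fun e => ham (j e) (n e) (u e)) e := by
  have hp := contDiffAt_pen hn hu h2
  have hz := contDiffAt_zz hj hn hu h1 h
  have hb := contDiffAt_bb hj h1
  have ho : ContDiffAt ℝ ∞ (fun e => outer (j e) (n e) (u e)) e :=
    (contDiffAt_const.add (contDiffAt_const.mul (hb.mul hn))).add (contDiffAt_const.mul hz)
  rcases lt_or_ge (-1 / 4) (n e) with h3 | h3
  · refine (ho.add hp).congr_of_eventuallyEq ?_
    filter_upwards [hn.continuousAt.eventually (lt_mem_nhds h3)] with e' he'
    exact ham_eq_outer he'.le _ _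
  · have hc := contDiffAt_cutoff hn
    exact (((contDiffAt_const.sub hc).mul
      (contDiffAt_inner hj hn hu h1 (Or.inl (by linarith)))).add (hc.mul ho)).add hp

end smooth

theorem exists_deriv_glue (x : ℝ) : ∃ d, 0 ≤ d ∧ HasDerivAt expNegInvGlue d x := by
  have h : DifferentiableAt ℝ expNegInvGlue x :=
    (expNegInvGlue.contDiff (n := 1)).contDiffAt.differentiableAt (by simp)
  exact ⟨_, expNegInvGlue.monotone.deriv_nonneg, h.hasDerivAt⟩

theorem exists_deriv_cutoff (n : ℝ) : ∃ d, 0 ≤ d ∧ HasDerivAt cutoff d n := by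
  have h : DifferentiableAt ℝ cutoff n := contDiff_cutoff.contDiffAt.differentiableAt (by simp)
  exact ⟨_, monotone_cutoff.deriv_nonneg, h.hasDerivAt⟩

theorem hasDerivAt_tau (n u : ℝ) : HasDerivAt (fun u => tau n u) (-8 * u) u := by
  have := ((hasDerivAt_id u).pow 2).const_mul 4 |>.const_sub ((1 - n ^ 2) ^ 2)
  refine this.congr_deriv ?_
  simp; ring

theorem exists_deriv_pen {n u : ℝ} (h : n ^ 2 + 2 * |u| < 1) (hu : 0 ≤ u) :
    ∃ d, 0 ≤ d ∧ HasDerivAt (fun u => pen n u) d u := by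
  obtain ⟨d, hd, hg⟩ := exists_deriv_glue (u ^ 2 - 1 / 64)
  have hτ := tau_pos h
  have h1 := expNegInvGlue.nonneg (n ^ 2 - 1 / 3)
  have h2 := expNegInvGlue.nonneg (u ^ 2 - 1 / 64)
  have e1 : HasDerivAt (fun u : ℝ => u ^ 2) (2 * u) u := by simpa using hasDerivAt_pow 2 u
  have e2 : HasDerivAt (fun u : ℝ => expNegInvGlue (u ^ 2 - 1 / 64)) (d * (2 * u)) u :=
    HasDerivAt.comp (h₂ := expNegInvGlue) u hg (e1.sub_const _)
  have e3 := ((e1.mul e2).const_add (expNegInvGlue (n ^ 2 - 1 / 3))).div (hasDerivAt_tau n u) hτ.ne'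
  refine ⟨_, ?_, e3⟩
  simp only [Pi.mul_apply]
  refine div_nonneg ?_ (by positivity)
  have : 0 ≤ (expNegInvGlue (n ^ 2 - 1 / 3) + u ^ 2 * expNegInvGlue (u ^ 2 - 1 / 64)) *
      (8 * u) := by
    positivity
  have : 0 ≤ (2 * u * expNegInvGlue (u ^ 2 - 1 / 64) + u ^ 2 * (d * (2 * u))) * tau n u := by
    positivity
  linarith

theorem hasDerivAt_zz {j n u : ℝ} (hz : 0 < zz j n u) :
    HasDerivAt (fun u => zz j n u) (bb j ^ 4 * u / zz j n u) u := by
  have e1 : HasDerivAt (fun u : ℝ => (bb j ^ 2 * u) ^ 2 + (bb j * n) ^ 2 + j ^ 2)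
      (2 * bb j ^ 4 * u) u := by
    have := ((((hasDerivAt_id u).const_mul (bb j ^ 2)).pow 2).add_const ((bb j * n) ^ 2)).add_const
      (j ^ 2)
    refine this.congr_deriv ?_
    simp; ring
  refine (e1.sqrt (Real.sqrt_pos.1 hz).ne').congr_deriv ?_
  unfold zz at hz ⊢
  field_simp

/-- On each slice of the reduced disk with `p · q` fixed, the Hamiltonian increases with `|u|`. -/
theorem exists_deriv_ham {j n u : ℝ} (hj : |j| < 1) (h : n ^ 2 + 2 * |u| < 1) (hu : 0 < u) :
    ∃ d, 0 < d ∧ HasDerivAt (fun u => ham j n u) d u := by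
  obtain ⟨dp, hdp, hp⟩ := exists_deriv_pen h hu.le
  have hz := zz_pos (n := n) hj (Or.inr (Or.inr hu.ne'))
  have hzd := hasDerivAt_zz hz
  have hb := bb_pos hj
  have hout : HasDerivAt (fun u => outer j n u) (15 / 8 * (bb j ^ 4 * u / zz j n u)) u :=
    (hzd.const_mul _).const_add _
  have hop : 0 < 15 / 8 * (bb j ^ 4 * u / zz j n u) := by positivity
  rcases lt_or_ge n (-1 / 4) with hn | hn
  · have hk := kk_pos (n := n) hj (Or.inl (by linarith))
    have e1 : HasDerivAt (fun u : ℝ => (bb j ^ 2 * u) ^ 2 / (4 * kk j n ^ 2))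
        (bb j ^ 4 * u / (2 * kk j n ^ 2)) u := by
      have := (((hasDerivAt_id u).const_mul (bb j ^ 2)).pow 2).div_const (4 * kk j n ^ 2)
      refine this.congr_deriv ?_
      simp; field_simp; ring
    have e2 := ((hasDerivAt_const u (bb j ^ 2 * (n + 1 / 2) ^ 2 * kk j n ^ 2)).div (hzd.pow 2)
      (by simp only [Pi.pow_apply]; positivity))
    have hin := e1.add e2
    have hip : 0 < bb j ^ 4 * u / (2 * kk j n ^ 2) + (0 * (zz j n u) ^ 2 -
        bb j ^ 2 * (n + 1 / 2) ^ 2 * kk j n ^ 2 *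
        (2 * zz j n u * (bb j ^ 4 * u / zz j n u))) / (zz j n u ^ 2) ^ 2 := by
      have h1 : bb j ^ 2 * (n + 1 / 2) ^ 2 < 1 / 4 := by
        have h3 := abs_lt_one_of_mem h
        have h4 := (abs_lt.1 h3).1
        have h5 : (n + 1 / 2) ^ 2 < 1 / 4 := by nlinarith
        have h6 : bb j ^ 2 ≤ 1 := by have := bb_le_one j; nlinarith
        nlinarith [sq_nonneg (n + 1 / 2)]
      have h2 : kk j n ^ 2 * kk j n ^ 2 ≤ zz j n u ^ 2 * zz j n u ^ 2 := by
        have := pow_le_pow_left₀ hk.le (kk_le_zz j n u) 2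
        exact mul_self_le_mul_self (by positivity) this
      have e : bb j ^ 4 * u / (2 * kk j n ^ 2) + (0 * (zz j n u) ^ 2 -
          bb j ^ 2 * (n + 1 / 2) ^ 2 * kk j n ^ 2 *
          (2 * zz j n u * (bb j ^ 4 * u / zz j n u))) / (zz j n u ^ 2) ^ 2 =
          bb j ^ 4 * u / (2 * kk j n ^ 2 * (zz j n u ^ 2 * zz j n u ^ 2)) *
          (zz j n u ^ 2 * zz j n u ^ 2 - 4 * (bb j ^ 2 * (n + 1 / 2) ^ 2) *
            (kk j n ^ 2 * kk j n ^ 2)) := by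
        field_simp; ring
      rw [e]
      refine mul_pos (by positivity) ?_
      have : 0 < kk j n ^ 2 * kk j n ^ 2 := by positivity
      nlinarith
    have := ((hin.const_mul (1 - cutoff n)).add (hout.const_mul (cutoff n))).add hp
    refine ⟨_, ?_, this⟩
    have h1 := cutoff_nonneg n
    have h2 := cutoff_le_one n
    simp only [Pi.pow_apply, Nat.cast_ofNat, Nat.add_one_sub_one, pow_one] at hip ⊢
    rcases h1.eq_or_lt with h3 | h3
    · rw [← h3]
      simpa using add_pos_of_pos_of_nonneg hip hdp
    · have := mul_nonneg (sub_nonneg.2 h2) hip.le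
      have := mul_pos h3 hop
      linarith
  · refine ⟨_, add_pos_of_pos_of_nonneg hop hdp, (hout.add hp).congr_of_eventuallyEq ?_⟩
    exact Eventually.of_forall fun u => ham_eq_outer hn j u

theorem inner_axis {j n : ℝ} (hj : |j| < 1) (h : n ≠ 0 ∨ j ≠ 0) :
    inner j n 0 = bb j ^ 2 * (n + 1 / 2) ^ 2 := by
  have := kk_pos hj h
  unfold inner; rw [zz_zero]; field_simp; simp; ring

theorem hasDerivAt_pen_axis_zero {n : ℝ} (h : n ^ 2 < 1 / 3) :
    HasDerivAt (fun n => pen n 0) 0 n := by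
  refine (hasDerivAt_const n (0 : ℝ)).congr_of_eventuallyEq ?_
  have : ∀ᶠ m in 𝓝 n, m ^ 2 < 1 / 3 :=
    (continuous_pow 2).continuousAt.eventually (gt_mem_nhds h)
  filter_upwards [this] with m hm
  exact pen_eq_zero hm.le (by norm_num)

theorem exists_deriv_pen_axis {n : ℝ} (h : |n| < 1) :
    ∃ d, 0 ≤ d ∧ HasDerivAt (fun n => pen n 0) (n * d) n := by
  obtain ⟨d, hd, hg⟩ := exists_deriv_glue (n ^ 2 - 1 / 3)
  have hn := (sq_lt_one_iff_abs_lt_one n).2 h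
  have h1 := expNegInvGlue.nonneg (n ^ 2 - 1 / 3)
  have e1 : HasDerivAt (fun n : ℝ => n ^ 2) (2 * n) n := by simpa using hasDerivAt_pow 2 n
  have e2 : HasDerivAt (fun n : ℝ => expNegInvGlue (n ^ 2 - 1 / 3)) (d * (2 * n)) n :=
    HasDerivAt.comp (h₂ := expNegInvGlue) n hg (e1.sub_const _)
  have e3 := e2.div ((e1.const_sub 1).pow 2) (by simp only [Pi.pow_apply]; nlinarith)
  have hpos : 0 < 1 - n ^ 2 := by linarith
  refine ⟨(d * 2 * (1 - n ^ 2) + expNegInvGlue (n ^ 2 - 1 / 3) * 4) / (1 - n ^ 2) ^ 3,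
    by positivity, ?_⟩
  refine (e3.congr_deriv ?_).congr_of_eventuallyEq ?_
  · simp; field_simp; ring
  · refine Eventually.of_forall fun m => ?_
    simp [pen, tau]

theorem exists_deriv_axis_neg {j n : ℝ} (hj : |j| < 1) (hn : |n| < 1) (h : n < -1 / 2) :
    ∃ d, d < 0 ∧ HasDerivAt (fun n => ham j n 0) d n := by
  obtain ⟨d, hd, hp⟩ := exists_deriv_pen_axis hn
  have hb := bb_pos hj
  have e1 : HasDerivAt (fun n : ℝ => bb j ^ 2 * (n + 1 / 2) ^ 2)
      (bb j ^ 2 * (2 * (n + 1 / 2))) n := by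
    refine ((((hasDerivAt_id n).add_const (1 / 2)).pow 2).const_mul (bb j ^ 2)).congr_deriv ?_
    simp
  refine ⟨_, ?_, (e1.add hp).congr_of_eventuallyEq ?_⟩
  · have : 0 < bb j ^ 2 := by positivity
    nlinarith
  · filter_upwards [gt_mem_nhds (show n < -3 / 8 by linarith)] with m hm
    rw [ham_eq_inner hm.le, inner_axis hj (Or.inl (by linarith))]; rfl

/-- On the axis `u = 0` the Hamiltonian increases to the right of its minimum `n = -1 / 2`. The
interpolation between the two models preserves this because `inner ≤ outer` on the axis and the
cutoff increases. -/
theorem exists_deriv_axis_pos {j n : ℝ} (hj : |j| < 1) (hn : |n| < 1) (h : -1 / 2 < n)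
    (h0 : n ≠ 0 ∨ j ≠ 0) : ∃ d, 0 < d ∧ HasDerivAt (fun n => ham j n 0) d n := by
  obtain ⟨dp, hdp, hp⟩ : ∃ d, 0 ≤ d ∧ HasDerivAt (fun n => pen n 0) d n := by
    rcases lt_or_ge n 0 with h1 | h1
    · exact ⟨0, le_rfl, hasDerivAt_pen_axis_zero (by nlinarith)⟩
    · obtain ⟨d, hd, hp⟩ := exists_deriv_pen_axis hn
      exact ⟨_, mul_nonneg h1 hd, hp⟩
  obtain ⟨dc, hdc, hc⟩ := exists_deriv_cutoff n
  have hb := bb_pos hj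
  have hk := kk_pos hj h0
  have e1 : HasDerivAt (fun n : ℝ => bb j ^ 2 * (n + 1 / 2) ^ 2)
      (bb j ^ 2 * (2 * (n + 1 / 2))) n := by
    refine ((((hasDerivAt_id n).add_const (1 / 2)).pow 2).const_mul (bb j ^ 2)).congr_deriv ?_
    simp
  have ek : HasDerivAt (fun n => kk j n) (bb j ^ 2 * n / kk j n) n := by
    have e2 : HasDerivAt (fun n : ℝ => (bb j * n) ^ 2 + j ^ 2) (2 * bb j ^ 2 * n) n := by
      have := (((hasDerivAt_id n).const_mul (bb j)).pow 2).add_const (j ^ 2)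
      refine this.congr_deriv ?_
      simp; ring
    refine (e2.sqrt (Real.sqrt_pos.1 hk).ne').congr_deriv ?_
    unfold kk at hk ⊢
    field_simp
  have eo : HasDerivAt (fun n => 1 / 2 + 17 / 8 * (bb j * n) + 15 / 8 * kk j n)
      (17 / 8 * bb j + 15 / 8 * (bb j ^ 2 * n / kk j n)) n := by
    have := ((((hasDerivAt_id n).const_mul (bb j)).const_mul (17 / 8)).const_add (1 / 2)).add
      (ek.const_mul (15 / 8))
    refine this.congr_deriv ?_
    simp
  have hop : 0 < 17 / 8 * bb j + 15 / 8 * (bb j ^ 2 * n / kk j n) := by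
    have h1 := abs_mul_le_kk j n
    have h2 : -1 ≤ bb j * n / kk j n := by
      rw [le_div_iff₀ hk]; have := neg_abs_le (bb j * n); linarith
    have h3 : bb j ^ 2 * n / kk j n = bb j * (bb j * n / kk j n) := by ring
    rw [h3]; nlinarith
  have hoi : bb j ^ 2 * (n + 1 / 2) ^ 2 ≤ 1 / 2 + 17 / 8 * (bb j * n) + 15 / 8 * kk j n := by
    have h1 := abs_mul_le_kk j n
    have h2 := le_abs_self (bb j * n)
    have h3 := neg_abs_le (bb j * n)
    have h4 := bb_le_one j
    have h5 := abs_lt.1 hn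
    rcases lt_or_ge n 0 with h6 | h6
    · have : (n + 1 / 2) ^ 2 ≤ 1 / 4 := by nlinarith
      have : bb j ^ 2 * (n + 1 / 2) ^ 2 ≤ 1 / 4 := by nlinarith [sq_nonneg (n + 1 / 2)]
      nlinarith
    · have e : bb j ^ 2 * (n + 1 / 2) ^ 2 =
          (bb j * n) * (bb j * n) + bb j * (bb j * n) + bb j ^ 2 / 4 := by ring
      have h7 : 0 ≤ bb j * n := by positivity
      have h8 : bb j * n ≤ 1 := by nlinarith
      rw [e]; nlinarith
  have := (((hc.const_sub 1).mul e1).add (hc.mul eo)).add hp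
  refine ⟨_, ?_, this.congr_of_eventuallyEq ?_⟩
  · have h1 := cutoff_nonneg n
    have h2 := cutoff_le_one n
    have h3 : 0 < bb j ^ 2 * (2 * (n + 1 / 2)) := by
      have : 0 < n + 1 / 2 := by linarith
      positivity
    have h4 : 0 < (1 - cutoff n) * (bb j ^ 2 * (2 * (n + 1 / 2))) +
        cutoff n * (17 / 8 * bb j + 15 / 8 * (bb j ^ 2 * n / kk j n)) := by
      rcases h1.eq_or_lt with h5 | h5
      · rw [← h5]; simpa using h3
      · have := mul_nonneg (sub_nonneg.2 h2) h3.le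
        have := mul_pos h5 hop
        linarith
    have h5 := mul_nonneg hdc (sub_nonneg.2 hoi)
    linarith
  · have hev : ∀ᶠ m in 𝓝 n, m ≠ 0 ∨ j ≠ 0 := by
      rcases h0 with h0 | h0
      · filter_upwards [isOpen_ne.mem_nhds h0] with m hm using Or.inl hm
      · exact Eventually.of_forall fun m => Or.inr h0
    filter_upwards [hev] with m hm
    simp only [ham, inner_axis hj hm, outer, zz_zero, Pi.add_apply, Pi.mul_apply]

/-! ### Factorisation of the Hamiltonian into two squares -/

/-- The quotient `(ham j n u - ham j n 0) / u²`, written in a form which is smooth at `u = 0`. -/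
def quot (j n u : ℝ) : ℝ :=
  (1 - cutoff n) * (bb j ^ 4 / (4 * kk j n ^ 2) -
    bb j ^ 2 * (n + 1 / 2) ^ 2 * bb j ^ 4 / zz j n u ^ 2) +
  cutoff n * (15 / 8 * bb j ^ 4 / (zz j n u + kk j n)) +
  (4 * expNegInvGlue (n ^ 2 - 1 / 3) / (tau n u * (1 - n ^ 2) ^ 2) +
    expNegInvGlue (u ^ 2 - 1 / 64) / tau n u)

/-- The quotient `ham j n 0 / (n + 1 / 2)²`, extended smoothly to the minimum `n = -1 / 2`. -/
def axisQuot (j n : ℝ) : ℝ := if n = -1 / 2 then bb j ^ 2 else ham j n 0 / (n + 1 / 2) ^ 2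

/-- The signed square root of the Hamiltonian on the axis `u = 0`. -/
def lam (j n : ℝ) : ℝ := (n + 1 / 2) * √(axisQuot j n)

/-- The signed square root of the difference between the Hamiltonian and its value on the
axis `u = 0`. -/
def pii (j n u : ℝ) : ℝ := u * √(quot j n u)

theorem ham_sub {j n u : ℝ} (hj : |j| < 1) (h : n ^ 2 + 2 * |u| < 1) (h0 : n ≠ 0 ∨ j ≠ 0) :
    ham j n u - ham j n 0 = u ^ 2 * quot j n u := by
  have hk := kk_pos hj h0
  have hz : 0 < zz j n u := hk.trans_le (kk_le_zz j n u)
  have hτ := tau_pos h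
  have hn : 0 < 1 - n ^ 2 := by have := abs_nonneg u; linarith
  have hzs := zz_sq j n u
  have e1 : inner j n u - inner j n 0 = u ^ 2 * (bb j ^ 4 / (4 * kk j n ^ 2) -
      bb j ^ 2 * (n + 1 / 2) ^ 2 * bb j ^ 4 / zz j n u ^ 2) := by
    rw [inner_axis hj h0, inner]
    field_simp
    rw [hzs]; ring
  have e2 : outer j n u - outer j n 0 =
      u ^ 2 * (15 / 8 * bb j ^ 4 / (zz j n u + kk j n)) := by
    rw [outer, outer, zz_zero]
    field_simp
    linear_combination 30 * hzs
  have e3 : pen n u - pen n 0 = u ^ 2 * (4 * expNegInvGlue (n ^ 2 - 1 / 3) /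
      (tau n u * (1 - n ^ 2) ^ 2) + expNegInvGlue (u ^ 2 - 1 / 64) / tau n u) := by
    have : tau n 0 = (1 - n ^ 2) ^ 2 := by simp [tau]
    rw [pen, pen, this]
    field_simp
    unfold tau
    ring
  unfold ham quot
  linear_combination (1 - cutoff n) * e1 + cutoff n * e2 + e3

theorem quot_pos {j n u : ℝ} (hj : |j| < 1) (h : n ^ 2 + 2 * |u| < 1) (h0 : n ≠ 0 ∨ j ≠ 0) :
    0 < quot j n u := by
  have hk := kk_pos hj h0
  have hz : 0 < zz j n u := hk.trans_le (kk_le_zz j n u)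
  have hτ := tau_pos h
  have hb := bb_pos hj
  have hn : 0 < 1 - n ^ 2 := by have := abs_nonneg u; linarith
  have g1 := expNegInvGlue.nonneg (n ^ 2 - 1 / 3)
  have g2 := expNegInvGlue.nonneg (u ^ 2 - 1 / 64)
  have h3 : 0 ≤ 4 * expNegInvGlue (n ^ 2 - 1 / 3) / (tau n u * (1 - n ^ 2) ^ 2) +
    expNegInvGlue (u ^ 2 - 1 / 64) / tau n u := by positivity
  have h2 : 0 < 15 / 8 * bb j ^ 4 / (zz j n u + kk j n) := by positivity
  unfold quot
  rcases lt_or_ge n (-1 / 4) with h1 | h1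
  · have h4 : 0 < bb j ^ 4 / (4 * kk j n ^ 2) -
        bb j ^ 2 * (n + 1 / 2) ^ 2 * bb j ^ 4 / zz j n u ^ 2 := by
      have h5 := (abs_lt.1 (abs_lt_one_of_mem h)).1
      have h6 : (n + 1 / 2) ^ 2 < 1 / 4 := by nlinarith
      have h7 : bb j ^ 2 * (n + 1 / 2) ^ 2 < 1 / 4 := by
        have : bb j ^ 2 ≤ 1 := by have := bb_le_one j; nlinarith
        nlinarith [sq_nonneg (n + 1 / 2)]
      have h8 : kk j n ^ 2 ≤ zz j n u ^ 2 := pow_le_pow_left₀ hk.le (kk_le_zz j n u) 2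
      have h9 : 0 < kk j n ^ 2 := by positivity
      rw [sub_pos, div_lt_div_iff₀ (by positivity) (by positivity)]
      have h10 : 0 < bb j ^ 4 := by positivity
      have : bb j ^ 2 * (n + 1 / 2) ^ 2 * (4 * kk j n ^ 2) < zz j n u ^ 2 := by nlinarith
      nlinarith
    rcases (cutoff_nonneg n).eq_or_lt with h5 | h5
    · rw [← h5]; linarith
    · have := mul_nonneg (sub_nonneg.2 (cutoff_le_one n)) h4.le
      have := mul_pos h5 h2
      linarith
  · rw [cutoff_eq_one h1]; linarith

theorem ham_axis_pos {j n : ℝ} (hj : |j| < 1) (hn : |n| < 1) (h : n ≠ -1 / 2) :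
    0 < ham j n 0 := by
  have hb := bb_pos hj
  have hp := pen_nonneg (n := n) (u := 0) (by
    have := (sq_lt_one_iff_abs_lt_one n).2 hn; simpa using this)
  have ho := outer_ge (j := j) hn.le 0
  have h2 : 0 < (n + 1 / 2) ^ 2 := by
    have : n + 1 / 2 ≠ 0 := by intro h'; apply h; linarith
    positivity
  unfold ham
  rcases lt_or_ge n (-1 / 4) with h1 | h1
  · rw [inner_axis hj (Or.inl (by linarith))]
    have h4 : 0 < bb j ^ 2 * (n + 1 / 2) ^ 2 := by positivity
    rcases (cutoff_nonneg n).eq_or_lt with h5 | h5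
    · rw [← h5]; linarith
    · have := mul_nonneg (sub_nonneg.2 (cutoff_le_one n)) h4.le
      have := mul_pos h5 (by linarith : 0 < outer j n 0)
      linarith
  · rw [cutoff_eq_one h1]; linarith

theorem axisQuot_pos {j n : ℝ} (hj : |j| < 1) (hn : |n| < 1) : 0 < axisQuot j n := by
  have hb := bb_pos hj
  unfold axisQuot
  split_ifs with h
  · positivity
  · have : n + 1 / 2 ≠ 0 := by intro h'; apply h; linarith
    have := ham_axis_pos hj hn h
    positivity

theorem axisQuot_near {j n : ℝ} (hj : |j| < 1) (h1 : n ^ 2 < 1 / 3) (h2 : n < -3 / 8) :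
    axisQuot j n = bb j ^ 2 := by
  unfold axisQuot
  split_ifs with h
  · rfl
  · have : n + 1 / 2 ≠ 0 := by intro h'; apply h; linarith
    rw [ham_eq_inner h2.le, pen_eq_zero h1.le (by norm_num), inner_axis hj (Or.inl (by linarith)),
      add_zero, mul_div_cancel_right₀ _ (pow_ne_zero 2 this)]

theorem lam_sq {j n : ℝ} (hj : |j| < 1) (hn : |n| < 1) : lam j n ^ 2 = ham j n 0 := by
  rw [lam, mul_pow, Real.sq_sqrt (axisQuot_pos hj hn).le]
  unfold axisQuot
  split_ifs with h
  · rw [h, ham_center]; norm_num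
  · have : n + 1 / 2 ≠ 0 := by intro h'; apply h; linarith
    exact mul_div_cancel₀ _ (pow_ne_zero 2 this)

theorem pii_sq {j n u : ℝ} (hj : |j| < 1) (h : n ^ 2 + 2 * |u| < 1) (h0 : n ≠ 0 ∨ j ≠ 0) :
    pii j n u ^ 2 = ham j n u - ham j n 0 := by
  rw [pii, mul_pow, Real.sq_sqrt (quot_pos hj h h0).le, ham_sub hj h h0]

theorem lam_sq_add_pii_sq {j n u : ℝ} (hj : |j| < 1) (h : n ^ 2 + 2 * |u| < 1)
    (h0 : n ≠ 0 ∨ j ≠ 0) : lam j n ^ 2 + pii j n u ^ 2 = ham j n u := by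
  rw [lam_sq hj (abs_lt_one_of_mem h), pii_sq hj h h0]; ring

theorem lam_pos {j n : ℝ} (hj : |j| < 1) (hn : |n| < 1) (h : -1 / 2 < n) : 0 < lam j n :=
  mul_pos (by linarith) (Real.sqrt_pos.2 (axisQuot_pos hj hn))

theorem lam_neg {j n : ℝ} (hj : |j| < 1) (hn : |n| < 1) (h : n < -1 / 2) : lam j n < 0 :=
  mul_neg_of_neg_of_pos (by linarith) (Real.sqrt_pos.2 (axisQuot_pos hj hn))

theorem axis_mem {n : ℝ} (hn : |n| < 1) : n ^ 2 + 2 * |(0 : ℝ)| < 1 := by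
  have := (sq_lt_one_iff_abs_lt_one n).2 hn; simpa using this

section smooth
variable {E : Type} [NormedAddCommGroup E] [NormedSpace ℝ E] {j n u : E → ℝ} {e : E}

theorem contDiffAt_quot (hj : ContDiffAt ℝ ∞ j e) (hn : ContDiffAt ℝ ∞ n e)
    (hu : ContDiffAt ℝ ∞ u e) (h1 : |j e| < 1) (h2 : n e ^ 2 + 2 * |u e| < 1)
    (h : n e ≠ 0 ∨ j e ≠ 0) : ContDiffAt ℝ ∞ (fun e => quot (j e) (n e) (u e)) e := by
  have hb := contDiffAt_bb hj h1
  have hk := contDiffAt_kk hj hn h1 h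
  have hz := contDiffAt_zz hj hn hu h1 (by tauto)
  have hk0 := kk_pos h1 h
  have hz0 := zz_pos (u := u e) h1 (by tauto : n e ≠ 0 ∨ j e ≠ 0 ∨ u e ≠ 0)
  have hc := contDiffAt_cutoff hn
  have hτ := contDiffAt_tau hn hu
  have hτ0 := tau_pos h2
  have hn0 : 0 < 1 - n e ^ 2 := by have := abs_nonneg (u e); linarith
  have c : ∀ a : ℝ, ContDiffAt ℝ ∞ (fun _ : E => a) e := fun a => contDiffAt_const
  exact (((c 1).sub hc).mul (((hb.pow 4).div ((c 4).mul (hk.pow 2)) (by positivity)).sub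
    ((((hb.pow 2).mul ((hn.add (c _)).pow 2)).mul (hb.pow 4)).div (hz.pow 2) (by positivity)))).add
    (hc.mul (((c (15 / 8)).mul (hb.pow 4)).div (hz.add hk) (by positivity))) |>.add
    ((((c 4).mul (contDiffAt_glue hn _)).div (hτ.mul (((c 1).sub (hn.pow 2)).pow 2))
      (by positivity)).add ((contDiffAt_glue hu _).div hτ hτ0.ne'))

theorem contDiffAt_pii (hj : ContDiffAt ℝ ∞ j e) (hn : ContDiffAt ℝ ∞ n e)
    (hu : ContDiffAt ℝ ∞ u e) (h1 : |j e| < 1) (h2 : n e ^ 2 + 2 * |u e| < 1)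
    (h : n e ≠ 0 ∨ j e ≠ 0) : ContDiffAt ℝ ∞ (fun e => pii (j e) (n e) (u e)) e :=
  hu.mul (ContDiffAt.sqrt (contDiffAt_quot hj hn hu h1 h2 h) (quot_pos h1 h2 h).ne')

/-- The quotient is smooth at `n = -1 / 2` since nearby, on the axis, the Hamiltonian equals `(bb
j)² (n + 1 / 2)²`. -/
theorem contDiffAt_axisQuot (hj : ContDiffAt ℝ ∞ j e) (hn : ContDiffAt ℝ ∞ n e)
    (h1 : |j e| < 1) (h2 : |n e| < 1) (h : n e ≠ 0 ∨ j e ≠ 0) :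
    ContDiffAt ℝ ∞ (fun e => axisQuot (j e) (n e)) e := by
  have hb := contDiffAt_bb hj h1
  by_cases h3 : n e = -1 / 2
  · refine (hb.pow 2).congr_of_eventuallyEq ?_
    have t1 : ∀ᶠ e' in 𝓝 e, n e' ^ 2 < 1 / 3 :=
      (hn.pow 2).continuousAt.eventually (gt_mem_nhds (by simp only [h3]; norm_num))
    have t2 : ∀ᶠ e' in 𝓝 e, n e' < -3 / 8 :=
      hn.continuousAt.eventually (gt_mem_nhds (by rw [h3]; norm_num))
    have t3 : ∀ᶠ e' in 𝓝 e, |j e'| < 1 := hj.continuousAt.abs.eventually (gt_mem_nhds h1)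
    filter_upwards [t1, t2, t3] with e' a1 a2 a3
    exact axisQuot_near a3 a1 a2
  · have h4 : n e + 1 / 2 ≠ 0 := by intro h'; apply h3; linarith
    have := (contDiffAt_ham hj hn contDiffAt_const h1 (axis_mem h2) (by tauto)).div
      ((hn.add contDiffAt_const).pow 2) (pow_ne_zero 2 h4)
    refine this.congr_of_eventuallyEq ?_
    filter_upwards [hn.continuousAt.eventually (isOpen_ne.mem_nhds h3)] with e' he'
    simp only [axisQuot]
    rw [if_neg he']; rfl

theorem contDiffAt_lam (hj : ContDiffAt ℝ ∞ j e) (hn : ContDiffAt ℝ ∞ n e)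
    (h1 : |j e| < 1) (h2 : |n e| < 1) (h : n e ≠ 0 ∨ j e ≠ 0) :
    ContDiffAt ℝ ∞ (fun e => lam (j e) (n e)) e :=
  (hn.add contDiffAt_const).mul
    (ContDiffAt.sqrt (contDiffAt_axisQuot hj hn h1 h2 h) (axisQuot_pos h1 h2).ne')

end smooth

/-- Away from the minimum this is the monotonicity of `lam² = ham j n 0`; at the minimum `lam` is
linear. -/
theorem deriv_lam_pos {j n : ℝ} (hj : |j| < 1) (hn : |n| < 1) (h : n ≠ 0 ∨ j ≠ 0) :
    0 < deriv (fun n => lam j n) n := by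
  have hd : HasDerivAt (fun n => lam j n) (deriv (fun n => lam j n) n) n :=
    ((contDiffAt_lam (j := fun _ => j) (n := fun n : ℝ => n) contDiffAt_const contDiffAt_id hj hn
      h).differentiableAt (by simp)).hasDerivAt
  have hb := bb_pos hj
  rcases lt_trichotomy n (-1 / 2) with h1 | h1 | h1
  · obtain ⟨d, hd0, hh⟩ := exists_deriv_axis_neg hj hn h1
    have hev : (fun n => lam j n ^ 2) =ᶠ[𝓝 n] fun n => ham j n 0 := by
      filter_upwards [(continuous_abs.continuousAt (x := n)).eventually (gt_mem_nhds hn)] with m hm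
      exact lam_sq hj hm
    have e := (hd.pow 2).unique (hh.congr_of_eventuallyEq hev)
    have hl := lam_neg hj hn h1
    simp at e
    nlinarith
  · have hev : (fun n => lam j n) =ᶠ[𝓝 n] fun n => (n + 1 / 2) * bb j := by
      have t1 : ∀ᶠ m in 𝓝 n, m ^ 2 < 1 / 3 :=
        (continuous_pow 2).continuousAt.eventually (gt_mem_nhds (by rw [h1]; norm_num))
      filter_upwards [t1, gt_mem_nhds (show n < -3 / 8 by linarith)] with m hm1 hm2
      rw [lam, axisQuot_near hj hm1 hm2, Real.sqrt_sq hb.le]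
    have e : HasDerivAt (fun n => (n + 1 / 2) * bb j) (1 * bb j) n :=
      ((hasDerivAt_id n).add_const (1 / 2)).mul_const _
    rw [(e.congr_of_eventuallyEq hev).deriv]; linarith
  · obtain ⟨d, hd0, hh⟩ := exists_deriv_axis_pos hj hn h1 h
    have hev : (fun n => lam j n ^ 2) =ᶠ[𝓝 n] fun n => ham j n 0 := by
      filter_upwards [(continuous_abs.continuousAt (x := n)).eventually (gt_mem_nhds hn)] with m hm
      exact lam_sq hj hm
    have e := (hd.pow 2).unique (hh.congr_of_eventuallyEq hev)
    have hl := lam_pos hj hn h1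
    simp at e
    nlinarith

theorem region_open_slice (n : ℝ) : IsOpen {u : ℝ | n ^ 2 + 2 * |u| < 1} :=
  isOpen_lt (by fun_prop) continuous_const

theorem exists_deriv_ham_neg {j n u : ℝ} (hj : |j| < 1) (h : n ^ 2 + 2 * |u| < 1) (hu : u < 0) :
    ∃ d, d < 0 ∧ HasDerivAt (fun u => ham j n u) d u := by
  obtain ⟨d, hd, hh⟩ := exists_deriv_ham (n := n) (u := -u) hj (by rwa [abs_neg]) (by linarith)
  refine ⟨-d, by linarith, ?_⟩
  have := hh.comp u (hasDerivAt_neg u)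
  refine (this.congr_of_eventuallyEq (Eventually.of_forall fun v => ?_)).congr_deriv (by simp)
  exact (ham_even j n v).symm

theorem deriv_pii_pos {j n u : ℝ} (hj : |j| < 1) (h : n ^ 2 + 2 * |u| < 1) (h0 : n ≠ 0 ∨ j ≠ 0) :
    0 < deriv (fun u => pii j n u) u := by
  have hq := (contDiffAt_quot (j := fun _ => j) (n := fun _ => n) (u := fun u : ℝ => u)
    contDiffAt_const contDiffAt_const contDiffAt_id hj h h0).differentiableAt (by simp)
  have hqp := quot_pos hj h h0
  have hd : HasDerivAt (fun u => pii j n u) (deriv (fun u => pii j n u) u) u :=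
    ((contDiffAt_pii (j := fun _ => j) (n := fun _ => n) (u := fun u : ℝ => u)
    contDiffAt_const contDiffAt_const contDiffAt_id hj h h0).differentiableAt (by simp)).hasDerivAt
  have hev : (fun u => pii j n u ^ 2) =ᶠ[𝓝 u] fun u => ham j n u - ham j n 0 := by
    filter_upwards [(region_open_slice n).mem_nhds h] with m hm
    exact pii_sq hj hm h0
  have hs : 0 < √(quot j n u) := Real.sqrt_pos.2 hqp
  rcases lt_trichotomy u 0 with h1 | h1 | h1
  · obtain ⟨d, hd0, hh⟩ := exists_deriv_ham_neg hj h h1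
    have e := (hd.pow 2).unique ((hh.sub_const (ham j n 0)).congr_of_eventuallyEq hev)
    have hl : pii j n u < 0 := mul_neg_of_neg_of_pos h1 hs
    simp at e
    nlinarith
  · have e := (hasDerivAt_id u).mul (hq.hasDerivAt.sqrt hqp.ne')
    have e2 : deriv (fun u => pii j n u) u = _ := e.deriv
    rw [e2]
    simpa [h1] using (by rwa [h1] at hqp)
  · obtain ⟨d, hd0, hh⟩ := exists_deriv_ham hj h h1
    have e := (hd.pow 2).unique ((hh.sub_const (ham j n 0)).congr_of_eventuallyEq hev)
    have hl : 0 < pii j n u := mul_pos h1 hs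
    simp at e
    nlinarith

/-! ### Levels, slices and areas -/

/-- The decreasing function `1 / (1 + H)` of the Hamiltonian, extended by zero outside the open
reduced disk. -/
def level (j n u : ℝ) : ℝ := if n ^ 2 + 2 * |u| < 1 then (1 + ham j n u)⁻¹ else 0

theorem level_of_mem {n u : ℝ} (h : n ^ 2 + 2 * |u| < 1) (j : ℝ) :
    level j n u = (1 + ham j n u)⁻¹ := if_pos h

theorem level_of_not_mem {n u : ℝ} (h : ¬ n ^ 2 + 2 * |u| < 1) (j : ℝ) :
    level j n u = 0 := if_neg h

theorem level_nonneg (j n u : ℝ) : 0 ≤ level j n u := by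
  unfold level; split_ifs with h
  · have := ham_nonneg (j := j) h; positivity
  · exact le_rfl

theorem level_le_one (j n u : ℝ) : level j n u ≤ 1 := by
  unfold level; split_ifs with h
  · have := ham_nonneg (j := j) h; exact inv_le_one_of_one_le₀ (by linarith)
  · exact zero_le_one

theorem level_pos_iff {j n u : ℝ} : 0 < level j n u ↔ n ^ 2 + 2 * |u| < 1 := by
  unfold level; split_ifs with h
  · have := ham_nonneg (j := j) h; simp only [h, iff_true]; positivity
  · simp [h]

theorem level_center (j : ℝ) : level j (-1 / 2) 0 = 1 := by
  rw [level_of_mem (by norm_num), ham_center]; norm_num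

theorem level_abs (j n u : ℝ) : level j n |u| = level j n u := by
  simp [level, ham_abs]

theorem isOpen_reduced : IsOpen {q : ℝ × ℝ × ℝ | q.2.1 ^ 2 + 2 * |q.2.2| < 1} :=
  isOpen_lt (by fun_prop) continuous_const

/-- At the node `j = n = u = 0` the Hamiltonian is not smooth in these coordinates, but it is still
continuous. -/
theorem continuousAt_ham {j n u : ℝ} (hj : |j| < 1) (h : n ^ 2 + 2 * |u| < 1) :
    ContinuousAt (fun q : ℝ × ℝ × ℝ => ham q.1 q.2.1 q.2.2) (j, n, u) := by
  by_cases h0 : n ≠ 0 ∨ j ≠ 0 ∨ u ≠ 0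
  · exact (contDiffAt_ham (j := fun q : ℝ × ℝ × ℝ => q.1) (n := fun q : ℝ × ℝ × ℝ => q.2.1)
      (u := fun q : ℝ × ℝ × ℝ => q.2.2) (by fun_prop) (by fun_prop) (by fun_prop)
      hj h h0).continuousAt
  · push Not at h0
    obtain ⟨rfl, rfl, rfl⟩ := h0
    have hp : ContinuousAt (fun q : ℝ × ℝ × ℝ => pen q.2.1 q.2.2) (0, 0, 0) :=
      (contDiffAt_pen (n := fun q : ℝ × ℝ × ℝ => q.2.1)
      (u := fun q : ℝ × ℝ × ℝ => q.2.2) (by fun_prop) (by fun_prop) h).continuousAt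
    have ho : ContinuousAt (fun q : ℝ × ℝ × ℝ => outer q.1 q.2.1 q.2.2) (0, 0, 0) := by
      unfold outer zz bb; fun_prop
    refine (ho.add hp).congr ?_
    have : ∀ᶠ q : ℝ × ℝ × ℝ in 𝓝 (0, 0, 0), -1 / 4 < q.2.1 :=
      (by fun_prop : ContinuousAt (fun q : ℝ × ℝ × ℝ => q.2.1) (0, 0, 0)).eventually
        (lt_mem_nhds (by norm_num))
    filter_upwards [this] with q hq
    exact (ham_eq_outer hq.le _ _).symm

/-- The compactified Hamiltonian is continuous also at the boundary of the reduced disk, where it is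
dominated by a multiple of `tau`. -/
theorem continuousAt_level {j : ℝ} (hj : |j| < 1) (n u : ℝ) :
    ContinuousAt (fun q : ℝ × ℝ × ℝ => level q.1 q.2.1 q.2.2) (j, n, u) := by
  rcases lt_trichotomy (n ^ 2 + 2 * |u|) 1 with h | h | h
  · have h1 : ContinuousAt (fun q : ℝ × ℝ × ℝ => (1 + ham q.1 q.2.1 q.2.2)⁻¹) (j, n, u) :=
      (continuousAt_const.add (continuousAt_ham hj h)).inv₀
        (ne_of_gt (by
          have := ham_nonneg (j := j) h
          change (0 : ℝ) < 1 + ham j n u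
          linarith))
    refine h1.congr ?_
    filter_upwards [isOpen_reduced.mem_nhds h] with q hq
    exact (level_of_mem hq _).symm
  · obtain ⟨c, hc, hpen⟩ := exists_pen_bound
    have hτc : Continuous (fun q : ℝ × ℝ × ℝ => tau q.2.1 q.2.2) := by unfold tau; fun_prop
    have hτ0 : tau n u = 0 := by rw [tau_eq]; rw [show 1 - n ^ 2 - 2 * |u| = 0 by linarith]; ring
    have h0 : level j n u = 0 := level_of_not_mem (by linarith) j
    unfold ContinuousAt
    simp only [h0]
    have hlim : Tendsto (fun q : ℝ × ℝ × ℝ => |tau q.2.1 q.2.2| / c) (𝓝 (j, n, u)) (𝓝 0) := by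
      have : Continuous (fun q : ℝ × ℝ × ℝ => |tau q.2.1 q.2.2| / c) := by fun_prop
      simpa [hτ0] using this.tendsto (j, n, u)
    refine squeeze_zero' (Eventually.of_forall fun q => level_nonneg _ _ _) ?_ hlim
    have hev : ∀ᶠ q : ℝ × ℝ × ℝ in 𝓝 (j, n, u), tau q.2.1 q.2.2 < 1 / 8 :=
      hτc.continuousAt.eventually (gt_mem_nhds (by simp only [hτ0]; norm_num))
    filter_upwards [hev] with q hq
    by_cases hm : q.2.1 ^ 2 + 2 * |q.2.2| < 1
    · have hτ := tau_pos hm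
      have h1 := hpen _ _ hm hq.le
      have h2 := pen_le_ham (j := q.1) hm
      rw [level_of_mem hm, abs_of_pos hτ,
        inv_le_comm₀ (by linarith [pen_nonneg hm]) (by positivity), inv_div, div_le_iff₀ hτ]
      nlinarith
    · rw [level_of_not_mem hm]; positivity
  · have hev : ∀ᶠ q : ℝ × ℝ × ℝ in 𝓝 (j, n, u), 1 < q.2.1 ^ 2 + 2 * |q.2.2| :=
      (by fun_prop : ContinuousAt (fun q : ℝ × ℝ × ℝ => q.2.1 ^ 2 + 2 * |q.2.2|)
        (j, n, u)).eventually (lt_mem_nhds h)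
    refine (continuousAt_const (y := (0 : ℝ))).congr ?_
    filter_upwards [hev] with q hq
    exact (level_of_not_mem (by linarith) _).symm

theorem continuousAt_level_comp {α : Type*} [TopologicalSpace α] {j n u : α → ℝ} {a : α}
    (hj : ContinuousAt j a) (hn : ContinuousAt n a) (hu : ContinuousAt u a) (h : |j a| < 1) :
    ContinuousAt (fun a => level (j a) (n a) (u a)) a :=
  ContinuousAt.comp (f := fun a => (j a, n a, u a)) (x := a)
    (g := fun q : ℝ × ℝ × ℝ => level q.1 q.2.1 q.2.2)
    (continuousAt_level h (n a) (u a)) (hj.prodMk (hn.prodMk hu))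

theorem ham_lt_ham {j n u v : ℝ} (hj : |j| < 1) (hu : 0 ≤ u) (huv : u < v)
    (hv : n ^ 2 + 2 * v < 1) : ham j n u < ham j n v := by
  have hm : ∀ w ∈ Icc u v, n ^ 2 + 2 * |w| < 1 := fun w hw => by
    rw [abs_of_nonneg (hu.trans hw.1)]; linarith [hw.2]
  have : StrictMonoOn (fun u => ham j n u) (Icc u v) := by
    refine strictMonoOn_of_deriv_pos (convex_Icc u v) (fun w hw => ?_) (fun w hw => ?_)
    · exact (ContinuousAt.comp (f := fun w : ℝ => (j, n, w)) (x := w)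
        (g := fun q : ℝ × ℝ × ℝ => ham q.1 q.2.1 q.2.2)
        (continuousAt_ham hj (hm w hw)) (by fun_prop)).continuousWithinAt
    · rw [interior_Icc] at hw
      obtain ⟨d, hd, hh⟩ := exists_deriv_ham hj (hm w (Ioo_subset_Icc_self hw)) (hu.trans_lt hw.1)
      rw [hh.deriv]; exact hd
  exact this (left_mem_Icc.2 huv.le) (right_mem_Icc.2 huv.le) huv

theorem level_lt_level {j n u v : ℝ} (hj : |j| < 1) (hu : 0 ≤ u) (huv : u < v)
    (h : n ^ 2 + 2 * u < 1) : level j n v < level j n u := by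
  have h1 : n ^ 2 + 2 * |u| < 1 := by rwa [abs_of_nonneg hu]
  by_cases hv : n ^ 2 + 2 * v < 1
  · rw [level_of_mem h1, level_of_mem (by rwa [abs_of_nonneg (hu.trans huv.le)])]
    have := ham_nonneg (j := j) h1
    have := ham_lt_ham hj hu huv hv
    exact inv_strictAnti₀ (by linarith) (by linarith)
  · rw [level_of_not_mem (by rwa [abs_of_nonneg (hu.trans huv.le)])]
    exact level_pos_iff.2 h1

theorem level_anti {j n u v : ℝ} (hj : |j| < 1) (hu : 0 ≤ u) (huv : u ≤ v) :
    level j n v ≤ level j n u := by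
  rcases huv.eq_or_lt with rfl | huv
  · exact le_rfl
  by_cases h : n ^ 2 + 2 * u < 1
  · exact (level_lt_level hj hu huv h).le
  · rw [level_of_not_mem (u := v)]
    · exact level_nonneg _ _ _
    · rw [abs_of_nonneg (hu.trans huv.le)]; linarith

theorem axis_monotone {j : ℝ} (hj : |j| < 1) {a b : ℝ} (ha : -1 / 2 ≤ a) (hab : a ≤ b)
    (hb : b < 1) : ham j a 0 ≤ ham j b 0 := by
  have hc : ∀ w, |w| < 1 → ContinuousAt (fun n => ham j n 0) w := fun w hw =>
    ContinuousAt.comp (f := fun w : ℝ => (j, w, (0 : ℝ))) (x := w)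
      (g := fun q : ℝ × ℝ × ℝ => ham q.1 q.2.1 q.2.2)
      (continuousAt_ham hj (axis_mem hw)) (by fun_prop)
  have h1 : MonotoneOn (fun n => ham j n 0) (Icc (-1 / 2) 0) := by
    refine (strictMonoOn_of_deriv_pos (convex_Icc _ _) (fun w hw => ?_) (fun w hw => ?_)).monotoneOn
    · exact (hc w (abs_lt.2 ⟨by linarith [hw.1], by linarith [hw.2]⟩)).continuousWithinAt
    · rw [interior_Icc] at hw
      obtain ⟨d, hd, hh⟩ := exists_deriv_axis_pos hj
        (abs_lt.2 ⟨by linarith [hw.1], by linarith [hw.2]⟩) hw.1 (Or.inl hw.2.ne)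
      rw [hh.deriv]; exact hd
  have h2 : MonotoneOn (fun n => ham j n 0) (Ico 0 1) := by
    refine (strictMonoOn_of_deriv_pos (convex_Ico _ _) (fun w hw => ?_) (fun w hw => ?_)).monotoneOn
    · exact (hc w (abs_lt.2 ⟨by linarith [hw.1], by linarith [hw.2]⟩)).continuousWithinAt
    · rw [interior_Ico] at hw
      obtain ⟨d, hd, hh⟩ := exists_deriv_axis_pos hj
        (abs_lt.2 ⟨by linarith [hw.1], by linarith [hw.2]⟩) (by linarith [hw.1]) (Or.inl hw.1.ne')
      rw [hh.deriv]; exact hd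
  rcases le_total a 0 with h3 | h3 <;> rcases le_total b 0 with h4 | h4
  · exact h1 ⟨ha, h3⟩ ⟨by linarith, h4⟩ hab
  · exact (h1 ⟨ha, h3⟩ ⟨by norm_num, le_rfl⟩ h3).trans (h2 ⟨le_rfl, one_pos⟩ ⟨h4, hb⟩ h4)
  · have : a = b := by linarith
    rw [this]
  · exact h2 ⟨h3, by linarith⟩ ⟨h4, hb⟩ hab

theorem axis_antitone {j : ℝ} (hj : |j| < 1) {a b : ℝ} (ha : -1 < a) (hab : a ≤ b)
    (hb : b ≤ -1 / 2) : ham j b 0 ≤ ham j a 0 := by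
  have h1 : AntitoneOn (fun n => ham j n 0) (Ioc (-1) (-1 / 2)) := by
    refine (strictAntiOn_of_deriv_neg (convex_Ioc _ _) (fun w hw => ?_) (fun w hw => ?_)).antitoneOn
    · have hw1 : |w| < 1 := abs_lt.2 ⟨by linarith [hw.1], by linarith [hw.2]⟩
      exact (ContinuousAt.comp (f := fun w : ℝ => (j, w, (0 : ℝ))) (x := w)
        (g := fun q : ℝ × ℝ × ℝ => ham q.1 q.2.1 q.2.2)
        (continuousAt_ham hj (axis_mem hw1)) (by fun_prop)).continuousWithinAt
    · rw [interior_Ioc] at hw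
      obtain ⟨d, hd, hh⟩ := exists_deriv_axis_neg hj
        (abs_lt.2 ⟨by linarith [hw.1], by linarith [hw.2]⟩) hw.2
      rw [hh.deriv]; exact hd
  exact h1 ⟨ha, hab.trans hb⟩ ⟨by linarith, hb⟩ hab

/-- The half-width in `u` of the slice at `n` of the set of points where `level` exceeds `t`. -/
def extent (j t n : ℝ) : ℝ := sSup {u | 0 ≤ u ∧ t < level j n u}

theorem extent_set_le {j t n u : ℝ} (ht : 0 ≤ t) (hu : u ∈ {u | 0 ≤ u ∧ t < level j n u}) :
    u ≤ (1 - n ^ 2) / 2 := by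
  have := level_pos_iff.1 (ht.trans_lt hu.2)
  rw [abs_of_nonneg hu.1] at this; linarith

theorem extent_nonneg (j t n : ℝ) : 0 ≤ extent j t n := Real.sSup_nonneg fun _ hu => hu.1

theorem extent_le {j t : ℝ} (ht : 0 ≤ t) (n : ℝ) : extent j t n ≤ max 0 ((1 - n ^ 2) / 2) :=
  Real.sSup_le (fun _ hu => (extent_set_le ht hu).trans (le_max_right _ _)) (le_max_left _ _)

theorem extent_le_half {j t : ℝ} (ht : 0 ≤ t) (n : ℝ) : extent j t n ≤ 1 / 2 :=
  (extent_le ht n).trans (max_le (by norm_num) (by nlinarith [sq_nonneg n]))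

theorem lt_extent_iff {j t n u : ℝ} (hj : |j| < 1) (ht : 0 ≤ t) (hu : 0 ≤ u) :
    u < extent j t n ↔ t < level j n u := by
  constructor
  · intro h
    have hne : {u | 0 ≤ u ∧ t < level j n u}.Nonempty := by
      by_contra h0
      rw [not_nonempty_iff_eq_empty] at h0
      rw [extent, h0, Real.sSup_empty] at h
      linarith
    obtain ⟨v, hv, huv⟩ := exists_lt_of_lt_csSup hne h
    exact hv.2.trans_le (level_anti hj hu huv.le)
  · intro h
    have hc : ContinuousAt (fun u => level j n u) u :=
      continuousAt_level_comp continuousAt_const continuousAt_const continuousAt_id hj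
    have hev := hc.eventually (lt_mem_nhds h)
    obtain ⟨v, hv, hv2⟩ := ((hev.filter_mono nhdsWithin_le_nhds).and
      (self_mem_nhdsWithin (s := Ioi u))).exists
    refine lt_of_lt_of_le hv2 (le_csSup ⟨(1 - n ^ 2) / 2, fun w hw => extent_set_le ht hw⟩ ?_)
    exact ⟨hu.trans (le_of_lt hv2), hv⟩

theorem extent_le_iff {j t n u : ℝ} (hj : |j| < 1) (ht : 0 ≤ t) (hu : 0 ≤ u) :
    extent j t n ≤ u ↔ level j n u ≤ t := by
  rw [← not_lt, lt_extent_iff hj ht hu, not_lt]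

/-- On a slice, `extent` is the solution of `level = t`. -/
theorem extent_eq {j n u : ℝ} (hj : |j| < 1) (hu : 0 ≤ u) (h : n ^ 2 + 2 * u ≤ 1) :
    extent j (level j n u) n = u := by
  refine le_antisymm ((extent_le_iff hj (level_nonneg _ _ _) hu).2 le_rfl) ?_
  refine le_of_forall_lt fun v hv => ?_
  rcases lt_or_ge v 0 with h1 | h1
  · exact h1.trans_le (extent_nonneg _ _ _)
  · exact (lt_extent_iff hj (level_nonneg _ _ _) h1).2 (level_lt_level hj h1 hv (by linarith))

theorem level_extent {j t n : ℝ} (hj : |j| < 1) (ht : 0 ≤ t) (h : t ≤ level j n 0) :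
    level j n (extent j t n) = t := by
  refine le_antisymm ((extent_le_iff hj ht (extent_nonneg _ _ _)).1 le_rfl) ?_
  by_contra! h1
  have hc : ContinuousAt (fun u => level j n u) (extent j t n) :=
    continuousAt_level_comp continuousAt_const continuousAt_const continuousAt_id hj
  rcases (extent_nonneg j t n).eq_or_lt with h0 | h0
  · rw [← h0] at h1; linarith
  · have hev := hc.eventually (gt_mem_nhds h1)
    obtain ⟨v, ⟨hv, hv0⟩, hv2⟩ := (((hev.and (lt_mem_nhds h0)).filter_mono nhdsWithin_le_nhds).and
      (self_mem_nhdsWithin (s := Iio (extent j t n)))).exists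
    have := (lt_extent_iff hj ht hv0.le).1 hv2
    linarith

/-- Since `level` is continuous, and strictly decreasing in `u ≥ 0`, the solution of `level = t`
depends continuously on all parameters. -/
theorem continuousOn_extent :
    ContinuousOn (fun q : ℝ × ℝ × ℝ => extent q.1 q.2.1 q.2.2) {q | |q.1| < 1 ∧ 0 ≤ q.2.1} := by
  rintro ⟨j, t, n⟩ ⟨hj, ht⟩
  simp only at hj ht
  have hev1 : ∀ᶠ q : ℝ × ℝ × ℝ in 𝓝[{q | |q.1| < 1 ∧ 0 ≤ q.2.1}] (j, t, n), |q.1| < 1 ∧ 0 ≤ q.2.1 :=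
    self_mem_nhdsWithin
  have hlev : ∀ u : ℝ, ContinuousAt (fun q : ℝ × ℝ × ℝ => level q.1 q.2.2 u) (j, t, n) := fun u =>
    continuousAt_level_comp (by fun_prop) (by fun_prop) (by fun_prop) hj
  refine tendsto_order.2 ⟨fun v hv => ?_, fun v hv => ?_⟩
  · rcases lt_or_ge v 0 with h | h
    · exact Eventually.of_forall fun q => h.trans_le (extent_nonneg _ _ _)
    · have h1 := (lt_extent_iff hj ht h).1 hv
      have h2 : ∀ᶠ q : ℝ × ℝ × ℝ in 𝓝 (j, t, n), q.2.1 < level q.1 q.2.2 v :=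
        ContinuousAt.eventually_lt (by fun_prop) (hlev v) h1
      filter_upwards [hev1, h2.filter_mono nhdsWithin_le_nhds] with q hq1 hq2
      exact (lt_extent_iff hq1.1 hq1.2 h).2 hq2
  · have hv0 : 0 < v := (extent_nonneg _ _ _).trans_lt hv
    rcases lt_or_ge ((1 - n ^ 2) / 2) v with h | h
    · have h2 : ∀ᶠ q : ℝ × ℝ × ℝ in 𝓝 (j, t, n), (1 - q.2.2 ^ 2) / 2 < v :=
        ContinuousAt.eventually_lt (by fun_prop) (by fun_prop) h
      filter_upwards [hev1, h2.filter_mono nhdsWithin_le_nhds] with q hq1 hq2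
      exact (extent_le hq1.2 _).trans_lt (max_lt hv0 hq2)
    · obtain ⟨w, hw1, hw2⟩ := exists_between hv
      have hw0 : 0 ≤ w := (extent_nonneg j t n).trans hw1.le
      have h1 : level j n w ≤ t := (extent_le_iff hj ht hw0).1 hw1.le
      obtain ⟨w', hw3, hw4⟩ := exists_between hw2
      have h3 : level j n w' < t := (level_lt_level hj hw0 hw3 (by linarith)).trans_le h1
      have h2 : ∀ᶠ q : ℝ × ℝ × ℝ in 𝓝 (j, t, n), level q.1 q.2.2 w' < q.2.1 :=
        ContinuousAt.eventually_lt (hlev w') (by fun_prop) h3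
      filter_upwards [hev1, h2.filter_mono nhdsWithin_le_nhds] with q hq1 hq2
      exact ((extent_le_iff hq1.1 hq1.2 (hw0.trans hw3.le)).2 hq2.le).trans_lt hw4

/-- The symplectic area of the part of the reduced disk where `level` exceeds `t`: the integral
over `C = bb j * n` of the width of the slice in the Darboux coordinate `x = arsinh (X / k) / 2`. -/
def area (j t : ℝ) : ℝ :=
  bb j * ∫ n in (-1 : ℝ)..1, Real.arsinh (bb j ^ 2 * extent j t n / kk j n)

theorem abs_le_kk {j n : ℝ} (hj : |j| < 1) (hn : |n| ≤ 1) : |n| ≤ kk j n := by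
  refine Real.abs_le_sqrt ?_
  rw [mul_pow, bb_sq hj]
  have := (sq_le_one_iff_abs_le_one n).2 hn
  nlinarith [sq_nonneg j]

theorem arsinh_le_log {x : ℝ} (hx : 0 ≤ x) : Real.arsinh x ≤ Real.log (1 + 2 * x) := by
  unfold Real.arsinh
  refine Real.log_le_log (by positivity) ?_
  have : √(1 + x ^ 2) ≤ 1 + x := Real.sqrt_le_iff.2 ⟨by linarith, by nlinarith⟩
  linarith

theorem slice_nonneg (j t n : ℝ) :
    0 ≤ Real.arsinh (bb j ^ 2 * extent j t n / kk j n) := by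
  have := extent_nonneg j t n
  have := kk_nonneg j n
  exact Real.arsinh_nonneg_iff.2 (by positivity)

/-- An integrable bound for the widths of the slices which does not depend on the level and on the
angular momentum. -/
theorem slice_le {j t n : ℝ} (hj : |j| < 1) (ht : 0 ≤ t) (hn : |n| ≤ 1) (h0 : n ≠ 0) :
    Real.arsinh (bb j ^ 2 * extent j t n / kk j n) ≤ Real.log 2 - Real.log n := by
  have h1 := extent_nonneg j t n
  have h2 := extent_le_half (j := j) ht n
  have h3 := abs_le_kk hj hn
  have h4 : 0 < |n| := abs_pos.2 h0
  have h5 : bb j ^ 2 ≤ 1 := by have := bb_le_one j; have := bb_nonneg j; nlinarith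
  have h6 : bb j ^ 2 * extent j t n / kk j n ≤ 1 / 2 / |n| :=
    div_le_div₀ (by norm_num) (by nlinarith [sq_nonneg (bb j)]) h4 h3
  have h7 : 0 ≤ bb j ^ 2 * extent j t n / kk j n := by have := kk_nonneg j n; positivity
  refine (arsinh_le_log h7).trans ?_
  rw [← Real.log_abs n, ← Real.log_div two_ne_zero h4.ne']
  refine Real.log_le_log (by positivity) ?_
  have h8 : 1 ≤ 1 / |n| := by rw [le_div_iff₀ h4]; linarith
  have h9 : 1 / 2 / |n| = (1 / |n|) / 2 := by ring
  have h10 : 2 / |n| = 2 * (1 / |n|) := by ring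
  rw [h10]; linarith

theorem intervalIntegrable_bound :
    IntervalIntegrable (fun n => Real.log 2 - Real.log n) volume (-1) 1 :=
  intervalIntegrable_const.sub intervalIntegral.intervalIntegrable_log'

theorem continuous_kk (j : ℝ) : Continuous fun n => kk j n := by
  unfold kk; fun_prop

theorem continuous_extent {j t : ℝ} (hj : |j| < 1) (ht : 0 ≤ t) :
    Continuous fun n => extent j t n :=
  continuousOn_extent.comp_continuous (f := fun n : ℝ => (j, t, n)) (by fun_prop)
    (fun _ => ⟨hj, ht⟩)

theorem measurable_slice {j t : ℝ} (hj : |j| < 1) (ht : 0 ≤ t) :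
    Measurable fun n => Real.arsinh (bb j ^ 2 * extent j t n / kk j n) :=
  Real.continuous_arsinh.measurable.comp
    (((continuous_extent hj ht).measurable.const_mul _).div (continuous_kk j).measurable)

theorem ae_ne_zero : ∀ᵐ n : ℝ, n ≠ 0 := by
  simp [ae_iff, measure_singleton]

theorem intervalIntegrable_slice {j t : ℝ} (hj : |j| < 1) (ht : 0 ≤ t) :
    IntervalIntegrable (fun n => Real.arsinh (bb j ^ 2 * extent j t n / kk j n)) volume (-1) 1 := by
  refine intervalIntegrable_bound.mono_fun (measurable_slice hj ht).aestronglyMeasurable ?_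
  have h1 : ∀ᵐ n : ℝ ∂(volume.restrict (uIoc (-1 : ℝ) 1)), n ∈ uIoc (-1 : ℝ) 1 :=
    ae_restrict_mem measurableSet_uIoc
  filter_upwards [h1, ae_restrict_of_ae ae_ne_zero] with n hn h0
  rw [uIoc_of_le (by norm_num)] at hn
  have h3 := slice_nonneg j t n
  have h4 := slice_le hj ht (abs_le.2 ⟨hn.1.le, hn.2⟩) h0
  rw [Real.norm_of_nonneg h3, Real.norm_of_nonneg (h3.trans h4)]
  exact h4

/-- Continuity of the area by dominated convergence; when `j = 0` the width of the slice at `n = 0`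
is infinite (and the quotient is a junk value), but this is a null set. -/
theorem continuousOn_area_aux :
    ContinuousOn (fun q : ℝ × ℝ => area q.1 q.2) {q | |q.1| < 1 ∧ 0 ≤ q.2} := by
  rintro ⟨j, t⟩ ⟨hj, ht⟩
  refine ContinuousWithinAt.mul (by unfold bb; fun_prop) ?_
  refine intervalIntegral.continuousWithinAt_of_dominated_interval
    (bound := fun n => Real.log 2 - Real.log n) ?_ ?_ intervalIntegrable_bound ?_
  · filter_upwards [self_mem_nhdsWithin] with q hq
    exact (measurable_slice hq.1 hq.2).aestronglyMeasurable
  · filter_upwards [self_mem_nhdsWithin] with q hq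
    filter_upwards [ae_ne_zero] with n h0 hn
    rw [uIoc_of_le (by norm_num)] at hn
    rw [Real.norm_of_nonneg (slice_nonneg _ _ _)]
    exact slice_le hq.1 hq.2 (abs_le.2 ⟨hn.1.le, hn.2⟩) h0
  · filter_upwards [ae_ne_zero] with n h0 hn
    have h1 : ContinuousWithinAt (fun q : ℝ × ℝ => extent q.1 q.2 n) {q | |q.1| < 1 ∧ 0 ≤ q.2}
        (j, t) :=
      ContinuousWithinAt.comp (f := fun q : ℝ × ℝ => (q.1, q.2, n)) (x := (j, t))
        (g := fun q : ℝ × ℝ × ℝ => extent q.1 q.2.1 q.2.2) (continuousOn_extent (j, t, n) ⟨hj, ht⟩)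
        (by fun_prop) (fun q hq => hq)
    refine Real.continuous_arsinh.continuousAt.comp_continuousWithinAt ?_
    refine ContinuousWithinAt.div (ContinuousWithinAt.mul (by unfold bb; fun_prop) h1)
      (by unfold kk bb; fun_prop) (kk_pos hj (Or.inl h0)).ne'

theorem area_nonneg (j t : ℝ) : 0 ≤ area j t :=
  mul_nonneg (bb_nonneg j) (intervalIntegral.integral_nonneg (by norm_num)
    fun n _ => slice_nonneg j t n)

theorem area_of_abs_eq_one {j : ℝ} (hj : |j| = 1) (t : ℝ) : area j t = 0 := by
  have : bb j = 0 := by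
    unfold bb; rw [← sq_abs, hj]; norm_num
  simp [area, this]

/-- The area tends to zero, uniformly in the level, as `|j|` tends to one. -/
theorem exists_area_le : ∃ c, 0 ≤ c ∧ ∀ j t, |j| ≤ 1 → 0 ≤ t → area j t ≤ bb j * c := by
  refine ⟨max 0 (∫ n in (-1 : ℝ)..1, (Real.log 2 - Real.log n)), le_max_left _ _,
    fun j t hj ht => ?_⟩
  rcases hj.eq_or_lt with h | h
  · rw [area_of_abs_eq_one h]; exact mul_nonneg (bb_nonneg j) (le_max_left _ _)
  · refine mul_le_mul_of_nonneg_left (le_trans ?_ (le_max_right _ _)) (bb_nonneg j)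
    refine intervalIntegral.integral_mono_ae_restrict (by norm_num)
      (intervalIntegrable_slice h ht) intervalIntegrable_bound ?_
    have h1 : ∀ᵐ n : ℝ ∂(volume.restrict (Icc (-1 : ℝ) 1)), n ∈ Icc (-1 : ℝ) 1 :=
      ae_restrict_mem measurableSet_Icc
    filter_upwards [h1, ae_restrict_of_ae ae_ne_zero] with n hn h0
    exact slice_le h ht (abs_le.2 ⟨hn.1, hn.2⟩) h0

theorem area_one (j : ℝ) : area j 1 = 0 := by
  have : ∀ n, extent j 1 n = 0 := fun n => by
    have : {u | 0 ≤ u ∧ 1 < level j n u} = ∅ := by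
      ext u; simp only [mem_ofPred_eq, mem_empty_iff_false, iff_false, not_and, not_lt]
      exact fun _ => level_le_one _ _ _
    rw [extent, this, Real.sSup_empty]
  simp [area, this]

theorem extent_anti {j s t : ℝ} (hs : 0 ≤ s) (hst : s ≤ t) (n : ℝ) :
    extent j t n ≤ extent j s n := by
  refine Real.sSup_le (fun u hu => ?_) (extent_nonneg _ _ _)
  exact le_csSup ⟨(1 - n ^ 2) / 2, fun w hw => extent_set_le hs hw⟩ ⟨hu.1, hst.trans_lt hu.2⟩

theorem slice_lt {j s t n : ℝ} (hj : |j| < 1) (h0 : n ≠ 0) (h : extent j t n < extent j s n) :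
    Real.arsinh (bb j ^ 2 * extent j t n / kk j n) <
      Real.arsinh (bb j ^ 2 * extent j s n / kk j n) := by
  have := bb_pos hj
  have := kk_pos hj (Or.inl h0)
  rw [Real.arsinh_lt_arsinh]
  gcongr

theorem slice_anti {j s t : ℝ} (hs : 0 ≤ s) (hst : s ≤ t) (n : ℝ) :
    Real.arsinh (bb j ^ 2 * extent j t n / kk j n) ≤
      Real.arsinh (bb j ^ 2 * extent j s n / kk j n) := by
  have := extent_anti (j := j) hs hst n
  have := kk_nonneg j n
  rw [Real.arsinh_le_arsinh]
  gcongr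

theorem area_strictAnti {j s t : ℝ} (hj : |j| < 1) (hs : 0 ≤ s) (hst : s < t) (ht : t ≤ 1) :
    area j t < area j s := by
  refine mul_lt_mul_of_pos_left ?_ (bb_pos hj)
  refine intervalIntegral.integral_lt_integral_of_ae_le_of_measure_setOfPred_lt_ne_zero
    (by norm_num) (intervalIntegrable_slice hj (hs.trans hst.le)) (intervalIntegrable_slice hj hs)
    (Eventually.of_forall fun n => slice_anti hs hst.le n) ?_
  -- the slices through the minimum differ, hence so do the nearby ones
  have hlt : extent j t (-1 / 2) < extent j s (-1 / 2) := by
    have hc : ContinuousOn (fun u => level j (-1 / 2) u) (Icc 0 1) := fun u _ =>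
      (continuousAt_level_comp continuousAt_const continuousAt_const continuousAt_id
        hj).continuousWithinAt
    have h1 : level j (-1 / 2) 1 = 0 := level_of_not_mem (by norm_num) j
    obtain ⟨u, hu, hu2⟩ := intermediate_value_Icc' zero_le_one hc
      (show (s + t) / 2 ∈ Icc (level j (-1 / 2) 1) (level j (-1 / 2) 0) by
        rw [h1, level_center]; constructor <;> linarith)
    simp only at hu2
    have a1 := (lt_extent_iff (t := s) (n := -1 / 2) hj hs hu.1).2 (by rw [hu2]; linarith)
    have a2 := (extent_le_iff (t := t) (n := -1 / 2) hj (hs.trans hst.le) hu.1).2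
      (by rw [hu2]; linarith)
    linarith
  have hev : ∀ᶠ n in 𝓝 (-1 / 2 : ℝ), extent j t n < extent j s n ∧ n ∈ Ioo (-1 : ℝ) 0 :=
    ((continuous_extent hj (hs.trans hst.le)).continuousAt.eventually_lt
      (continuous_extent hj hs).continuousAt hlt).and
      (Ioo_mem_nhds (by norm_num) (by norm_num))
  obtain ⟨v, hv, hvo, hvm⟩ := mem_nhds_iff.1 hev
  have hpos : 0 < volume v := hvo.measure_pos volume ⟨_, hvm⟩
  refine (hpos.trans_le ?_).ne'
  rw [Measure.restrict_apply' measurableSet_Ioc]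
  refine measure_mono fun n hn => ⟨?_, ?_⟩
  · exact slice_lt hj (hv hn).2.2.ne (hv hn).1
  · exact ⟨(hv hn).2.1, (hv hn).2.2.le.trans zero_le_one⟩

theorem extent_zero {j n : ℝ} (hj : |j| < 1) (hn : |n| ≤ 1) : extent j 0 n = (1 - n ^ 2) / 2 := by
  have h := (sq_le_one_iff_abs_le_one n).2 hn
  have h1 : level j n ((1 - n ^ 2) / 2) = 0 := level_of_not_mem (by
    rw [abs_of_nonneg (by linarith)]; linarith) j
  have h2 := extent_eq (n := n) hj (show 0 ≤ (1 - n ^ 2) / 2 by linarith) (by linarith)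
  rwa [h1] at h2

theorem slice_zero {j n : ℝ} (hj : |j| < 1) (hn : |n| ≤ 1) (h0 : n ≠ 0 ∨ j ≠ 0) :
    Real.arsinh (bb j ^ 2 * extent j 0 n / kk j n) = -(Real.log ((bb j * n) ^ 2 + j ^ 2) / 2) := by
  have hk := kk_pos hj h0
  have hk2 := kk_sq j n
  have hb := bb_sq hj
  rw [extent_zero hj hn, ← hk2, Real.log_pow]
  have : bb j ^ 2 * ((1 - n ^ 2) / 2) / kk j n = Real.sinh (-Real.log (kk j n)) := by
    rw [Real.sinh_eq, neg_neg, Real.exp_neg, Real.exp_log hk]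
    field_simp
    rw [hk2]; linear_combination (norm := ring_nf) hb
  rw [this, Real.arsinh_sinh]; push_cast; ring

/-- At the boundary level the area is the height of the boundary curve. -/
theorem area_zero_eq {j : ℝ} (hj : |j| < 1) :
    area j 0 = 2 * bb j - 2 * j * Real.arctan (bb j / j) := by
  have hb := bb_sq hj
  unfold area
  by_cases h0 : j = 0
  · subst h0
    have e : ∫ n in (-1 : ℝ)..1, Real.arsinh (bb 0 ^ 2 * extent 0 0 n / kk 0 n) =
        ∫ n in (-1 : ℝ)..1, -Real.log n := by
      refine intervalIntegral.integral_congr_ae ?_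
      filter_upwards [ae_ne_zero] with n hn hn1
      rw [uIoc_of_le (by norm_num)] at hn1
      rw [slice_zero hj (abs_le.2 ⟨hn1.1.le, hn1.2⟩) (Or.inl hn)]
      have : bb 0 = 1 := by simp [bb]
      rw [this]; simp [Real.log_pow]
    rw [e, intervalIntegral.integral_neg, integral_log]
    have : bb 0 = 1 := by simp [bb]
    norm_num [this]
  · rw [← intervalIntegral.integral_const_mul]
    have e : ∫ n in (-1 : ℝ)..1, bb j * Real.arsinh (bb j ^ 2 * extent j 0 n / kk j n) =
        ∫ n in (-1 : ℝ)..1, -(bb j * Real.log ((bb j * n) ^ 2 + j ^ 2) / 2) := by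
      refine intervalIntegral.integral_congr fun n hn => ?_
      rw [uIcc_of_le (by norm_num)] at hn
      rw [slice_zero hj (abs_le.2 ⟨hn.1, hn.2⟩) (Or.inr h0)]; ring
    have hpos : ∀ n, 0 < (bb j * n) ^ 2 + j ^ 2 := fun n => by positivity
    -- integration by parts gives a primitive
    have hd : ∀ n ∈ uIcc (-1 : ℝ) 1, HasDerivAt
        (fun n => bb j * n - j * Real.arctan (bb j * n / j) -
          (bb j * n) * Real.log ((bb j * n) ^ 2 + j ^ 2) / 2)
        (-(bb j * Real.log ((bb j * n) ^ 2 + j ^ 2) / 2)) n := by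
      intro n _
      have e1 : HasDerivAt (fun n => bb j * n) (bb j) n := by
        simpa using (hasDerivAt_id n).const_mul (bb j)
      have e2 := (e1.div_const j).arctan.const_mul j
      have e3 := (((e1.pow 2).add_const (j ^ 2)).log (hpos n).ne')
      refine ((e1.sub e2).sub ((e1.mul e3).div_const 2)).congr_deriv ?_
      have h1 : 0 < 1 + (bb j * n / j) ^ 2 := by positivity
      have h2 := hpos n
      have h3 : 1 + (bb j * n / j) ^ 2 = ((bb j * n) ^ 2 + j ^ 2) / j ^ 2 := by field_simp; ring
      rw [h3]
      simp only [Pi.pow_apply]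
      field_simp
      ring
    have hc : Continuous fun n => -(bb j * Real.log ((bb j * n) ^ 2 + j ^ 2) / 2) :=
      (continuous_const.mul (Continuous.log (by fun_prop) fun n => (hpos n).ne')).div_const 2 |>.neg
    rw [e, intervalIntegral.integral_eq_sub_of_hasDerivAt hd (hc.intervalIntegrable _ _)]
    have h1 : (bb j * 1) ^ 2 + j ^ 2 = 1 := by rw [mul_one, hb]; ring
    have h2 : (bb j * -1) ^ 2 + j ^ 2 = 1 := by rw [mul_neg_one, neg_sq, hb]; ring
    rw [h1, h2, Real.log_one, mul_one, mul_neg_one, neg_div, Real.arctan_neg]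
    ring

theorem height_eq (j : ℝ) :
    height (2 * Real.pi * j) = 2 * bb j - 2 * j * Real.arctan (bb j / j) := by
  have hπ := Real.pi_pos
  have h1 : √(4 * Real.pi ^ 2 - (2 * Real.pi * j) ^ 2) = 2 * Real.pi * bb j := by
    rw [show 4 * Real.pi ^ 2 - (2 * Real.pi * j) ^ 2 = (2 * Real.pi) ^ 2 * (1 - j ^ 2) by ring,
      Real.sqrt_mul (by positivity), Real.sqrt_sq (by positivity)]; rfl
  have h2 : 2 * Real.pi * bb j / (2 * Real.pi * j) = bb j / j :=
    mul_div_mul_left _ _ (by positivity)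
  rw [height, h1, h2]
  field_simp

theorem area_zero {j : ℝ} (hj : |j| ≤ 1) : area j 0 = height (2 * Real.pi * j) := by
  rcases hj.eq_or_lt with h | h
  · have : bb j = 0 := by
      unfold bb; rw [← sq_abs, h]; norm_num
    rw [area_of_abs_eq_one h, height_eq, this]; simp
  · rw [area_zero_eq h, height_eq]

/-! ### Level curves of the Hamiltonian in the reduced spaces -/

theorem fderiv_snd_eq_deriv {E : Type} [NormedAddCommGroup E] [NormedSpace ℝ E] {g : E × ℝ → ℝ}
    {a : E} {t : ℝ} (h : DifferentiableAt ℝ g (a, t)) :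
    fderiv ℝ g (a, t) (0, 1) = deriv (fun t => g (a, t)) t := by
  have h1 : HasDerivAt (fun t : ℝ => (a, t)) ((0 : E), (1 : ℝ)) t :=
    (hasDerivAt_const t a).prodMk (hasDerivAt_id t)
  exact ((h.hasFDerivAt.comp_hasDerivAt t h1).deriv).symm

/-- The domain of `lam`: the axis of a reduced disk, cut at the node when `j = 0`. -/
def axisDom : Set (ℝ × ℝ) := {q | |q.1| < 1 ∧ |q.2| < 1 ∧ (q.2 < 0 ∨ q.1 ≠ 0)}

theorem isOpen_axisDom : IsOpen axisDom :=
  (isOpen_lt (continuous_fst (X := ℝ) (Y := ℝ)).abs continuous_const).inter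
    ((isOpen_lt continuous_snd.abs continuous_const).inter
      ((isOpen_lt continuous_snd continuous_const).union
        (isOpen_ne_fun continuous_fst continuous_const)))

theorem ne_of_slit {n j : ℝ} (h : n < 0 ∨ j ≠ 0) : n ≠ 0 ∨ j ≠ 0 := h.imp_left fun h => h.ne

theorem lam_injOn (j : ℝ) (hj : |j| < 1) :
    StrictMonoOn (fun n => lam j n) {n | |n| < 1 ∧ (n < 0 ∨ j ≠ 0)} := by
  have hcd : ∀ n, |n| < 1 → (n < 0 ∨ j ≠ 0) → ContinuousAt (fun n => lam j n) n := fun n hn h =>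
    (contDiffAt_lam (j := fun _ => j) (n := fun n : ℝ => n) contDiffAt_const contDiffAt_id hj hn
      (ne_of_slit h)).continuousAt
  have hconv : Convex ℝ {n : ℝ | |n| < 1 ∧ (n < 0 ∨ j ≠ 0)} := by
    by_cases h : j = 0
    · have : {n : ℝ | |n| < 1 ∧ (n < 0 ∨ j ≠ 0)} = Ioo (-1) 0 := by
        ext n; simp only [mem_ofPred_eq, abs_lt, mem_Ioo, h]; constructor
        · rintro ⟨h1, h2⟩; exact ⟨h1.1, by simpa using h2⟩
        · rintro ⟨h1, h2⟩; exact ⟨⟨h1, by linarith⟩, Or.inl h2⟩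
      rw [this]; exact convex_Ioo _ _
    · have : {n : ℝ | |n| < 1 ∧ (n < 0 ∨ j ≠ 0)} = Ioo (-1) 1 := by
        ext n; simp [abs_lt, h]
      rw [this]; exact convex_Ioo _ _
  refine strictMonoOn_of_deriv_pos hconv (fun n hn => (hcd n hn.1 hn.2).continuousWithinAt)
    fun n hn => ?_
  have hn' := interior_subset hn
  exact deriv_lam_pos hj hn'.1 (ne_of_slit hn'.2)

open Classical in
/-- The inverse of `lam j`, with the value `0` outside the image. -/
def nInv (q : ℝ × ℝ) : ℝ :=
  if h : ∃ n, (q.1, n) ∈ axisDom ∧ lam q.1 n = q.2 then h.choose else 0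

/-- The set of pairs `(j, lam j n)`. -/
def lamImage : Set (ℝ × ℝ) := {q | ∃ n, (q.1, n) ∈ axisDom ∧ lam q.1 n = q.2}

theorem nInv_spec {q : ℝ × ℝ} (h : q ∈ lamImage) :
    (q.1, nInv q) ∈ axisDom ∧ lam q.1 (nInv q) = q.2 := by
  have h' : ∃ n, (q.1, n) ∈ axisDom ∧ lam q.1 n = q.2 := h
  unfold nInv
  rw [dif_pos h']
  exact h'.choose_spec

theorem nInv_lam {j n : ℝ} (h : (j, n) ∈ axisDom) : nInv (j, lam j n) = n := by
  have h1 := nInv_spec (q := (j, lam j n)) ⟨n, h, rfl⟩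
  exact (lam_injOn j h.1).injOn h1.1.2 h.2 h1.2

theorem nInv_smooth : IsOpen lamImage ∧ ContDiffOn ℝ ∞ nInv lamImage := by
  have hg : ContDiffOn ℝ ∞ (fun q : ℝ × ℝ => lam q.1 q.2) axisDom := fun q hq =>
    (contDiffAt_lam (j := fun q : ℝ × ℝ => q.1) (n := fun q : ℝ × ℝ => q.2) contDiffAt_fst
      contDiffAt_snd hq.1 hq.2.1 (ne_of_slit hq.2.2)).contDiffWithinAt
  refine fiber_inverse isOpen_axisDom hg (fun j n h => ?_)
    (fun j r h => nInv_spec h) (fun j n h => ⟨⟨n, h, rfl⟩, nInv_lam h⟩)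
  rw [fderiv_snd_eq_deriv ((hg.contDiffAt (isOpen_axisDom.mem_nhds h)).differentiableAt (by simp))]
  exact (deriv_lam_pos h.1 h.2.1 (ne_of_slit h.2.2)).ne'

theorem exists_axis_level {j t : ℝ} (hj : |j| < 1) (ht : t ∈ Icc (0 : ℝ) 1) :
    (∃ n ∈ Icc (-1 / 2 : ℝ) 1, level j n 0 = t) ∧
      (∃ n ∈ Icc (-1 : ℝ) (-1 / 2), level j n 0 = t) := by
  have hc : Continuous fun n => level j n 0 := continuous_iff_continuousAt.2 fun n =>
    continuousAt_level_comp continuousAt_const continuousAt_id continuousAt_const hj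
  have h1 : level j 1 0 = 0 := level_of_not_mem (by norm_num) j
  have h2 : level j (-1) 0 = 0 := level_of_not_mem (by norm_num) j
  constructor
  · exact intermediate_value_Icc' (by norm_num) hc.continuousOn (by rwa [h1, level_center])
  · exact intermediate_value_Icc (by norm_num) hc.continuousOn (by rwa [h2, level_center])

theorem ham_eq_of_level {j n u h : ℝ} (hh : 0 ≤ h) (hl : level j n u = (1 + h)⁻¹) :
    n ^ 2 + 2 * |u| < 1 ∧ ham j n u = h := by
  have h0 : 0 < level j n u := by rw [hl]; positivity
  have h1 := level_pos_iff.1 h0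
  refine ⟨h1, ?_⟩
  rw [level_of_mem h1] at hl
  have := inv_injective hl
  linarith

theorem inv_mem_Icc {h : ℝ} (hh : 0 ≤ h) : (1 + h)⁻¹ ∈ Icc (0 : ℝ) 1 :=
  ⟨by positivity, inv_le_one_of_one_le₀ (by linarith)⟩

/-- The range of `lam j` is everything when `j ≠ 0`; when `j = 0` and `n` stays to the left of the
node it contains the `r` with `r² < 1 / 2`, where `1 / 2` is the value of the Hamiltonian at the
node. -/
theorem mem_lamImage {j r : ℝ} (hj : |j| < 1) (h : j ≠ 0 ∨ r ^ 2 < 1 / 2) : (j, r) ∈ lamImage := by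
  obtain ⟨⟨n, hn, hnl⟩, ⟨m, hm, hml⟩⟩ := exists_axis_level hj (inv_mem_Icc (sq_nonneg r))
  obtain ⟨hn1, hn2⟩ := ham_eq_of_level (sq_nonneg r) hnl
  obtain ⟨hm1, hm2⟩ := ham_eq_of_level (sq_nonneg r) hml
  have hn3 := abs_lt_one_of_mem hn1
  have hm3 := abs_lt_one_of_mem hm1
  have hn4 : n < 0 ∨ j ≠ 0 := by
    rcases h with h | h
    · exact Or.inr h
    · exact Or.inl (neg_of_ham_lt hn1 (by rw [hn2]; exact h))
  rcases le_total 0 r with hr | hr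
  · refine ⟨n, ⟨hj, hn3, hn4⟩, ?_⟩
    have h5 : 0 ≤ lam j n := by
      rcases hn.1.eq_or_lt with h6 | h6
      · rw [lam, ← h6]; norm_num
      · exact (lam_pos hj hn3 h6).le
    have h6 := lam_sq hj hn3
    exact (sq_eq_sq₀ h5 hr).1 (by rw [h6, hn2])
  · refine ⟨m, ⟨hj, hm3, Or.inl (by linarith [hm.2])⟩, ?_⟩
    have h5 : lam j m ≤ 0 := by
      rcases hm.2.eq_or_lt with h6 | h6
      · rw [lam, h6]; norm_num
      · exact (lam_neg hj hm3 h6).le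
    have h6 := lam_sq hj hm3
    have := (sq_eq_sq₀ (neg_nonneg.2 h5) (neg_nonneg.2 hr)).1 (by rw [neg_sq, neg_sq, h6, hm2])
    simpa using this

/-- The domain of `pii`: the reduced disks, cut along `n ≥ 0` when `j = 0`. -/
def diskDom : Set ((ℝ × ℝ) × ℝ) :=
  {q | |q.1.1| < 1 ∧ q.1.2 ^ 2 + 2 * |q.2| < 1 ∧ (q.1.2 < 0 ∨ q.1.1 ≠ 0)}

theorem isOpen_diskDom : IsOpen diskDom := by
  have h1 : Continuous fun q : (ℝ × ℝ) × ℝ => q.1.1 := by fun_prop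
  have h2 : Continuous fun q : (ℝ × ℝ) × ℝ => q.1.2 := by fun_prop
  exact (isOpen_lt h1.abs continuous_const).inter
    ((isOpen_lt ((h2.pow 2).add (continuous_snd.abs.const_mul 2)) continuous_const).inter
      ((isOpen_lt h2 continuous_const).union (isOpen_ne_fun h1 continuous_const)))

theorem pii_injOn {j n : ℝ} (hj : |j| < 1) (h : n < 0 ∨ j ≠ 0) :
    StrictMonoOn (fun u => pii j n u) {u | n ^ 2 + 2 * |u| < 1} := by
  have hconv : Convex ℝ {u : ℝ | n ^ 2 + 2 * |u| < 1} := by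
    have : {u : ℝ | n ^ 2 + 2 * |u| < 1} = Ioo (-((1 - n ^ 2) / 2)) ((1 - n ^ 2) / 2) := by
      ext u
      rw [mem_ofPred_eq, mem_Ioo, ← abs_lt]
      constructor <;> intro h <;> linarith
    rw [this]; exact convex_Ioo _ _
  refine strictMonoOn_of_deriv_pos hconv (fun u hu => ?_) fun u hu => ?_
  · exact (contDiffAt_pii (j := fun _ => j) (n := fun _ => n) (u := fun u : ℝ => u)
      contDiffAt_const contDiffAt_const contDiffAt_id hj hu
      (ne_of_slit h)).continuousAt.continuousWithinAt
  · have hu' : n ^ 2 + 2 * |u| < 1 := by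
      have := interior_subset hu
      exact this
    exact deriv_pii_pos hj hu' (ne_of_slit h)

open Classical in
/-- The inverse of `pii j n`, with the value `0` outside the image. -/
def uInv (q : (ℝ × ℝ) × ℝ) : ℝ :=
  if h : ∃ u, (q.1, u) ∈ diskDom ∧ pii q.1.1 q.1.2 u = q.2 then h.choose else 0

/-- The set of triples `((j, n), pii j n u)`. -/
def piiImage : Set ((ℝ × ℝ) × ℝ) := {q | ∃ u, (q.1, u) ∈ diskDom ∧ pii q.1.1 q.1.2 u = q.2}

theorem uInv_spec {q : (ℝ × ℝ) × ℝ} (h : q ∈ piiImage) :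
    (q.1, uInv q) ∈ diskDom ∧ pii q.1.1 q.1.2 (uInv q) = q.2 := by
  have h' : ∃ u, (q.1, u) ∈ diskDom ∧ pii q.1.1 q.1.2 u = q.2 := h
  unfold uInv
  rw [dif_pos h']
  exact h'.choose_spec

theorem uInv_pii {j n u : ℝ} (h : ((j, n), u) ∈ diskDom) : uInv ((j, n), pii j n u) = u := by
  have h1 := uInv_spec (q := ((j, n), pii j n u)) ⟨u, h, rfl⟩
  exact (pii_injOn h.1 h.2.2).injOn h1.1.2.1 h.2.1 h1.2

theorem contDiffOn_pii :
    ContDiffOn ℝ ∞ (fun q : (ℝ × ℝ) × ℝ => pii q.1.1 q.1.2 q.2) diskDom := fun q hq =>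
  (contDiffAt_pii (j := fun q : (ℝ × ℝ) × ℝ => q.1.1) (n := fun q : (ℝ × ℝ) × ℝ => q.1.2)
    (u := fun q : (ℝ × ℝ) × ℝ => q.2) (by fun_prop) (by fun_prop) contDiffAt_snd hq.1 hq.2.1
    (ne_of_slit hq.2.2)).contDiffWithinAt

theorem uInv_smooth : IsOpen piiImage ∧ ContDiffOn ℝ ∞ uInv piiImage := by
  refine fiber_inverse isOpen_diskDom contDiffOn_pii (fun a u h => ?_)
    (fun a r h => uInv_spec h) (fun a u h => ⟨⟨u, h, rfl⟩, uInv_pii h⟩)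
  rw [fderiv_snd_eq_deriv ((contDiffOn_pii.contDiffAt
    (isOpen_diskDom.mem_nhds h)).differentiableAt (by simp))]
  exact (deriv_pii_pos h.1 h.2.1 (ne_of_slit h.2.2)).ne'

/-- The function `pii j n` takes all values, because the Hamiltonian blows up at the boundary. -/
theorem mem_piiImage {j n : ℝ} (h : (j, n) ∈ axisDom) (r : ℝ) : ((j, n), r) ∈ piiImage := by
  have hj := h.1
  have hn := h.2.1
  have hh : 0 ≤ ham j n 0 + r ^ 2 := by
    have := ham_nonneg (j := j) (axis_mem hn); positivity
  have hc : ContinuousOn (fun u => level j n u) (Icc 0 1) := fun u _ =>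
    (continuousAt_level_comp continuousAt_const continuousAt_const continuousAt_id
      hj).continuousWithinAt
  have h1 : level j n 1 = 0 := level_of_not_mem (by norm_num; nlinarith [sq_nonneg n]) j
  obtain ⟨u, hu, hul⟩ := intermediate_value_Icc' zero_le_one hc
    (show (1 + (ham j n 0 + r ^ 2))⁻¹ ∈ Icc (level j n 1) (level j n 0) by
      rw [h1, level_of_mem (axis_mem hn)]
      refine ⟨by positivity, inv_anti₀ ?_ ?_⟩
      · have := ham_nonneg (j := j) (axis_mem hn); positivity
      · nlinarith [sq_nonneg r])
  obtain ⟨hm, hham⟩ := ham_eq_of_level hh hul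
  have hsq := pii_sq hj hm (ne_of_slit h.2.2)
  rw [hham, add_sub_cancel_left] at hsq
  have hu0 : 0 ≤ pii j n u := mul_nonneg hu.1 (Real.sqrt_nonneg _)
  rcases le_total 0 r with hr | hr
  · exact ⟨u, ⟨hj, hm, h.2.2⟩, (sq_eq_sq₀ hu0 hr).1 hsq⟩
  · refine ⟨-u, ⟨hj, by simpa using hm, h.2.2⟩, ?_⟩
    have h2 := (sq_eq_sq₀ hu0 (neg_nonneg.2 hr)).1 (by rw [neg_sq, hsq])
    have h3 : pii j n (-u) = -pii j n u := by simp [pii, quot, tau, zz]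
    simp only [h3, h2]; ring

/-- The pairs `(j, h)` for which the level curve `H = h` in the reduced disk at `j` is a circle
which avoids the node and is not reduced to a point: everything except the branch cut. -/
def curveDom : Set (ℝ × ℝ) := {q | |q.1| < 1 ∧ 0 < q.2 ∧ (q.1 ≠ 0 ∨ q.2 < 1 / 2)}

theorem isOpen_curveDom : IsOpen curveDom :=
  (isOpen_lt (continuous_fst (X := ℝ) (Y := ℝ)).abs continuous_const).inter
    ((isOpen_lt continuous_const continuous_snd).inter
      ((isOpen_ne_fun continuous_fst continuous_const).union
        (isOpen_lt continuous_snd continuous_const)))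

/-- The `n`-coordinate of the point at angle `φ` on the level curve `H = h`. As `H = lam² + pii²`,
the angle is the one with `lam = -√h cos φ` and `pii = √h sin φ`; at `φ = 0` the curve crosses the
axis `u = 0` to the left of the minimum. -/
def cn (q : (ℝ × ℝ) × ℝ) : ℝ := nInv (q.1.1, -(√q.1.2 * Real.cos q.2))

/-- The `u`-coordinate of the point at angle `φ` on the level curve `H = h`. -/
def cu (q : (ℝ × ℝ) × ℝ) : ℝ := uInv ((q.1.1, cn q), √q.1.2 * Real.sin q.2)

theorem cn_arg_mem {q : (ℝ × ℝ) × ℝ} (h : q.1 ∈ curveDom) :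
    (q.1.1, -(√q.1.2 * Real.cos q.2)) ∈ lamImage := by
  refine mem_lamImage h.1 (h.2.2.imp_right fun h1 => ?_)
  rw [neg_sq, mul_pow, Real.sq_sqrt h.2.1.le]
  have := Real.cos_sq_le_one q.2
  have := h.2.1
  nlinarith

theorem cn_spec {q : (ℝ × ℝ) × ℝ} (h : q.1 ∈ curveDom) :
    (q.1.1, cn q) ∈ axisDom ∧ lam q.1.1 (cn q) = -(√q.1.2 * Real.cos q.2) :=
  nInv_spec (cn_arg_mem h)

theorem cu_spec {q : (ℝ × ℝ) × ℝ} (h : q.1 ∈ curveDom) :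
    ((q.1.1, cn q), cu q) ∈ diskDom ∧ pii q.1.1 (cn q) (cu q) = √q.1.2 * Real.sin q.2 :=
  uInv_spec (mem_piiImage (cn_spec h).1 _)

theorem ham_curve {q : (ℝ × ℝ) × ℝ} (h : q.1 ∈ curveDom) : ham q.1.1 (cn q) (cu q) = q.1.2 := by
  obtain ⟨h1, h2⟩ := cn_spec h
  obtain ⟨h3, h4⟩ := cu_spec h
  rw [← lam_sq_add_pii_sq h3.1 h3.2.1 (ne_of_slit h3.2.2)]
  simp only
  rw [h2, h4, neg_sq, mul_pow, mul_pow, ← mul_add, Real.cos_sq_add_sin_sq, mul_one,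
    Real.sq_sqrt h.2.1.le]

theorem isOpen_curveDom_prod : IsOpen (curveDom ×ˢ (univ : Set ℝ)) :=
  isOpen_curveDom.prod isOpen_univ

theorem contDiffAt_cn {q : (ℝ × ℝ) × ℝ} (h : q.1 ∈ curveDom) : ContDiffAt ℝ ∞ cn q := by
  have h1 : ContDiffAt ℝ ∞ nInv (q.1.1, -(√q.1.2 * Real.cos q.2)) :=
    nInv_smooth.2.contDiffAt (nInv_smooth.1.mem_nhds (cn_arg_mem h))
  have h2 : ContDiffAt ℝ ∞ (fun q : (ℝ × ℝ) × ℝ => √q.1.2) q :=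
    ContDiffAt.sqrt (by fun_prop) h.2.1.ne'
  have h3 : ContDiffAt ℝ ∞ (fun q : (ℝ × ℝ) × ℝ => (q.1.1, -(√q.1.2 * Real.cos q.2))) q :=
    ContDiffAt.prodMk (by fun_prop) (h2.mul (by fun_prop)).neg
  exact h1.comp q h3

theorem contDiffAt_cu {q : (ℝ × ℝ) × ℝ} (h : q.1 ∈ curveDom) : ContDiffAt ℝ ∞ cu q := by
  have h1 : ContDiffAt ℝ ∞ uInv ((q.1.1, cn q), √q.1.2 * Real.sin q.2) :=
    uInv_smooth.2.contDiffAt (uInv_smooth.1.mem_nhds (mem_piiImage (cn_spec h).1 _))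
  have h2 : ContDiffAt ℝ ∞ (fun q : (ℝ × ℝ) × ℝ => √q.1.2) q :=
    ContDiffAt.sqrt (by fun_prop) h.2.1.ne'
  have h3 : ContDiffAt ℝ ∞ (fun q : (ℝ × ℝ) × ℝ => ((q.1.1, cn q), √q.1.2 * Real.sin q.2)) q :=
    ContDiffAt.prodMk (ContDiffAt.prodMk (by fun_prop) (contDiffAt_cn h)) (h2.mul (by fun_prop))
  exact h1.comp q h3

/-- Every point of the level curve is attained. -/
theorem exists_angle {j n u : ℝ} (h : ((j, n), u) ∈ diskDom) (hpos : 0 < ham j n u)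
    (hc : j ≠ 0 ∨ ham j n u < 1 / 2) :
    (j, ham j n u) ∈ curveDom ∧ ∃ φ, cn ((j, ham j n u), φ) = n ∧ cu ((j, ham j n u), φ) = u := by
  have hd : (j, ham j n u) ∈ curveDom := ⟨h.1, hpos, hc⟩
  refine ⟨hd, ?_⟩
  have hs := lam_sq_add_pii_sq h.1 h.2.1 (ne_of_slit h.2.2)
  simp only at hs
  have hq : 0 < √(ham j n u) := Real.sqrt_pos.2 hpos
  have hax : (j, n) ∈ axisDom := ⟨h.1, abs_lt_one_of_mem h.2.1, h.2.2⟩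
  obtain ⟨φ, hφ1, hφ2⟩ := exists_cos_sin (c := -lam j n / √(ham j n u))
    (s := pii j n u / √(ham j n u)) (by
      rw [div_pow, div_pow, Real.sq_sqrt hpos.le, neg_sq, ← add_div, hs, div_self hpos.ne'])
  have e1 : cn ((j, ham j n u), φ) = n := by
    unfold cn
    simp only [hφ1]
    rw [show -(√(ham j n u) * (-lam j n / √(ham j n u))) = lam j n by field_simp, nInv_lam hax]
  refine ⟨φ, e1, ?_⟩
  unfold cu
  rw [e1]
  simp only [hφ2]
  rw [show √(ham j n u) * (pii j n u / √(ham j n u)) = pii j n u by field_simp, uInv_pii h]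

theorem cn_add_two_pi (a : ℝ × ℝ) (φ : ℝ) : cn (a, φ + 2 * Real.pi) = cn (a, φ) := by
  simp [cn]

theorem cu_add_two_pi (a : ℝ × ℝ) (φ : ℝ) : cu (a, φ + 2 * Real.pi) = cu (a, φ) := by
  simp [cu, cn]

theorem angle_inj {a : ℝ × ℝ} (h : a ∈ curveDom) {φ φ' : ℝ} (h1 : cn (a, φ) = cn (a, φ'))
    (h2 : cu (a, φ) = cu (a, φ')) : ∃ k : ℤ, φ' = φ + 2 * Real.pi * k := by
  have hq : 0 < √a.2 := Real.sqrt_pos.2 h.2.1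
  have e1 := (cn_spec (q := (a, φ)) h).2
  have e2 := (cn_spec (q := (a, φ')) h).2
  have e3 := (cu_spec (q := (a, φ)) h).2
  have e4 := (cu_spec (q := (a, φ')) h).2
  simp only at e1 e2 e3 e4
  rw [h1, e2] at e1
  rw [h1, h2, e4] at e3
  have hc : Real.cos φ' = Real.cos φ := mul_left_cancel₀ hq.ne' (neg_injective e1)
  have hs : Real.sin φ' = Real.sin φ := mul_left_cancel₀ hq.ne' e3
  obtain ⟨k, hk⟩ := Real.Angle.angle_eq_iff_two_pi_dvd_sub.1 (Real.Angle.cos_sin_inj hc hs)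
  exact ⟨k, by linarith⟩

theorem cu_eq_zero {a : ℝ × ℝ} (h : a ∈ curveDom) {φ : ℝ} (hs : Real.sin φ = 0) :
    cu (a, φ) = 0 := by
  have h1 := (cu_spec (q := (a, φ)) h)
  have h2 := quot_pos h1.1.1 h1.1.2.1 (ne_of_slit h1.1.2.2)
  have h3 := h1.2
  simp only [hs, mul_zero] at h3
  exact (mul_eq_zero.1 h3).resolve_right (Real.sqrt_pos.2 h2).ne'

theorem cu_nonneg {a : ℝ × ℝ} (h : a ∈ curveDom) {φ : ℝ} (hs : 0 ≤ Real.sin φ) :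
    0 ≤ cu (a, φ) := by
  have h1 := (cu_spec (q := (a, φ)) h)
  have h2 := Real.sqrt_pos.2 (quot_pos h1.1.1 h1.1.2.1 (ne_of_slit h1.1.2.2))
  have h3 : 0 ≤ pii a.1 (cn (a, φ)) (cu (a, φ)) := by
    have := h1.2
    simp only at this
    rw [this]; positivity
  exact nonneg_of_mul_nonneg_left h3 h2

theorem cn_neg (a : ℝ × ℝ) (φ : ℝ) : cn (a, -φ) = cn (a, φ) := by
  simp [cn]

theorem pii_neg (j n u : ℝ) : pii j n (-u) = -pii j n u := by simp [pii, quot, tau, zz]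

theorem cu_neg {a : ℝ × ℝ} (h : a ∈ curveDom) (φ : ℝ) : cu (a, -φ) = -cu (a, φ) := by
  have h1 := (cu_spec (q := (a, φ)) h)
  have h2 : ((a.1, cn (a, φ)), -cu (a, φ)) ∈ diskDom :=
    ⟨h1.1.1, by simpa using h1.1.2.1, h1.1.2.2⟩
  have h3 := uInv_pii h2
  have h4 := h1.2
  simp only at h4
  rw [pii_neg, h4] at h3
  rw [← h3]
  simp [cu, cn]

/-! ### Action integrals of the level curves -/

/-- If `dσ = x dy + T dA + s ℓ` with `ℓ` constant, then `dx ∧ dy = dA ∧ dT + ℓ ∧ ds`. -/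
theorem exact_decomp {E : Type} [NormedAddCommGroup E] [NormedSpace ℝ E] {σ y A x T s : E → ℝ}
    {ℓ : E →L[ℝ] ℝ} {p : E} (hσ : ContDiffAt ℝ ∞ σ p) (hy : ContDiffAt ℝ ∞ y p)
    (hA : ContDiffAt ℝ ∞ A p) (hx : DifferentiableAt ℝ x p) (hT : DifferentiableAt ℝ T p)
    (hs : DifferentiableAt ℝ s p)
    (h : ∀ᶠ q in 𝓝 p, fderiv ℝ σ q = x q • fderiv ℝ y q + T q • fderiv ℝ A q + s q • ℓ)
    (v w : E) :
    fderiv ℝ x p v * fderiv ℝ y p w - fderiv ℝ x p w * fderiv ℝ y p v =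
      (fderiv ℝ A p v * fderiv ℝ T p w - fderiv ℝ A p w * fderiv ℝ T p v) +
      (ℓ v * fderiv ℝ s p w - ℓ w * fderiv ℝ s p v) := by
  have hdiff : ∀ {g : E → ℝ}, ContDiffAt ℝ ∞ g p → DifferentiableAt ℝ (fderiv ℝ g) p := fun hg =>
    (hg.fderiv_right (m := ∞) (by simp)).differentiableAt (by simp)
  have hsymm : ∀ {g : E → ℝ}, ContDiffAt ℝ ∞ g p →
      fderiv ℝ (fderiv ℝ g) p v w = fderiv ℝ (fderiv ℝ g) p w v := fun hg =>
    (hg.isSymmSndFDerivAt (by simp; exact WithTop.coe_le_coe.2 le_top)).eq v w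
  have h1 : HasFDerivAt (fderiv ℝ σ) _ p :=
    (((hx.hasFDerivAt.smul (hdiff hy).hasFDerivAt).add
      (hT.hasFDerivAt.smul (hdiff hA).hasFDerivAt)).add
      (hs.hasFDerivAt.smul_const ℓ)).congr_of_eventuallyEq h
  have h2 := hsymm hσ
  rw [h1.fderiv] at h2
  simp only [_root_.add_apply, _root_.smul_apply, ContinuousLinearMap.smulRight_apply,
    smul_eq_mul] at h2
  have h3 := hsymm hy
  have h4 := hsymm hA
  rw [h3, h4] at h2
  linear_combination h2

/-- The coordinate `x` of `lift` in terms of the reduced coordinates. -/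
def xcoord (j n u : ℝ) : ℝ := Real.arsinh (bb j ^ 2 * u / kk j n) / 2

theorem contDiffOn_xcoord :
    ContDiffOn ℝ ∞ (fun q : (ℝ × ℝ) × ℝ => xcoord q.1.1 q.1.2 q.2) diskDom := by
  intro q hq
  have h0 := ne_of_slit hq.2.2
  have h1 := contDiffAt_kk (e := q) (j := fun q : (ℝ × ℝ) × ℝ => q.1.1)
    (n := fun q : (ℝ × ℝ) × ℝ => q.1.2) (by fun_prop) (by fun_prop) hq.1 h0
  have h2 := contDiffAt_bb (e := q) (j := fun q : (ℝ × ℝ) × ℝ => q.1.1) (by fun_prop) hq.1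
  have h3 := (((h2.pow 2).mul contDiffAt_snd).div h1 (kk_pos hq.1 h0).ne').arsinh.div_const 2
  exact h3.contDiffWithinAt

theorem deriv_xcoord_pos {j n : ℝ} (hj : |j| < 1) (h0 : n ≠ 0 ∨ j ≠ 0) (u : ℝ) :
    0 < deriv (fun u => xcoord j n u) u := by
  have hk := kk_pos hj h0
  have hb := bb_pos hj
  have h1 : HasDerivAt (fun u => bb j ^ 2 * u / kk j n) (bb j ^ 2 * 1 / kk j n) u :=
    ((hasDerivAt_id u).const_mul _).div_const _
  rw [show (fun u => xcoord j n u) = fun u => Real.arsinh (bb j ^ 2 * u / kk j n) / 2 from rfl,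
    (h1.arsinh.div_const 2).deriv]
  simp only [smul_eq_mul]
  positivity

/-- The coordinate `y = p · q` along the level curves. -/
def yy (q : (ℝ × ℝ) × ℝ) : ℝ := bb q.1.1 * cn q

/-- The coordinate `x` of `lift` along the level curves. -/
def xx (q : (ℝ × ℝ) × ℝ) : ℝ := xcoord q.1.1 (cn q) (cu q)

theorem contDiffAt_yy {q : (ℝ × ℝ) × ℝ} (h : q.1 ∈ curveDom) : ContDiffAt ℝ ∞ yy q :=
  (contDiffAt_bb (j := fun q : (ℝ × ℝ) × ℝ => q.1.1) (by fun_prop) h.1).mul (contDiffAt_cn h)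

theorem contDiffAt_curve {q : (ℝ × ℝ) × ℝ} (h : q.1 ∈ curveDom) :
    ContDiffAt ℝ ∞ (fun q : (ℝ × ℝ) × ℝ => ((q.1.1, cn q), cu q)) q :=
  ContDiffAt.prodMk (ContDiffAt.prodMk (by fun_prop) (contDiffAt_cn h)) (contDiffAt_cu h)

theorem contDiffAt_xx {q : (ℝ × ℝ) × ℝ} (h : q.1 ∈ curveDom) : ContDiffAt ℝ ∞ xx q := by
  have h1 := contDiffOn_xcoord.contDiffAt (isOpen_diskDom.mem_nhds (cu_spec h).1)
  exact h1.comp q (contDiffAt_curve h)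

/-- In the `(h, φ)`-planes the form `dx ∧ dy` is a positive multiple of `dh ∧ dφ`. -/
theorem wedge_pos {q : (ℝ × ℝ) × ℝ} (h : q.1 ∈ curveDom) :
    0 < fderiv ℝ xx q ((0, 1), 0) * fderiv ℝ yy q (0, 1) -
      fderiv ℝ xx q (0, 1) * fderiv ℝ yy q ((0, 1), 0) := by
  obtain ⟨⟨j, hh⟩, φ⟩ := q
  set q : (ℝ × ℝ) × ℝ := ((j, hh), φ) with hq
  have hj : |j| < 1 := h.1
  have hpos : 0 < hh := h.2.1
  obtain ⟨hax, hlam⟩ := cn_spec h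
  obtain ⟨hdk, hpii⟩ := cu_spec h
  have h0 := ne_of_slit hdk.2.2
  have hcn := (contDiffAt_cn h).differentiableAt (by simp)
  have hcu := (contDiffAt_cu h).differentiableAt (by simp)
  have hcv := ((contDiffAt_curve h).differentiableAt (by simp)).hasFDerivAt
  -- derivative of the curve
  have hcurve : ∀ v : (ℝ × ℝ) × ℝ,
      fderiv ℝ (fun q : (ℝ × ℝ) × ℝ => ((q.1.1, cn q), cu q)) q v =
        ((v.1.1, fderiv ℝ cn q v), fderiv ℝ cu q v) := by
    intro v
    have e1 : HasFDerivAt (fun q : (ℝ × ℝ) × ℝ => q.1.1)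
      ((ContinuousLinearMap.fst ℝ ℝ ℝ).comp (ContinuousLinearMap.fst ℝ (ℝ × ℝ) ℝ)) q :=
      ((ContinuousLinearMap.fst ℝ ℝ ℝ).comp (ContinuousLinearMap.fst ℝ (ℝ × ℝ) ℝ)).hasFDerivAt
    rw [((e1.prodMk hcn.hasFDerivAt).prodMk hcu.hasFDerivAt).fderiv]
    rfl
  have hchain : ∀ {G : (ℝ × ℝ) × ℝ → ℝ}, ContDiffOn ℝ ∞ G diskDom → ∀ v : (ℝ × ℝ) × ℝ,
      v.1.1 = 0 → fderiv ℝ (fun q : (ℝ × ℝ) × ℝ => G ((q.1.1, cn q), cu q)) q v =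
        fderiv ℝ cn q v * fderiv ℝ G ((j, cn q), cu q) ((0, 1), 0) +
        fderiv ℝ cu q v * fderiv ℝ G ((j, cn q), cu q) (0, 1) := by
    intro G hG v hv
    have e1 := ((hG.contDiffAt (isOpen_diskDom.mem_nhds hdk)).differentiableAt
      (by simp)).hasFDerivAt
    have e2 : HasFDerivAt (fun q : (ℝ × ℝ) × ℝ => G ((q.1.1, cn q), cu q)) _ q :=
      HasFDerivAt.comp q e1 hcv
    rw [e2.fderiv, ContinuousLinearMap.comp_apply, hcurve, hv]
    rw [show (((0 : ℝ), fderiv ℝ cn q v), fderiv ℝ cu q v) =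
      fderiv ℝ cn q v • (((0, 1), 0) : (ℝ × ℝ) × ℝ) + fderiv ℝ cu q v • ((0, 1) : (ℝ × ℝ) × ℝ)
      by simp [Prod.zero_eq_mk], map_add, map_smul, map_smul]
    rfl
  have hlamd : ContDiffOn ℝ ∞ (fun q : (ℝ × ℝ) × ℝ => lam q.1.1 q.1.2) diskDom := fun q hq =>
    (contDiffAt_lam (j := fun q : (ℝ × ℝ) × ℝ => q.1.1) (n := fun q : (ℝ × ℝ) × ℝ => q.1.2)
      (by fun_prop) (by fun_prop) hq.1 (abs_lt_one_of_mem hq.2.1)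
      (ne_of_slit hq.2.2)).contDiffWithinAt
  have hev : ∀ᶠ q' : (ℝ × ℝ) × ℝ in 𝓝 q, q'.1 ∈ curveDom :=
    continuousAt_fst.eventually (isOpen_curveDom.mem_nhds h)
  have hsq : HasFDerivAt (fun q : (ℝ × ℝ) × ℝ => √q.1.2)
      ((1 / (2 * √hh)) • ((ContinuousLinearMap.snd ℝ ℝ ℝ).comp
        (ContinuousLinearMap.fst ℝ (ℝ × ℝ) ℝ))) q :=
    HasFDerivAt.sqrt (f := fun q : (ℝ × ℝ) × ℝ => q.1.2) (x := q)
      (((ContinuousLinearMap.snd ℝ ℝ ℝ).comp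
        (ContinuousLinearMap.fst ℝ (ℝ × ℝ) ℝ)).hasFDerivAt) hpos.ne'
  have hsnd : HasFDerivAt (fun q : (ℝ × ℝ) × ℝ => q.2) (ContinuousLinearMap.snd ℝ (ℝ × ℝ) ℝ) q :=
    (ContinuousLinearMap.snd ℝ (ℝ × ℝ) ℝ).hasFDerivAt
  have hL : (fun q : (ℝ × ℝ) × ℝ => lam q.1.1 (cn q)) =ᶠ[𝓝 q]
      fun q => -(√q.1.2 * Real.cos q.2) := hev.mono fun q' h' => (cn_spec h').2
  have hP : (fun q : (ℝ × ℝ) × ℝ => pii q.1.1 (cn q) (cu q)) =ᶠ[𝓝 q]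
      fun q => √q.1.2 * Real.sin q.2 := hev.mono fun q' h' => (cu_spec h').2
  have dL := hL.fderiv_eq.trans (hsq.mul hsnd.cos).neg.fderiv
  have dP := hP.fderiv_eq.trans (hsq.mul hsnd.sin).fderiv
  have L1 := hchain hlamd
  have P1 := hchain contDiffOn_pii
  have X1 := hchain contDiffOn_xcoord
  have lu : fderiv ℝ (fun q : (ℝ × ℝ) × ℝ => lam q.1.1 q.1.2) ((j, cn q), cu q) (0, 1) = 0 := by
    rw [fderiv_snd_eq_deriv ((hlamd.contDiffAt (isOpen_diskDom.mem_nhds hdk)).differentiableAt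
      (by simp))]
    exact deriv_const (cu q) (lam j (cn q))
  have ln : 0 < fderiv ℝ (fun q : (ℝ × ℝ) × ℝ => lam q.1.1 q.1.2) ((j, cn q), cu q)
      ((0, 1), 0) := by
    have e1 := ((hlamd.contDiffAt (isOpen_diskDom.mem_nhds hdk)).differentiableAt
      (by simp)).hasFDerivAt
    have e2 : HasDerivAt (fun n : ℝ => (((j, n), cu q) : (ℝ × ℝ) × ℝ)) ((0, 1), 0) (cn q) :=
      ((hasDerivAt_const _ _).prodMk (hasDerivAt_id _)).prodMk (hasDerivAt_const _ _)
    have e3 := (e1.comp_hasDerivAt (cn q) e2).deriv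
    rw [← e3]
    exact deriv_lam_pos hj hax.2.1 h0
  have pu : 0 < fderiv ℝ (fun q : (ℝ × ℝ) × ℝ => pii q.1.1 q.1.2 q.2) ((j, cn q), cu q)
      (0, 1) := by
    rw [fderiv_snd_eq_deriv ((contDiffOn_pii.contDiffAt
      (isOpen_diskDom.mem_nhds hdk)).differentiableAt (by simp))]
    exact deriv_pii_pos hj hdk.2.1 h0
  have xu : 0 < fderiv ℝ (fun q : (ℝ × ℝ) × ℝ => xcoord q.1.1 q.1.2 q.2) ((j, cn q), cu q)
      (0, 1) := by
    rw [fderiv_snd_eq_deriv ((contDiffOn_xcoord.contDiffAt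
      (isOpen_diskDom.mem_nhds hdk)).differentiableAt (by simp))]
    exact deriv_xcoord_pos hj h0 _
  have hyv : ∀ v : (ℝ × ℝ) × ℝ, v.1.1 = 0 → fderiv ℝ yy q v = bb j * fderiv ℝ cn q v := by
    intro v hv
    have eb : ContDiffAt ℝ ∞ bb j := contDiffAt_bb (j := fun j : ℝ => j) contDiffAt_id hj
    have e1 : HasFDerivAt (fun q : (ℝ × ℝ) × ℝ => bb q.1.1) _ q :=
      HasFDerivAt.comp (g := bb) (f := fun q : (ℝ × ℝ) × ℝ => q.1.1) q
        (eb.differentiableAt (by simp)).hasFDerivAt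
        ((ContinuousLinearMap.fst ℝ ℝ ℝ).comp (ContinuousLinearMap.fst ℝ (ℝ × ℝ) ℝ)).hasFDerivAt
    have e2 : HasFDerivAt yy _ q := e1.mul hcn.hasFDerivAt
    rw [e2.fderiv]
    simp [hv, hq]
  have Lh := (L1 ((0, 1), 0) rfl).symm.trans (congrArg (fun l => l ((0, 1), 0)) dL)
  have Lφ := (L1 (0, 1) rfl).symm.trans (congrArg (fun l => l (0, 1)) dL)
  have Ph := (P1 ((0, 1), 0) rfl).symm.trans (congrArg (fun l => l ((0, 1), 0)) dP)
  have Pφ := (P1 (0, 1) rfl).symm.trans (congrArg (fun l => l (0, 1)) dP)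
  have Xh := X1 ((0, 1), 0) rfl
  have Xφ := X1 (0, 1) rfl
  have hr : 0 < √hh := Real.sqrt_pos.2 hpos
  have hb := bb_pos hj
  rw [hyv _ rfl, hyv _ rfl, show xx = fun q : (ℝ × ℝ) × ℝ => xcoord q.1.1 (cn q) (cu q) from rfl,
    Xh, Xφ]
  simp [lu] at Lh Lφ Ph Pφ
  clear dL dP L1 P1 X1 Xh Xφ hL hP hchain hcurve
  generalize fderiv ℝ cn q ((0, 1), 0) = nh at *
  generalize fderiv ℝ cn q (0, 1) = nφ at *
  generalize fderiv ℝ cu q ((0, 1), 0) = uh at *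
  generalize fderiv ℝ cu q (0, 1) = uφ at *
  generalize fderiv ℝ (fun q : (ℝ × ℝ) × ℝ => lam q.1.1 q.1.2) ((j, cn q), cu q)
      ((0, 1), 0) = a at *
  generalize fderiv ℝ (fun q : (ℝ × ℝ) × ℝ => pii q.1.1 q.1.2 q.2) ((j, cn q), cu q)
      (0, 1) = pu' at *
  generalize fderiv ℝ (fun q : (ℝ × ℝ) × ℝ => pii q.1.1 q.1.2 q.2) ((j, cn q), cu q)
      ((0, 1), 0) = pn' at *
  generalize fderiv ℝ (fun q : (ℝ × ℝ) × ℝ => xcoord q.1.1 q.1.2 q.2) ((j, cn q), cu q)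
      (0, 1) = xu' at *
  generalize fderiv ℝ (fun q : (ℝ × ℝ) × ℝ => xcoord q.1.1 q.1.2 q.2) ((j, cn q), cu q)
      ((0, 1), 0) = xn' at *
  have hkey : a * pu' * (uh * nφ - uφ * nh) = 1 / 2 := by
    have e1 : √hh * (√hh)⁻¹ = 1 := mul_inv_cancel₀ hr.ne'
    have e2 := Real.sin_sq_add_cos_sq q.2
    have Lφ' : nφ * a = √hh * Real.sin q.2 := Lφ
    have Pφ' : nφ * pn' + uφ * pu' = √hh * Real.cos q.2 := Pφ
    linear_combination (a * nφ) * Ph - (a * nh) * Pφ' +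
      (Real.sin q.2 * ((√hh)⁻¹ * 2⁻¹)) * Lφ' - (√hh * Real.cos q.2) * Lh +
      (Real.sin q.2 ^ 2 + Real.cos q.2 ^ 2) / 2 * e1 + e2 / 2
  have hpos' : 0 < uh * nφ - uφ * nh := by
    by_contra hneg
    have := mul_nonpos_of_nonneg_of_nonpos (mul_pos ln pu).le (not_lt.1 hneg)
    linarith
  have : (nh * xn' + uh * xu') * (bb j * nφ) - (nφ * xn' + uφ * xu') * (bb j * nh) =
      bb j * xu' * (uh * nφ - uφ * nh) := by ring
  rw [this]
  positivity

/-- The density `x ∂y/∂φ` of the form `x dy` along a level curve. -/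
def actionForm (a : ℝ × ℝ) (φ : ℝ) : ℝ := xx (a, φ) * fderiv ℝ yy (a, φ) (0, 1)

/-- The integral `σ` of `x dy` along a level curve, from angle `0` to angle `φ`. -/
def sig (q : (ℝ × ℝ) × ℝ) : ℝ := ∫ t in (0 : ℝ)..q.2, actionForm q.1 t

/-- The area enclosed by a level curve. -/
def action (a : ℝ × ℝ) : ℝ := sig (a, 2 * Real.pi)

theorem xx_zero {a : ℝ × ℝ} (h : a ∈ curveDom) : xx (a, 0) = 0 := by
  simp [xx, xcoord, cu_eq_zero h Real.sin_zero]

theorem xx_add_two_pi (a : ℝ × ℝ) (φ : ℝ) : xx (a, φ + 2 * Real.pi) = xx (a, φ) := by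
  simp only [xx, cn_add_two_pi, cu_add_two_pi]

theorem yy_add_two_pi (a : ℝ × ℝ) (φ : ℝ) : yy (a, φ + 2 * Real.pi) = yy (a, φ) := by
  simp only [yy, cn_add_two_pi]

theorem fderiv_yy_add_two_pi (a : ℝ × ℝ) (φ : ℝ) :
    fderiv ℝ yy (a, φ + 2 * Real.pi) = fderiv ℝ yy (a, φ) := by
  have h1 : (fun q : (ℝ × ℝ) × ℝ => yy (q + (0, 2 * Real.pi))) = yy := by
    funext q
    rw [show q + (0, 2 * Real.pi) = (q.1, q.2 + 2 * Real.pi) by ext <;> simp]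
    exact yy_add_two_pi q.1 q.2
  have h2 := fderiv_comp_add_right (𝕜 := ℝ) (f := yy) (x := (a, φ)) ((0 : ℝ × ℝ), 2 * Real.pi)
  rw [h1] at h2
  rw [h2]
  simp

theorem actionForm_add_two_pi (a : ℝ × ℝ) (φ : ℝ) :
    actionForm a (φ + 2 * Real.pi) = actionForm a φ := by
  simp only [actionForm, xx_add_two_pi, fderiv_yy_add_two_pi]

theorem contDiffAt_actionForm {q : (ℝ × ℝ) × ℝ} (h : q.1 ∈ curveDom) :
    ContDiffAt ℝ ∞ (Function.uncurry actionForm) q :=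
  (contDiffAt_xx h).mul (((contDiffAt_yy h).fderiv_right (m := ∞) (by simp)).clm_apply
    contDiffAt_const)

theorem contDiffAt_sig {q : (ℝ × ℝ) × ℝ} (h : q.1 ∈ curveDom) : ContDiffAt ℝ ∞ sig q :=
  (contDiffOn_primitive isOpen_curveDom (g := actionForm) fun _ hq =>
    (contDiffAt_actionForm hq.1).contDiffWithinAt).contDiffAt
      (isOpen_curveDom_prod.mem_nhds ⟨h, mem_univ _⟩)

theorem continuous_actionForm {a : ℝ × ℝ} (h : a ∈ curveDom) : Continuous (actionForm a) :=
  continuous_iff_continuousAt.2 fun φ =>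
    (contDiffAt_actionForm (q := (a, φ)) h).continuousAt.comp
      (continuousAt_const.prodMk continuousAt_id)

theorem fderiv_sig_angle {q : (ℝ × ℝ) × ℝ} (h : q.1 ∈ curveDom) :
    fderiv ℝ sig q (0, 1) = xx q * fderiv ℝ yy q (0, 1) := by
  have h1 := fderiv_snd_eq_deriv (a := q.1) (t := q.2)
    ((contDiffAt_sig h).differentiableAt (by simp))
  rw [h1]
  exact (continuous_actionForm h).deriv_integral _ _ _

theorem sig_zero (a : ℝ × ℝ) : sig (a, 0) = 0 := by simp [sig]

theorem sig_add_two_pi {a : ℝ × ℝ} (h : a ∈ curveDom) (φ : ℝ) :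
    sig (a, φ + 2 * Real.pi) = sig (a, φ) + action a := by
  have hp : Function.Periodic (actionForm a) (2 * Real.pi) := actionForm_add_two_pi a
  have hi : ∀ s t : ℝ, IntervalIntegrable (actionForm a) volume s t := fun s t =>
    (continuous_actionForm h).intervalIntegrable s t
  have h1 := hp.intervalIntegral_add_eq φ 0
  simp only [zero_add] at h1
  simp only [sig, action]
  rw [← h1, intervalIntegral.integral_add_adjacent_intervals (hi _ _) (hi _ _)]

theorem contDiffAt_action {a : ℝ × ℝ} (h : a ∈ curveDom) : ContDiffAt ℝ ∞ action a :=
  (contDiffAt_sig (q := (a, 2 * Real.pi)) h).comp a (f := fun a : ℝ × ℝ => (a, 2 * Real.pi))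
    (by fun_prop)

/-- The coefficient of `dh` in `dσ - x dy`. -/
def hCoef (q : (ℝ × ℝ) × ℝ) : ℝ :=
  fderiv ℝ sig q ((0, 1), 0) - xx q * fderiv ℝ yy q ((0, 1), 0)

/-- The coefficient of `dj` in `dσ - x dy`. -/
def jCoef (q : (ℝ × ℝ) × ℝ) : ℝ :=
  fderiv ℝ sig q ((1, 0), 0) - xx q * fderiv ℝ yy q ((1, 0), 0)

theorem contDiffAt_coef {q : (ℝ × ℝ) × ℝ} (h : q.1 ∈ curveDom) (v : (ℝ × ℝ) × ℝ) :
    ContDiffAt ℝ ∞ (fun q => fderiv ℝ sig q v - xx q * fderiv ℝ yy q v) q :=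
  (((contDiffAt_sig h).fderiv_right (m := ∞) (by simp)).clm_apply contDiffAt_const).sub
    ((contDiffAt_xx h).mul (((contDiffAt_yy h).fderiv_right (m := ∞) (by simp)).clm_apply
      contDiffAt_const))

theorem contDiffAt_hCoef {q : (ℝ × ℝ) × ℝ} (h : q.1 ∈ curveDom) : ContDiffAt ℝ ∞ hCoef q :=
  contDiffAt_coef h _

theorem contDiffAt_jCoef {q : (ℝ × ℝ) × ℝ} (h : q.1 ∈ curveDom) : ContDiffAt ℝ ∞ jCoef q :=
  contDiffAt_coef h _

/-- The coordinate form `dj`. -/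
def dj : (ℝ × ℝ) × ℝ →L[ℝ] ℝ :=
  (ContinuousLinearMap.fst ℝ ℝ ℝ).comp (ContinuousLinearMap.fst ℝ (ℝ × ℝ) ℝ)

/-- The coordinate form `dh`. -/
def dh : (ℝ × ℝ) × ℝ →L[ℝ] ℝ :=
  (ContinuousLinearMap.snd ℝ ℝ ℝ).comp (ContinuousLinearMap.fst ℝ (ℝ × ℝ) ℝ)

theorem dj_apply (v : (ℝ × ℝ) × ℝ) : dj v = v.1.1 := rfl

theorem dh_apply (v : (ℝ × ℝ) × ℝ) : dh v = v.1.2 := rfl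

theorem clm_ext {L M : (ℝ × ℝ) × ℝ →L[ℝ] ℝ} (h1 : L ((1, 0), 0) = M ((1, 0), 0))
    (h2 : L ((0, 1), 0) = M ((0, 1), 0)) (h3 : L (0, 1) = M (0, 1)) : L = M := by
  ext <;> simpa

theorem fderiv_sig {q : (ℝ × ℝ) × ℝ} (h : q.1 ∈ curveDom) :
    fderiv ℝ sig q = xx q • fderiv ℝ yy q + hCoef q • dh + jCoef q • dj := by
  refine clm_ext ?_ ?_ ?_ <;>
    simp only [_root_.add_apply, _root_.smul_apply, smul_eq_mul, hCoef, jCoef, dj_apply, dh_apply,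
      fderiv_sig_angle h] <;> simp

theorem eventually_curveDom {q : (ℝ × ℝ) × ℝ} (h : q.1 ∈ curveDom) :
    ∀ᶠ q' : (ℝ × ℝ) × ℝ in 𝓝 q, q'.1 ∈ curveDom :=
  continuousAt_fst.eventually (isOpen_curveDom.mem_nhds h)

/-- By `exact_decomp` the form `dx ∧ dy` equals `dh ∧ d(hCoef) + dj ∧ d(jCoef)`, so that the
derivative of `hCoef` along the level curve is the coefficient which is positive by `wedge_pos`. -/
theorem fderiv_hCoef_angle {q : (ℝ × ℝ) × ℝ} (h : q.1 ∈ curveDom) :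
    0 < fderiv ℝ hCoef q (0, 1) := by
  have hfun : fderiv ℝ (fun q : (ℝ × ℝ) × ℝ => q.1.2) = fun _ => dh := by
    funext q; exact dh.fderiv
  have h1 := exact_decomp (σ := sig) (y := yy) (A := fun q : (ℝ × ℝ) × ℝ => q.1.2) (x := xx)
    (T := hCoef) (s := jCoef) (ℓ := dj) (contDiffAt_sig h) (contDiffAt_yy h) (by fun_prop)
    ((contDiffAt_xx h).differentiableAt (by simp)) ((contDiffAt_hCoef h).differentiableAt (by simp))
    ((contDiffAt_jCoef h).differentiableAt (by simp))
    ((eventually_curveDom h).mono fun q' h' => by rw [fderiv_sig h', hfun])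
    ((0, 1), 0) (0, 1)
  rw [hfun] at h1
  have h2 := wedge_pos h
  rw [h1] at h2
  simpa [dj_apply, dh_apply] using h2

theorem fderiv_sig_add_two_pi {a : ℝ × ℝ} (h : a ∈ curveDom) (φ : ℝ) (v : ℝ × ℝ) :
    fderiv ℝ sig (a, φ + 2 * Real.pi) (v, 0) = fderiv ℝ sig (a, φ) (v, 0) +
      fderiv ℝ action a v := by
  have h1 : (fun q : (ℝ × ℝ) × ℝ => sig (q + (0, 2 * Real.pi))) =ᶠ[𝓝 (a, φ)]
      fun q => sig q + action q.1 := by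
    refine (eventually_curveDom (q := (a, φ)) h).mono fun q hq => ?_
    beta_reduce
    rw [show q + (0, 2 * Real.pi) = (q.1, q.2 + 2 * Real.pi) by ext <;> simp]
    exact sig_add_two_pi hq q.2
  have h2 := fderiv_comp_add_right (𝕜 := ℝ) (f := sig) (x := (a, φ)) ((0 : ℝ × ℝ), 2 * Real.pi)
  rw [h1.fderiv_eq] at h2
  have h3 : HasFDerivAt (fun q : (ℝ × ℝ) × ℝ => action q.1) _ (a, φ) :=
    HasFDerivAt.comp (a, φ) (g := action) (f := fun q : (ℝ × ℝ) × ℝ => q.1)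
      ((contDiffAt_action h).differentiableAt (by simp)).hasFDerivAt
      (ContinuousLinearMap.fst ℝ (ℝ × ℝ) ℝ).hasFDerivAt
  have h4 :=
    (((contDiffAt_sig (q := (a, φ)) h).differentiableAt (by simp)).hasFDerivAt.add h3).fderiv
  have h5 : ((a, φ) : (ℝ × ℝ) × ℝ) + (0, 2 * Real.pi) = (a, φ + 2 * Real.pi) := by simp
  rw [h5] at h2
  rw [← h2]
  refine (congrArg (fun L => L (v, 0)) h4).trans ?_
  simp

theorem hCoef_add_two_pi {a : ℝ × ℝ} (h : a ∈ curveDom) (φ : ℝ) :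
    hCoef (a, φ + 2 * Real.pi) = hCoef (a, φ) + fderiv ℝ action a (0, 1) := by
  simp only [hCoef, fderiv_sig_add_two_pi h, xx_add_two_pi, fderiv_yy_add_two_pi]; ring

theorem jCoef_add_two_pi {a : ℝ × ℝ} (h : a ∈ curveDom) (φ : ℝ) :
    jCoef (a, φ + 2 * Real.pi) = jCoef (a, φ) + fderiv ℝ action a (1, 0) := by
  simp only [jCoef, fderiv_sig_add_two_pi h, xx_add_two_pi, fderiv_yy_add_two_pi]; ring

theorem fderiv_sig_zero {a : ℝ × ℝ} (h : a ∈ curveDom) (v : ℝ × ℝ) :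
    fderiv ℝ sig (a, 0) (v, 0) = 0 := by
  have h1 : HasFDerivAt (fun b : ℝ × ℝ => ((b, 0) : (ℝ × ℝ) × ℝ))
      (ContinuousLinearMap.inl ℝ (ℝ × ℝ) ℝ) a := (ContinuousLinearMap.inl ℝ (ℝ × ℝ) ℝ).hasFDerivAt
  have h2 := (((contDiffAt_sig (q := (a, 0)) h).differentiableAt (by simp)).hasFDerivAt.comp a
    h1).fderiv
  have h3 : (sig ∘ fun b : ℝ × ℝ => ((b, 0) : (ℝ × ℝ) × ℝ)) = fun _ => 0 := by
    funext b; exact sig_zero b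
  rw [h3] at h2
  have h4 := congrArg (fun L => L v) h2
  simpa using h4.symm

theorem hCoef_zero {a : ℝ × ℝ} (h : a ∈ curveDom) : hCoef (a, 0) = 0 := by
  simp [hCoef, fderiv_sig_zero h, xx_zero h]

theorem strictMono_hCoef {a : ℝ × ℝ} (h : a ∈ curveDom) : StrictMono fun φ => hCoef (a, φ) := by
  refine strictMono_of_deriv_pos fun φ => ?_
  rw [← fderiv_snd_eq_deriv ((contDiffAt_hCoef (q := (a, φ)) h).differentiableAt (by simp))]
  exact fderiv_hCoef_angle h

/-- The derivative of the enclosed area with respect to `h` is the increment of the increasing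
function `hCoef` over a period. -/
theorem fderiv_action_pos {a : ℝ × ℝ} (h : a ∈ curveDom) : 0 < fderiv ℝ action a (0, 1) := by
  have h1 := hCoef_add_two_pi h 0
  have h2 := strictMono_hCoef h (show (0 : ℝ) < 0 + 2 * Real.pi by positivity)
  simp only at h2
  linarith

/-- The angle coordinate conjugate to the area of the level curves. -/
def angleCoord (q : (ℝ × ℝ) × ℝ) : ℝ := hCoef q / fderiv ℝ action q.1 (0, 1)

/-- The shift of the rotation angle along a level curve: the angle of `lift` which is conjugate to
`j` when the other pair of conjugate variables is `(action, angleCoord)` instead of `(x, y)`. -/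
def shift (q : (ℝ × ℝ) × ℝ) : ℝ := jCoef q - angleCoord q * fderiv ℝ action q.1 (1, 0)

theorem contDiffAt_fderiv_action {q : (ℝ × ℝ) × ℝ} (h : q.1 ∈ curveDom) (v : ℝ × ℝ) :
    ContDiffAt ℝ ∞ (fun q : (ℝ × ℝ) × ℝ => fderiv ℝ action q.1 v) q :=
  (((contDiffAt_action h).fderiv_right (m := ∞) (by simp)).comp q contDiffAt_fst).clm_apply
    contDiffAt_const

theorem contDiffAt_angleCoord {q : (ℝ × ℝ) × ℝ} (h : q.1 ∈ curveDom) :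
    ContDiffAt ℝ ∞ angleCoord q :=
  (contDiffAt_hCoef h).div (contDiffAt_fderiv_action h _) (fderiv_action_pos h).ne'

theorem contDiffAt_shift {q : (ℝ × ℝ) × ℝ} (h : q.1 ∈ curveDom) : ContDiffAt ℝ ∞ shift q :=
  (contDiffAt_jCoef h).sub ((contDiffAt_angleCoord h).mul (contDiffAt_fderiv_action h _))

theorem angleCoord_add_two_pi {a : ℝ × ℝ} (h : a ∈ curveDom) (φ : ℝ) :
    angleCoord (a, φ + 2 * Real.pi) = angleCoord (a, φ) + 1 := by
  simp only [angleCoord, hCoef_add_two_pi h]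
  rw [add_div, div_self (fderiv_action_pos h).ne']

theorem shift_add_two_pi {a : ℝ × ℝ} (h : a ∈ curveDom) (φ : ℝ) :
    shift (a, φ + 2 * Real.pi) = shift (a, φ) := by
  simp only [shift, jCoef_add_two_pi h, angleCoord_add_two_pi h]; ring

theorem fderiv_action_fst {q : (ℝ × ℝ) × ℝ} (h : q.1 ∈ curveDom) (v : (ℝ × ℝ) × ℝ) :
    fderiv ℝ (fun q : (ℝ × ℝ) × ℝ => action q.1) q v = fderiv ℝ action q.1 v.1 := by
  have h3 : HasFDerivAt (fun q : (ℝ × ℝ) × ℝ => action q.1) _ q :=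
    HasFDerivAt.comp q (g := action) (f := fun q : (ℝ × ℝ) × ℝ => q.1)
      ((contDiffAt_action h).differentiableAt (by simp)).hasFDerivAt
      (ContinuousLinearMap.fst ℝ (ℝ × ℝ) ℝ).hasFDerivAt
  rw [h3.fderiv]; rfl

theorem strictMono_angleCoord {a : ℝ × ℝ} (h : a ∈ curveDom) :
    StrictMono fun φ => angleCoord (a, φ) := fun _ _ hst =>
  div_lt_div_of_pos_right (strictMono_hCoef h hst) (fderiv_action_pos h)

theorem fderiv_angleCoord_angle {q : (ℝ × ℝ) × ℝ} (h : q.1 ∈ curveDom) :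
    0 < fderiv ℝ angleCoord q (0, 1) := by
  have h1 := fderiv_snd_eq_deriv (a := q.1) (t := q.2)
    ((contDiffAt_angleCoord h).differentiableAt (by simp))
  have h2 := fderiv_snd_eq_deriv (a := q.1) (t := q.2)
    ((contDiffAt_hCoef h).differentiableAt (by simp))
  have h3 := fderiv_hCoef_angle h
  rw [h2] at h3
  rw [h1, show (fun t => angleCoord (q.1, t)) =
    fun t => hCoef (q.1, t) / fderiv ℝ action q.1 (0, 1) from rfl, deriv_div_const]
  exact div_pos h3 (fderiv_action_pos h)

/-- In the coordinates `(j, h, φ)` the form `dx ∧ dy` equals `dA ∧ dT + dj ∧ ds`, where `A` is the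
action, `T` the angle coordinate and `s` the shift. -/
theorem wedge_eq {q : (ℝ × ℝ) × ℝ} (h : q.1 ∈ curveDom) (v w : (ℝ × ℝ) × ℝ) :
    fderiv ℝ xx q v * fderiv ℝ yy q w - fderiv ℝ xx q w * fderiv ℝ yy q v =
      (fderiv ℝ action q.1 v.1 * fderiv ℝ angleCoord q w -
        fderiv ℝ action q.1 w.1 * fderiv ℝ angleCoord q v) +
      (v.1.1 * fderiv ℝ shift q w - w.1.1 * fderiv ℝ shift q v) := by
  have h1 := exact_decomp (σ := sig) (y := yy) (A := fun q : (ℝ × ℝ) × ℝ => action q.1) (x := xx)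
    (T := angleCoord) (s := shift) (ℓ := dj) (contDiffAt_sig h) (contDiffAt_yy h)
    ((contDiffAt_action h).comp q contDiffAt_fst)
    ((contDiffAt_xx h).differentiableAt (by simp))
    ((contDiffAt_angleCoord h).differentiableAt (by simp))
    ((contDiffAt_shift h).differentiableAt (by simp))
    ((eventually_curveDom h).mono fun q' h' => by
      have hA := (fderiv_action_pos h').ne'
      rw [fderiv_sig h']
      refine clm_ext ?_ ?_ ?_ <;>
        simp only [_root_.add_apply, _root_.smul_apply, smul_eq_mul, fderiv_action_fst h',
          dj_apply, dh_apply, shift, angleCoord] <;> (simp; try field_simp))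
    v w
  rw [fderiv_action_fst h, fderiv_action_fst h] at h1
  exact h1

/-! ### The area function as an action integral -/

/-- The area can be computed by integrating over any parametrisation of the right half of a level
curve. -/
theorem area_eq_of_param {j h : ℝ} (hj : |j| < 1) (hh : 0 ≤ h) {n n' u : ℝ → ℝ}
    (hn : ∀ φ, HasDerivAt n (n' φ) φ) (hn' : Continuous n')
    (hmem : ∀ φ ∈ Icc 0 Real.pi, n φ ^ 2 + 2 * |u φ| < 1 ∧ 0 ≤ u φ ∧ ham j (n φ) (u φ) = h ∧
      (n φ < 0 ∨ j ≠ 0))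
    (h0 : u 0 = 0) (h1 : u Real.pi = 0) (hl : n 0 ≤ -1 / 2) (hr : -1 / 2 ≤ n Real.pi) :
    area j (1 + h)⁻¹ =
      bb j * ∫ φ in (0 : ℝ)..Real.pi, Real.arsinh (bb j ^ 2 * u φ / kk j (n φ)) * n' φ := by
  set G : ℝ → ℝ := fun n => Real.arsinh (bb j ^ 2 * extent j (1 + h)⁻¹ n / kk j n) with hG
  have ht : 0 ≤ (1 + h)⁻¹ := (inv_mem_Icc hh).1
  have hpi : (0 : ℝ) ≤ Real.pi := Real.pi_pos.le
  have hlev : ∀ φ ∈ Icc 0 Real.pi, level j (n φ) (u φ) = (1 + h)⁻¹ := fun φ hφ => by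
    rw [level_of_mem (hmem φ hφ).1, (hmem φ hφ).2.2.1]
  have hext : ∀ φ ∈ Icc 0 Real.pi, extent j (1 + h)⁻¹ (n φ) = u φ := fun φ hφ => by
    obtain ⟨e1, e2, -⟩ := hmem φ hφ
    rw [abs_of_nonneg e2] at e1
    rw [← hlev φ hφ, extent_eq hj e2 e1.le]
  have hm0 := hmem 0 ⟨le_rfl, hpi⟩
  have hm1 := hmem Real.pi ⟨hpi, le_rfl⟩
  have ha0 := abs_lt.1 (abs_lt_one_of_mem hm0.1)
  have ha1 := abs_lt.1 (abs_lt_one_of_mem hm1.1)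
  -- outside the interval between the end points of the curve the slices are empty
  have hout : ∀ m : ℝ, -1 < m → m < 1 → h ≤ ham j m 0 → G m = 0 := by
    intro m h1 h2 hm
    have e1 : extent j (1 + h)⁻¹ m ≤ 0 := by
      rw [extent_le_iff hj ht le_rfl, level_of_mem (axis_mem (abs_lt.2 ⟨h1, h2⟩))]
      exact inv_anti₀ (by linarith) (by linarith)
    have e2 : extent j (1 + h)⁻¹ m = 0 := le_antisymm e1 (extent_nonneg _ _ _)
    simp [hG, e2]
  have hint := intervalIntegrable_slice hj ht
  have hsub : ∀ {a b : ℝ}, -1 ≤ a → a ≤ b → b ≤ 1 → IntervalIntegrable G volume a b := by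
    intro a b h1 h2 h3
    refine hint.mono_set ?_
    rw [uIcc_of_le h2, uIcc_of_le (by norm_num)]
    exact Icc_subset_Icc h1 h3
  have i1 : ∫ m in (-1 : ℝ)..n 0, G m = 0 := by
    refine intervalIntegral.integral_zero_ae (Eventually.of_forall fun m hm => ?_)
    rw [uIoc_of_le ha0.1.le] at hm
    refine hout m hm.1 (by linarith [hm.2]) ?_
    rw [← hm0.2.2.1, h0]
    exact axis_antitone hj hm.1 hm.2 hl
  have i2 : ∫ m in n Real.pi..1, G m = 0 := by
    refine intervalIntegral.integral_zero_ae ?_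
    filter_upwards [Measure.ae_ne volume (1 : ℝ)] with m hm1' hm
    rw [uIoc_of_le ha1.2.le] at hm
    have hlt : m < 1 := lt_of_le_of_ne hm.2 hm1'
    refine hout m (by linarith [hm.1]) hlt ?_
    rw [← hm1.2.2.1, h1]
    exact axis_monotone hj hr hm.1.le hlt
  have hsplit : ∫ m in (-1 : ℝ)..1, G m = ∫ m in n 0..n Real.pi, G m := by
    rw [← intervalIntegral.integral_add_adjacent_intervals (b := n 0)
      (hsub le_rfl ha0.1.le ha0.2.le) (hsub ha0.1.le ha0.2.le le_rfl), i1, zero_add,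
      ← intervalIntegral.integral_add_adjacent_intervals (b := n Real.pi)
      (hsub ha0.1.le (hl.trans hr) ha1.2.le) (hsub ha1.1.le ha1.2.le le_rfl), i2, add_zero]
  have hcont : ContinuousOn G (n '' uIcc 0 Real.pi) := by
    rintro _ ⟨φ, hφ, rfl⟩
    rw [uIcc_of_le hpi] at hφ
    have hk := kk_pos hj (ne_of_slit (hmem φ hφ).2.2.2)
    refine (Real.continuous_arsinh.continuousAt.comp ?_).continuousWithinAt
    exact ((continuous_extent hj ht).continuousAt.const_mul _).div (continuous_kk j).continuousAt
      hk.ne'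
  have hsubst := intervalIntegral.integral_comp_mul_deriv' (a := 0) (b := Real.pi) (g := G)
    (fun φ _ => hn φ) hn'.continuousOn hcont
  unfold area
  rw [show (∫ n in (-1 : ℝ)..1, Real.arsinh (bb j ^ 2 * extent j (1 + h)⁻¹ n / kk j n)) =
    ∫ m in (-1 : ℝ)..1, G m from rfl, hsplit, ← hsubst]
  congr 1
  refine intervalIntegral.integral_congr fun φ hφ => ?_
  rw [uIcc_of_le hpi] at hφ
  simp only [Function.comp, hG, hext φ hφ]

theorem hasDerivAt_cn {a : ℝ × ℝ} (h : a ∈ curveDom) (φ : ℝ) :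
    HasDerivAt (fun φ => cn (a, φ)) (fderiv ℝ cn (a, φ) (0, 1)) φ := by
  have h1 : HasDerivAt (fun t : ℝ => (a, t)) ((0 : ℝ × ℝ), (1 : ℝ)) φ :=
    (hasDerivAt_const φ a).prodMk (hasDerivAt_id φ)
  exact ((contDiffAt_cn (q := (a, φ)) h).differentiableAt
    (by simp)).hasFDerivAt.comp_hasDerivAt φ h1

theorem hasDerivAt_yy {a : ℝ × ℝ} (h : a ∈ curveDom) (φ : ℝ) :
    HasDerivAt (fun φ => yy (a, φ)) (fderiv ℝ yy (a, φ) (0, 1)) φ := by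
  have h1 : HasDerivAt (fun t : ℝ => (a, t)) ((0 : ℝ × ℝ), (1 : ℝ)) φ :=
    (hasDerivAt_const φ a).prodMk (hasDerivAt_id φ)
  exact ((contDiffAt_yy (q := (a, φ)) h).differentiableAt
    (by simp)).hasFDerivAt.comp_hasDerivAt φ h1

theorem fderiv_yy_angle {a : ℝ × ℝ} (h : a ∈ curveDom) (φ : ℝ) :
    fderiv ℝ yy (a, φ) (0, 1) = bb a.1 * fderiv ℝ cn (a, φ) (0, 1) :=
  (hasDerivAt_yy h φ).unique ((hasDerivAt_cn h φ).const_mul (bb a.1))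

theorem actionForm_neg {a : ℝ × ℝ} (h : a ∈ curveDom) (φ : ℝ) :
    actionForm a (-φ) = actionForm a φ := by
  have h1 : xx (a, -φ) = -xx (a, φ) := by
    simp only [xx, xcoord, cn_neg, cu_neg h, mul_neg, neg_div, Real.arsinh_neg]
  have h2 : fderiv ℝ yy (a, -φ) (0, 1) = -fderiv ℝ yy (a, φ) (0, 1) := by
    have e1 := (hasDerivAt_yy h (-φ)).scomp φ (hasDerivAt_neg φ)
    have e2 : ((fun φ => yy (a, φ)) ∘ fun φ => -φ) = fun φ => yy (a, φ) := by
      funext t; simp only [Function.comp, yy, cn_neg]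
    rw [show ((fun φ => yy (a, φ)) ∘ Neg.neg) = fun φ => yy (a, φ) from e2] at e1
    have e3 := e1.unique (hasDerivAt_yy h φ)
    simp only [neg_smul, one_smul] at e3
    linarith
  simp only [actionForm, h1, h2, neg_mul_neg]

/-- The two halves `u ≥ 0` and `u ≤ 0` of a level curve enclose the same area. -/
theorem action_eq {a : ℝ × ℝ} (h : a ∈ curveDom) :
    action a = 2 * ∫ φ in (0 : ℝ)..Real.pi, actionForm a φ := by
  have hp : Function.Periodic (actionForm a) (2 * Real.pi) := actionForm_add_two_pi a
  have hi : ∀ s t : ℝ, IntervalIntegrable (actionForm a) volume s t := fun s t =>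
    (continuous_actionForm h).intervalIntegrable s t
  have h1 := hp.intervalIntegral_add_eq (-Real.pi) 0
  rw [show -Real.pi + 2 * Real.pi = Real.pi by ring, zero_add] at h1
  have h2 : action a = ∫ φ in (0 : ℝ)..2 * Real.pi, actionForm a φ := rfl
  have h3 : ∫ φ in (-Real.pi)..0, actionForm a φ = ∫ φ in (0 : ℝ)..Real.pi, actionForm a φ := by
    have := intervalIntegral.integral_comp_neg (actionForm a) (a := 0) (b := Real.pi)
    rw [neg_zero] at this
    rw [← this]
    simp only [actionForm_neg h]
  rw [h2, ← h1, ← intervalIntegral.integral_add_adjacent_intervals (hi _ 0) (hi _ _), h3]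
  ring

/-- The symplectic area of a sublevel set of the Hamiltonian is the action integral of the level
curve which bounds it. -/
theorem area_eq_action {a : ℝ × ℝ} (h : a ∈ curveDom) : area a.1 (1 + a.2)⁻¹ = action a := by
  have hl : cn (a, 0) ≤ -1 / 2 := by
    by_contra hc
    obtain ⟨e1, e2⟩ := cn_spec (q := (a, 0)) h
    have e3 := lam_pos e1.1 e1.2.1 (not_le.1 hc)
    have e4 := Real.sqrt_nonneg a.2
    simp only [Real.cos_zero, mul_one] at e2
    linarith
  have hr : -1 / 2 ≤ cn (a, Real.pi) := by
    by_contra hc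
    obtain ⟨e1, e2⟩ := cn_spec (q := (a, Real.pi)) h
    have e3 := lam_neg e1.1 e1.2.1 (not_le.1 hc)
    have e4 := Real.sqrt_nonneg a.2
    simp only [Real.cos_pi, mul_neg, mul_one, neg_neg] at e2
    linarith
  have hcont : Continuous fun φ => fderiv ℝ cn (a, φ) (0, 1) := continuous_iff_continuousAt.2
    fun φ => ContinuousAt.comp (f := fun φ : ℝ => (a, φ)) (g := fun q => fderiv ℝ cn q (0, 1))
      (((((contDiffAt_cn (q := (a, φ)) h).fderiv_right (m := ∞) (by simp)).clm_apply
        contDiffAt_const)).continuousAt) (continuousAt_const.prodMk continuousAt_id)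
  rw [area_eq_of_param h.1 h.2.1.le (hasDerivAt_cn h) hcont (u := fun φ => cu (a, φ)) ?_
    (cu_eq_zero h Real.sin_zero) (cu_eq_zero h Real.sin_pi) hl hr, action_eq h,
    ← intervalIntegral.integral_const_mul, ← intervalIntegral.integral_const_mul]
  · refine intervalIntegral.integral_congr fun φ _ => ?_
    simp only [actionForm, fderiv_yy_angle h, xx, xcoord]
    ring
  · intro φ hφ
    have e1 := cu_spec (q := (a, φ)) h
    exact ⟨e1.1.2.1, cu_nonneg h (Real.sin_nonneg_of_mem_Icc hφ), ham_curve (q := (a, φ)) h,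
      e1.1.2.2⟩

/-- Close to the minimum the Hamiltonian is the model `ξ² + η²`, in Darboux coordinates. -/
theorem ham_model {j ξ η : ℝ} (hj : |j| < 1) (h : ξ ^ 2 + η ^ 2 < bb j ^ 4 / 512) :
    let n := -1 / 2 + η * √(1 + 4 * ξ ^ 2) / bb j
    let u := 2 * ξ * kk j n / bb j ^ 2
    (n ^ 2 < 1 / 3 ∧ n < -3 / 8 ∧ u ^ 2 ≤ 1 / 64) ∧ n ^ 2 + 2 * |u| < 1 ∧
      ham j n u = ξ ^ 2 + η ^ 2 := by
  intro n u
  have hb := bb_pos hj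
  have hb1 := bb_le_one j
  set w := √(1 + 4 * ξ ^ 2) with hw
  have hw2 : w ^ 2 = 1 + 4 * ξ ^ 2 := Real.sq_sqrt (by positivity)
  have hb2 : bb j ^ 2 ≤ 1 := pow_le_one₀ hb.le hb1
  have hξ : 512 * ξ ^ 2 ≤ bb j ^ 4 := by nlinarith [sq_nonneg η]
  have hη : 512 * η ^ 2 < bb j ^ 4 := by nlinarith [sq_nonneg ξ]
  have hb4 : bb j ^ 4 ≤ bb j ^ 2 := by nlinarith [sq_nonneg (bb j)]
  have hm : (η * w / bb j) ^ 2 < 1 / 256 := by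
    rw [div_pow, div_lt_iff₀ (by positivity), mul_pow, hw2]
    have : 4 * ξ ^ 2 ≤ 1 := by nlinarith
    nlinarith [sq_nonneg η]
  have hm' : |η * w / bb j| < 1 / 16 := by
    refine abs_lt_of_sq_lt_sq ?_ (by norm_num); linarith
  obtain ⟨m1, m2⟩ := abs_lt.1 hm'
  have hn1 : -9 / 16 < n := by change -9 / 16 < -1 / 2 + η * w / bb j; linarith
  have hn2 : n < -7 / 16 := by change -1 / 2 + η * w / bb j < -7 / 16; linarith
  have hn3 : n ^ 2 < 1 / 3 := by nlinarith
  have hn0 : n ≠ 0 := by intro h; rw [h] at hn2; norm_num at hn2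
  have hkp := kk_pos hj (Or.inl hn0)
  have hk1 : kk j n ≤ 1 := kk_le_one hj (abs_le.2 ⟨by linarith, by linarith⟩)
  have hu : u ^ 2 ≤ 1 / 128 := by
    change (2 * ξ * kk j n / bb j ^ 2) ^ 2 ≤ 1 / 128
    rw [div_pow, div_le_iff₀ (by positivity)]
    have : kk j n ^ 2 ≤ 1 := pow_le_one₀ hkp.le hk1
    have e : (2 * ξ * kk j n) ^ 2 ≤ 4 * ξ ^ 2 := by nlinarith [sq_nonneg ξ]
    have e' : (bb j ^ 2) ^ 2 = bb j ^ 4 := by ring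
    rw [e']
    linarith
  have hu' : |u| < 1 / 8 := by
    refine abs_lt_of_sq_lt_sq ?_ (by norm_num); linarith
  refine ⟨⟨hn3, by linarith, by linarith⟩, by linarith, ?_⟩
  rw [ham_eq_inner (by linarith), pen_eq_zero hn3.le (by linarith), add_zero]
  have e1 : bb j ^ 2 * u = 2 * ξ * kk j n := by
    change bb j ^ 2 * (2 * ξ * kk j n / bb j ^ 2) = _
    field_simp
  have e2 : zz j n u ^ 2 = kk j n ^ 2 * w ^ 2 := by rw [zz_sq, e1, hw2]; ring
  have e3 : bb j * (n + 1 / 2) = η * w := by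
    change bb j * (-1 / 2 + η * w / bb j + 1 / 2) = _
    field_simp; ring
  have hw0 : w ≠ 0 := by
    intro h0; rw [h0] at hw2; nlinarith [sq_nonneg ξ]
  unfold inner
  rw [e1, e2, ← mul_pow, e3]
  field_simp
  ring

/-- Near the minimum the level curve is a circle of radius `√h` in the Darboux coordinates `ξ`, `η`.
This makes the area smooth at the minimum, where the level curves degenerate. -/
theorem area_eq_pi_mul {j h : ℝ} (hj : |j| < 1) (hh : 0 ≤ h) (h1 : h < bb j ^ 4 / 512) :
    area j (1 + h)⁻¹ = Real.pi * h := by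
  have hb := bb_pos hj
  set r := √h with hr
  have hr2 : r ^ 2 = h := Real.sq_sqrt hh
  have hr0 : 0 ≤ r := Real.sqrt_nonneg _
  set ξ : ℝ → ℝ := fun φ => r * Real.sin φ with hξ
  set η : ℝ → ℝ := fun φ => -(r * Real.cos φ) with hη
  set w : ℝ → ℝ := fun φ => √(1 + 4 * ξ φ ^ 2) with hw
  set n : ℝ → ℝ := fun φ => -1 / 2 + η φ * w φ / bb j with hn
  have dξ : ∀ φ, HasDerivAt ξ (-η φ) φ := fun φ => by
    simpa [hη] using (Real.hasDerivAt_sin φ).const_mul r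
  have dη : ∀ φ, HasDerivAt η (ξ φ) φ := fun φ => by
    exact ((Real.hasDerivAt_cos φ).const_mul r).neg.congr_deriv (by simp [hξ])
  have hw2 : ∀ φ, w φ ^ 2 = 1 + 4 * ξ φ ^ 2 := fun φ => Real.sq_sqrt (by positivity)
  have hw0 : ∀ φ, 0 < w φ := fun φ => Real.sqrt_pos.2 (by positivity)
  have dw : ∀ φ, HasDerivAt w (-(4 * ξ φ * η φ) / w φ) φ := fun φ => by
    have := ((((dξ φ).pow 2).const_mul 4).const_add 1).sqrt
      (show 1 + 4 * ξ φ ^ 2 ≠ 0 by positivity)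
    refine HasDerivAt.congr_deriv (f := w) this ?_
    have e : √(1 + 4 * (ξ ^ 2) φ) = w φ := rfl
    rw [e]
    have := (hw0 φ).ne'
    field_simp
    push_cast
    ring
  set n' : ℝ → ℝ := fun φ => (ξ φ * w φ + η φ * (-(4 * ξ φ * η φ) / w φ)) / bb j with hn'
  have dn : ∀ φ, HasDerivAt n (n' φ) φ := fun φ =>
    (((dη φ).mul (dw φ)).div_const _).const_add _
  have cξ : Continuous ξ := by fun_prop
  have cη : Continuous η := by fun_prop
  have cw : Continuous w := by fun_prop
  have cn' : Continuous n' := by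
    refine Continuous.div_const ?_ _
    exact (cξ.mul cw).add (cη.mul (Continuous.div (by fun_prop) cw fun φ => (hw0 φ).ne'))
  have hsum : ∀ φ, ξ φ ^ 2 + η φ ^ 2 = h := fun φ => by
    simp only [hξ, hη]
    have := Real.sin_sq_add_cos_sq φ
    linear_combination r ^ 2 * this + hr2
  have hmod : ∀ φ, _ := fun φ => ham_model (ξ := ξ φ) (η := η φ) hj (by rw [hsum]; exact h1)
  rw [area_eq_of_param hj hh dn cn' (u := fun φ => 2 * ξ φ * kk j (n φ) / bb j ^ 2) ?_
    (by simp [hξ]) (by simp [hξ]) ?_ ?_]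
  · have hk : ∀ φ, 0 < kk j (n φ) := fun φ => kk_pos hj (Or.inl (by
      have := (hmod φ).1.2.1
      change n φ < _ at this
      intro h0; rw [h0] at this; norm_num at this))
    have e1 : ∀ φ, bb j * (Real.arsinh (bb j ^ 2 * (2 * ξ φ * kk j (n φ) / bb j ^ 2) / kk j (n φ)) *
        n' φ) = Real.arsinh (2 * ξ φ) * (ξ φ * w φ + η φ * (-(4 * ξ φ * η φ) / w φ)) := fun φ => by
      have := (hk φ).ne'
      rw [show bb j ^ 2 * (2 * ξ φ * kk j (n φ) / bb j ^ 2) / kk j (n φ) = 2 * ξ φ by field_simp]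
      simp only [hn']
      field_simp
    rw [← intervalIntegral.integral_const_mul]
    simp only [e1]
    -- the form `x dy` differs from `ξ dη` by an exact form
    rw [intervalIntegral.integral_eq_sub_of_hasDerivAt
      (f := fun φ => Real.arsinh (2 * ξ φ) * (η φ * w φ) + h * (φ + Real.sin φ * Real.cos φ))]
    · simp [hξ]; ring
    · intro φ _
      have d1 := ((dξ φ).const_mul 2).arsinh.mul ((dη φ).mul (dw φ))
      have d2 := ((hasDerivAt_id φ).add ((Real.hasDerivAt_sin φ).mul
        (Real.hasDerivAt_cos φ))).const_mul h
      refine (d1.add d2).congr_deriv ?_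
      have e2 : √(1 + (2 * ξ φ) ^ 2) = w φ := by simp only [hw]; congr 1; ring
      rw [e2]
      have := (hw0 φ).ne'
      have e3 : η φ ^ 2 = h * Real.cos φ ^ 2 := by simp only [hη]; rw [← hr2]; ring
      have e4 := Real.sin_sq_add_cos_sq φ
      simp only [smul_eq_mul, Pi.mul_apply]
      field_simp
      linear_combination (-2 * w φ) * e3 - (h * w φ) * e4
    · refine Continuous.intervalIntegrable ?_ _ _
      refine (Real.continuous_arsinh.comp (cξ.const_mul 2)).mul ?_
      exact (cξ.mul cw).add (cη.mul (Continuous.div (by fun_prop) cw fun φ => (hw0 φ).ne'))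
  · intro φ hφ
    obtain ⟨⟨e1, e2, e3⟩, e4, e5⟩ := hmod φ
    refine ⟨e4, ?_, by rw [← hsum φ]; exact e5, Or.inl (lt_trans e2 (by norm_num))⟩
    have := Real.sin_nonneg_of_mem_Icc hφ
    have := kk_nonneg j (n φ)
    simp only [hξ]
    positivity
  · have : 0 ≤ w 0 := (hw0 0).le
    have e : η 0 * w 0 / bb j ≤ 0 := by
      refine div_nonpos_of_nonpos_of_nonneg ?_ hb.le
      simp only [hη, Real.cos_zero]; nlinarith
    simp only [hn]; linarith
  · have : 0 ≤ w Real.pi := (hw0 _).le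
    have e : 0 ≤ η Real.pi * w Real.pi / bb j := by
      refine div_nonneg ?_ hb.le
      simp only [hη, Real.cos_pi]; nlinarith
    simp only [hn]; linarith

/-! ### The fibration and its fibres -/

/-- A compact set is connected if it is mapped onto a connected set with connected fibres. -/
theorem isConnected_of_fibres {X Y : Type*} [TopologicalSpace X] [T2Space X] [TopologicalSpace Y]
    [T2Space Y] {K : Set X} (hK : IsCompact K) {f : X → Y} (hf : ContinuousOn f K)
    (hc : IsConnected (f '' K)) (hfib : ∀ x ∈ K, IsPreconnected (K ∩ f ⁻¹' {f x})) :
    IsConnected K := by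
  refine ⟨hc.nonempty.of_image, isPreconnected_closed_iff.2 fun t t' ht ht' hsub hn hn' => ?_⟩
  have hcl : ∀ {t : Set X}, IsClosed t → IsClosed (f '' (K ∩ t)) := fun ht =>
    ((hK.inter_right ht).image_of_continuousOn (hf.mono inter_subset_left)).isClosed
  obtain ⟨y, -, ⟨x, ⟨hx, hxt⟩, rfl⟩, x', ⟨hx', hxt'⟩, hxx⟩ := isPreconnected_closed_iff.1
    hc.isPreconnected _ _ (hcl ht) (hcl ht') (by
      rintro _ ⟨x, hx, rfl⟩
      exact (hsub hx).imp (fun h => ⟨x, ⟨hx, h⟩, rfl⟩) fun h => ⟨x, ⟨hx, h⟩, rfl⟩)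
    (by obtain ⟨x, hx, h⟩ := hn; exact ⟨f x, ⟨x, hx, rfl⟩, x, ⟨hx, h⟩, rfl⟩)
    (by obtain ⟨x, hx, h⟩ := hn'; exact ⟨f x, ⟨x, hx, rfl⟩, x, ⟨hx, h⟩, rfl⟩)
  obtain ⟨w, hw, h⟩ := isPreconnected_closed_iff.1 (hfib x hx) _ _ ht ht'
    (fun w hw => hsub hw.1) ⟨x, ⟨hx, rfl⟩, hxt⟩ ⟨x', ⟨hx', hxx⟩, hxt'⟩
  exact ⟨w, hw.1, h⟩

/-- The simultaneous rotation of `p` and `q` by the angle `θ`. -/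
def rot (θ : ℝ) (z : Phase) : Phase :=
  mkPhase (Real.cos θ * z.1 0 - Real.sin θ * z.1 1) (Real.sin θ * z.1 0 + Real.cos θ * z.1 1)
    (Real.cos θ * z.2 0 - Real.sin θ * z.2 1) (Real.sin θ * z.2 0 + Real.cos θ * z.2 1)

theorem dot_rot (θ : ℝ) (z : Phase) : dot (rot θ z) = dot z := by
  have := Real.sin_sq_add_cos_sq θ
  simp only [dot, rot, mkPhase_p0, mkPhase_p1, mkPhase_q0, mkPhase_q1]
  linear_combination (z.1 0 * z.2 0 + z.1 1 * z.2 1) * this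

theorem ang_rot (θ : ℝ) (z : Phase) : ang (rot θ z) = ang z := by
  have := Real.sin_sq_add_cos_sq θ
  simp only [ang, rot, mkPhase_p0, mkPhase_p1, mkPhase_q0, mkPhase_q1]
  linear_combination (z.1 0 * z.2 1 - z.1 1 * z.2 0) * this

theorem sqP_rot (θ : ℝ) (z : Phase) : sqP (rot θ z) = sqP z := by
  have := Real.sin_sq_add_cos_sq θ
  simp only [sqP, rot, mkPhase_p0, mkPhase_p1]
  linear_combination (z.1 0 ^ 2 + z.1 1 ^ 2) * this

theorem sqQ_rot (θ : ℝ) (z : Phase) : sqQ (rot θ z) = sqQ z := by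
  have := Real.sin_sq_add_cos_sq θ
  simp only [sqQ, rot, mkPhase_q0, mkPhase_q1]
  linear_combination (z.2 0 ^ 2 + z.2 1 ^ 2) * this

theorem continuous_rot (z : Phase) : Continuous fun θ => rot θ z :=
  (contDiff_iff_contDiffAt.2 fun θ => contDiffWithinAt_mkPhase (n := ∞) (s := univ)
    (by fun_prop) (by fun_prop) (by fun_prop) (by fun_prop)).continuous

/-- Two planar vectors of the same length differ by a rotation. -/
theorem exists_rotation {a b c d : ℝ} (h : a ^ 2 + b ^ 2 = c ^ 2 + d ^ 2) :
    ∃ θ, Real.cos θ * a - Real.sin θ * b = c ∧ Real.sin θ * a + Real.cos θ * b = d := by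
  by_cases h0 : a ^ 2 + b ^ 2 = 0
  · have h1 : c ^ 2 + d ^ 2 = 0 := by rw [← h, h0]
    have ha : a = 0 := by nlinarith [sq_nonneg a, sq_nonneg b]
    have hb : b = 0 := by nlinarith [sq_nonneg a, sq_nonneg b]
    have hc : c = 0 := by nlinarith [sq_nonneg c, sq_nonneg d]
    have hd : d = 0 := by nlinarith [sq_nonneg c, sq_nonneg d]
    exact ⟨0, by simp [ha, hb, hc], by simp [ha, hb, hd]⟩
  · obtain ⟨θ, h1, h2⟩ := exists_cos_sin (c := (a * c + b * d) / (a ^ 2 + b ^ 2))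
      (s := (a * d - b * c) / (a ^ 2 + b ^ 2)) (by
        rw [div_pow, div_pow, ← add_div, div_eq_one_iff_eq (by positivity)]
        linear_combination (-(a ^ 2 + b ^ 2)) * h)
    refine ⟨θ, ?_, ?_⟩ <;> rw [h1, h2] <;> field_simp <;> ring

theorem exists_rot_eq {z w : Phase} (hd : dot z = dot w) (ha : ang z = ang w)
    (hp : sqP z = sqP w) (hq : sqQ z = sqQ w) : ∃ θ, rot θ z = w := by
  by_cases h0 : sqP w = 0
  · obtain ⟨θ, h1, h2⟩ := exists_rotation hq
    have hz : sqP (rot θ z) = 0 := by rw [sqP_rot, hp, h0]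
    unfold sqP at h0 hz
    have key : ∀ {a b : ℝ}, a ^ 2 + b ^ 2 = 0 → a = 0 ∧ b = 0 := fun {a b} h =>
      ⟨pow_eq_zero_iff two_ne_zero |>.1 (by linarith [sq_nonneg a, sq_nonneg b]),
        pow_eq_zero_iff two_ne_zero |>.1 (by linarith [sq_nonneg a, sq_nonneg b])⟩
    exact ⟨θ, phase_ext ((key hz).1.trans (key h0).1.symm) ((key hz).2.trans (key h0).2.symm)
      h1 h2⟩
  · obtain ⟨θ, h1, h2⟩ := exists_rotation hp
    refine ⟨θ, eq_of_fst_eq h1 h2 ?_ ?_ ?_⟩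
    · rwa [sqP_rot, hp]
    · rw [dot_rot, hd]
    · rw [ang_rot, ha]

/-- The normalised inner product `p · q / √(1 - j²)`. -/
def nn (z : Phase) : ℝ := dot z / bb (ang z)

/-- The normalised difference `(|p|² - |q|²) / (2 (1 - j²))`. -/
def uu (z : Phase) : ℝ := (sqP z - sqQ z) / 2 / bb (ang z) ^ 2

/-- The fibration: the angular momentum and the Hamiltonian. -/
def fib (z : Phase) : ℝ × ℝ := (ang z, ham (ang z) (nn z) (uu z))

/-- The compactified Hamiltonian, which vanishes on the boundary of the bidisk. -/
def lev (z : Phase) : ℝ := level (ang z) (nn z) (uu z)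

/-- The map to the base diagram: the moment map and the area of the level curve. -/
def act (z : Phase) : ℝ × ℝ := (2 * Real.pi * ang z, area (ang z) (lev z))

theorem abs_ang_le {z : Phase} (hz : z ∈ bidisk) : |ang z| ≤ 1 := by
  rw [mem_bidisk_iff] at hz
  rw [← sq_le_one_iff_abs_le_one]
  have := ang_sq_add_dot_sq z
  nlinarith [sq_nonneg (dot z), sqP_nonneg z, sqQ_nonneg z]

theorem abs_ang_lt {z : Phase} (hz : z ∈ openBidisk) : |ang z| < 1 := by
  rw [mem_openBidisk_iff] at hz
  rw [← sq_lt_one_iff_abs_lt_one]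
  have := ang_sq_add_dot_sq z
  nlinarith [sq_nonneg (dot z), sqP_nonneg z, sqQ_nonneg z]

theorem openBidisk_subset : openBidisk ⊆ bidisk := fun _ hz => ⟨hz.1.le, hz.2.le⟩

theorem bb_mul_nn {z : Phase} (h : |ang z| < 1) : bb (ang z) * nn z = dot z :=
  mul_div_cancel₀ _ (bb_pos h).ne'

theorem bb_mul_uu {z : Phase} (h : |ang z| < 1) :
    bb (ang z) ^ 2 * uu z = (sqP z - sqQ z) / 2 :=
  mul_div_cancel₀ _ (pow_pos (bb_pos h) 2).ne'

theorem reduced_eq {z : Phase} (h : |ang z| < 1) :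
    bb (ang z) ^ 2 * (1 - (nn z ^ 2 + 2 * |uu z|)) = 1 - sqP z * sqQ z - |sqP z - sqQ z| := by
  have h1 := bb_mul_nn h
  have h2 := bb_mul_uu h
  have h3 := bb_sq h
  have h4 := ang_sq_add_dot_sq z
  have h5 : |sqP z - sqQ z| = 2 * (bb (ang z) ^ 2 * |uu z|) := by
    rw [← abs_of_nonneg (sq_nonneg (bb (ang z))), ← abs_mul, h2, abs_div, abs_two]
    ring
  rw [h5, ← h4, ← h1]
  linear_combination h3

/-- In the normalised coordinates every reduced space of the open bidisk is the same disk `n² + 2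
|u| < 1`. -/
theorem mem_reduced_iff {z : Phase} (h : |ang z| < 1) :
    nn z ^ 2 + 2 * |uu z| < 1 ↔ z ∈ openBidisk := by
  have hb := pow_pos (bb_pos h) 2
  have h1 := reduced_eq h
  have hP := sqP_nonneg z
  have hQ := sqQ_nonneg z
  have h2 : nn z ^ 2 + 2 * |uu z| < 1 ↔ |sqP z - sqQ z| < 1 - sqP z * sqQ z := by
    rw [← sub_pos, ← mul_pos_iff_of_pos_left hb, h1]
    exact sub_pos
  rw [h2, mem_openBidisk_iff, abs_lt]
  constructor
  · rintro ⟨h3, h4⟩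
    constructor <;> by_contra hc <;> nlinarith
  · rintro ⟨h3, h4⟩
    constructor <;> nlinarith

theorem mem_reduced_closed_iff {z : Phase} (h : |ang z| < 1) :
    nn z ^ 2 + 2 * |uu z| ≤ 1 ↔ z ∈ bidisk := by
  have hb := pow_pos (bb_pos h) 2
  have h1 := reduced_eq h
  have hP := sqP_nonneg z
  have hQ := sqQ_nonneg z
  have h2 : nn z ^ 2 + 2 * |uu z| ≤ 1 ↔ |sqP z - sqQ z| ≤ 1 - sqP z * sqQ z := by
    rw [← sub_nonneg, ← mul_nonneg_iff_of_pos_left hb, h1]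
    exact sub_nonneg
  rw [h2, mem_bidisk_iff, abs_le]
  constructor
  · rintro ⟨h3, h4⟩
    constructor <;> by_contra hc <;> nlinarith
  · rintro ⟨h3, h4⟩
    constructor <;> nlinarith

/-- Every point of a reduced space comes from a point of phase space. -/
theorem exists_phase (j c x : ℝ) : ∃ z, ang z = j ∧ dot z = c ∧ (sqP z - sqQ z) / 2 = x := by
  -- `|p|² = r + x` and `|q|² = r - x`, and `p` can be put on the first axis
  set r := √(x ^ 2 + c ^ 2 + j ^ 2) with hr
  have hr2 : r ^ 2 = x ^ 2 + c ^ 2 + j ^ 2 := Real.sq_sqrt (by positivity)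
  have hrx : |x| ≤ r := Real.abs_le_sqrt (by nlinarith [sq_nonneg c, sq_nonneg j])
  have hA : 0 ≤ r + x := by linarith [neg_abs_le x]
  have hB : 0 ≤ r - x := by linarith [le_abs_self x]
  have hA2 := Real.sq_sqrt hA
  rcases hA.eq_or_lt with h0 | h0
  · have hc : c = 0 := by nlinarith [sq_nonneg c, sq_nonneg j]
    have hj : j = 0 := by nlinarith [sq_nonneg c, sq_nonneg j]
    refine ⟨mkPhase 0 0 (√(r - x)) 0, ?_, ?_, ?_⟩
    · simp [ang, hj]
    · simp [dot, hc]
    · simp only [sqP, sqQ, mkPhase_p0, mkPhase_p1, mkPhase_q0, mkPhase_q1, Real.sq_sqrt hB]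
      linarith
  · have hs : 0 < √(r + x) := Real.sqrt_pos.2 h0
    refine ⟨mkPhase (√(r + x)) 0 (c / √(r + x)) (j / √(r + x)), ?_, ?_, ?_⟩
    · simp only [ang, mkPhase_p0, mkPhase_p1, mkPhase_q0, mkPhase_q1]; field_simp; ring
    · simp only [dot, mkPhase_p0, mkPhase_p1, mkPhase_q0, mkPhase_q1]; field_simp; ring
    · simp only [sqP, sqQ, mkPhase_p0, mkPhase_p1, mkPhase_q0, mkPhase_q1, div_pow, hA2]
      field_simp
      linear_combination hr2

theorem exists_phase_reduced {j : ℝ} (hj : |j| < 1) (n u : ℝ) :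
    ∃ z, ang z = j ∧ nn z = n ∧ uu z = u := by
  obtain ⟨z, h1, h2, h3⟩ := exists_phase j (bb j * n) (bb j ^ 2 * u)
  have hb := bb_pos hj
  refine ⟨z, h1, ?_, ?_⟩
  · rw [nn, h1, h2]; field_simp
  · rw [uu, h1, h3]; field_simp

theorem contDiffAt_nn {z : Phase} (h : |ang z| < 1) : ContDiffAt ℝ ∞ nn z :=
  contDiff_dot.contDiffAt.div (contDiffAt_bb contDiff_ang.contDiffAt h) (bb_pos h).ne'

theorem contDiffAt_uu {z : Phase} (h : |ang z| < 1) : ContDiffAt ℝ ∞ uu z :=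
  ((contDiff_sqP.sub contDiff_sqQ).contDiffAt.div_const 2).div
    ((contDiffAt_bb contDiff_ang.contDiffAt h).pow 2) (pow_pos (bb_pos h) 2).ne'

theorem continuousAt_lev {z : Phase} (h : |ang z| < 1) : ContinuousAt lev z :=
  continuousAt_level_comp contDiff_ang.continuous.continuousAt (contDiffAt_nn h).continuousAt
    (contDiffAt_uu h).continuousAt h

theorem lev_mem (z : Phase) : lev z ∈ Icc (0 : ℝ) 1 := ⟨level_nonneg _ _ _, level_le_one _ _ _⟩

theorem lev_pos_iff {z : Phase} (h : |ang z| < 1) : 0 < lev z ↔ z ∈ openBidisk :=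
  level_pos_iff.trans (mem_reduced_iff h)

theorem lev_eq {z : Phase} (h : z ∈ openBidisk) : lev z = (1 + (fib z).2)⁻¹ :=
  level_of_mem ((mem_reduced_iff (abs_ang_lt h)).2 h) _

theorem fib_nonneg {z : Phase} (h : z ∈ openBidisk) : 0 ≤ (fib z).2 :=
  ham_nonneg ((mem_reduced_iff (abs_ang_lt h)).2 h)

theorem continuousOn_act : ContinuousOn act bidisk := by
  intro z hz
  refine ContinuousWithinAt.prodMk
    (contDiff_ang.continuous.const_mul _).continuousWithinAt ?_
  rcases (abs_ang_le hz).lt_or_eq with h | h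
  · have h1 : ∀ᶠ w in 𝓝 z, |ang w| < 1 :=
      contDiff_ang.continuous.abs.continuousAt.eventually (isOpen_Iio.mem_nhds h)
    have h2 : Tendsto (fun w => (ang w, lev w)) (𝓝 z)
        (𝓝[{q : ℝ × ℝ | |q.1| < 1 ∧ 0 ≤ q.2}] (ang z, lev z)) :=
      tendsto_nhdsWithin_iff.2 ⟨contDiff_ang.continuous.continuousAt.prodMk (continuousAt_lev h),
        h1.mono fun w hw => ⟨hw, (lev_mem w).1⟩⟩
    exact ((continuousOn_area_aux (ang z, lev z) ⟨h, (lev_mem z).1⟩).tendsto.comp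
      h2).mono_left nhdsWithin_le_nhds
  · obtain ⟨c, hc, hle⟩ := exists_area_le
    have h0 : area (ang z) (lev z) = 0 := area_of_abs_eq_one h _
    have hb : bb (ang z) * c = 0 := by
      rw [bb, ← sq_abs, h]; simp
    have h1 : ContinuousWithinAt (fun w => bb (ang w) * c) bidisk z := by
      have : Continuous bb := by unfold bb; fun_prop
      exact ((this.comp contDiff_ang.continuous).mul_const c).continuousWithinAt
    unfold ContinuousWithinAt at h1 ⊢
    beta_reduce at h1 ⊢
    rw [hb] at h1
    rw [h0]
    refine tendsto_of_tendsto_of_tendsto_of_le_of_le' tendsto_const_nhds h1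
      (Eventually.of_forall fun w => area_nonneg _ _) ?_
    filter_upwards [self_mem_nhdsWithin] with w hw
    exact hle _ _ (abs_ang_le hw) (lev_mem w).1

theorem continuousOn_area {j : ℝ} (hj : |j| < 1) : ContinuousOn (fun t => area j t) (Icc 0 1) :=
  ContinuousOn.comp (g := fun q : ℝ × ℝ => area q.1 q.2) (f := fun t : ℝ => (j, t))
    continuousOn_area_aux (by fun_prop) fun t ht => ⟨hj, ht.1⟩

theorem exists_area_eq {j a : ℝ} (hj : |j| < 1) (h0 : 0 ≤ a) (h1 : a ≤ area j 0) :
    ∃ t ∈ Icc (0 : ℝ) 1, area j t = a :=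
  intermediate_value_Icc' zero_le_one (continuousOn_area hj) ⟨by rwa [area_one], h1⟩

theorem area_strictAntiOn {j : ℝ} (hj : |j| < 1) :
    StrictAntiOn (fun t => area j t) (Icc 0 1) := fun _ hs _ ht hst =>
  area_strictAnti hj hs.1 hst ht.2

theorem mem_region_iff {m a : ℝ} : (m, a) ∈ region ↔
    |m / (2 * Real.pi)| ≤ 1 ∧ 0 ≤ a ∧ a ≤ area (m / (2 * Real.pi)) 0 := by
  have hpi : 0 < 2 * Real.pi := by positivity
  have h1 : |m / (2 * Real.pi)| ≤ 1 ↔ |m| ≤ 2 * Real.pi := by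
    rw [abs_div, abs_of_pos hpi, div_le_one hpi]
  have h2 : |m / (2 * Real.pi)| ≤ 1 → area (m / (2 * Real.pi)) 0 = height m := fun h => by
    rw [area_zero h, mul_div_cancel₀ _ hpi.ne']
  constructor
  · rintro ⟨h3, h4, h5⟩
    exact ⟨h1.2 h3, h4, by rw [h2 (h1.2 h3)]; exact h5⟩
  · rintro ⟨h3, h4, h5⟩
    exact ⟨h1.1 h3, h4, by rw [h2 h3] at h5; exact h5⟩

theorem area_zero_of_abs_eq_one {j a : ℝ} (hj : |j| = 1) (h0 : 0 ≤ a) (h1 : a ≤ area j 0) :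
    a = 0 := by
  rw [area_of_abs_eq_one hj] at h1
  exact le_antisymm h1 h0

theorem exists_bidisk_of_abs_eq_one {j : ℝ} (hj : |j| = 1) : ∃ z ∈ bidisk, ang z = j := by
  have : j ^ 2 = 1 := by rw [← sq_abs, hj]; norm_num
  refine ⟨mkPhase 1 0 0 j, mem_bidisk_iff.2 ?_, by simp [ang]⟩
  simp [sqP, sqQ, this]

theorem exists_bidisk_of_level {j t : ℝ} (hj : |j| < 1) (ht : t ∈ Icc (0 : ℝ) 1) :
    ∃ z ∈ bidisk, ang z = j ∧ lev z = t := by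
  obtain ⟨n, hn, hnl⟩ := (exists_axis_level hj ht).1
  obtain ⟨z, h1, h2, h3⟩ := exists_phase_reduced hj n 0
  refine ⟨z, (mem_reduced_closed_iff (by rwa [h1])).1 ?_, h1, ?_⟩
  · rw [h2, h3]
    have := hn.1
    have := hn.2
    simp only [abs_zero]
    nlinarith
  · rw [lev, h1, h2, h3, hnl]

theorem act_image : act '' bidisk = region := by
  ext ⟨m, a⟩
  have hpi : 0 < 2 * Real.pi := by positivity
  rw [mem_region_iff]
  constructor
  · rintro ⟨z, hz, h⟩
    obtain ⟨rfl, rfl⟩ := Prod.ext_iff.1 h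
    simp only [act]
    rw [mul_div_cancel_left₀ _ hpi.ne']
    refine ⟨abs_ang_le hz, area_nonneg _ _, ?_⟩
    rcases (abs_ang_le hz).lt_or_eq with h | h
    · exact (area_strictAntiOn h).antitoneOn ⟨le_rfl, zero_le_one⟩ (lev_mem z) (lev_mem z).1
    · rw [area_of_abs_eq_one h, area_of_abs_eq_one h]
  · rintro ⟨h1, h2, h3⟩
    rcases h1.lt_or_eq with h | h
    · obtain ⟨t, ht, hta⟩ := exists_area_eq h h2 h3
      obtain ⟨z, hz, hj, hl⟩ := exists_bidisk_of_level h ht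
      refine ⟨z, hz, Prod.ext ?_ ?_⟩
      · simp only [act, hj]; field_simp
      · simp only [act, hj, hl, hta]
    · obtain ⟨z, hz, hj⟩ := exists_bidisk_of_abs_eq_one h
      refine ⟨z, hz, Prod.ext ?_ ?_⟩
      · simp only [act, hj]; field_simp
      · simp only [act, hj]
        rw [area_zero_of_abs_eq_one h h2 h3, area_of_abs_eq_one h]

theorem act_top_iff {z : Phase} (hz : z ∈ bidisk) :
    (act z).2 = height (act z).1 ↔ z ∉ openBidisk := by
  simp only [act]
  rw [← area_zero (abs_ang_le hz)]
  rcases (abs_ang_le hz).lt_or_eq with h | h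
  · rw [(area_strictAntiOn h).injOn.eq_iff (lev_mem z) ⟨le_rfl, zero_le_one⟩, ← lev_pos_iff h,
      not_lt]
    exact ⟨fun h => h.le, fun h => le_antisymm h (lev_mem z).1⟩
  · rw [area_of_abs_eq_one h, area_of_abs_eq_one h]
    refine ⟨fun _ ho => ?_, fun _ => rfl⟩
    exact (abs_ang_lt ho).ne h

/-- The interval of values of `n` above which a level curve lies. -/
def axisSet (j t : ℝ) : Set ℝ := {n | n ∈ Icc (-1 : ℝ) 1 ∧ t ≤ level j n 0}

theorem axis_level_mono {j : ℝ} (hj : |j| < 1) {a b : ℝ} (ha : -1 / 2 ≤ a) (hab : a ≤ b) :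
    level j b 0 ≤ level j a 0 := by
  by_cases hb : b < 1
  · have h1 := axis_monotone hj ha hab hb
    have h2 := axis_mem (n := a) (abs_lt.2 ⟨by linarith, by linarith⟩)
    rw [level_of_mem (axis_mem (n := b) (abs_lt.2 ⟨by linarith, hb⟩)), level_of_mem h2]
    have := ham_nonneg (j := j) h2
    exact inv_anti₀ (by linarith) (by linarith)
  · rw [level_of_not_mem (n := b) (by simp only [abs_zero]; nlinarith)]
    exact level_nonneg _ _ _

theorem axis_level_anti {j : ℝ} (hj : |j| < 1) {a b : ℝ} (hab : a ≤ b) (hb : b ≤ -1 / 2) :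
    level j a 0 ≤ level j b 0 := by
  by_cases ha : -1 < a
  · have h1 := axis_antitone hj ha hab hb
    have h2 := axis_mem (n := b) (abs_lt.2 ⟨by linarith, by linarith⟩)
    rw [level_of_mem (axis_mem (n := a) (abs_lt.2 ⟨ha, by linarith⟩)), level_of_mem h2]
    have := ham_nonneg (j := j) h2
    exact inv_anti₀ (by linarith) (by linarith)
  · rw [level_of_not_mem (n := a) (by simp only [abs_zero]; nlinarith)]
    exact level_nonneg _ _ _

theorem isPreconnected_axisSet {j : ℝ} (hj : |j| < 1) (t : ℝ) : IsPreconnected (axisSet j t) := by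
  refine isPreconnected_iff_ordConnected.2 ⟨fun a ha b hb n hn => ?_⟩
  refine ⟨⟨ha.1.1.trans hn.1, hn.2.trans hb.1.2⟩, ?_⟩
  rcases le_total n (-1 / 2) with h | h
  · exact ha.2.trans (axis_level_anti hj hn.1 h)
  · exact hb.2.trans (axis_level_mono hj h hn.2)

/-- The level curves in the reduced disks, including the boundary. -/
def levelCurve (j t : ℝ) : Set (ℝ × ℝ) := {r | r.1 ^ 2 + 2 * |r.2| ≤ 1 ∧ level j r.1 r.2 = t}

/-- A level curve consists of two graphs over an interval of the axis `u = 0`, which meet at its end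
points. -/
theorem levelCurve_eq {j t : ℝ} (hj : |j| < 1) (ht : 0 ≤ t) : levelCurve j t =
    (fun n => (n, extent j t n)) '' axisSet j t ∪ (fun n => (n, -extent j t n)) '' axisSet j t := by
  ext ⟨n, u⟩
  constructor
  · rintro ⟨h1, h2⟩
    simp only at h1 h2
    have h3 : extent j t n = |u| := by
      rw [← h2, ← level_abs, extent_eq hj (abs_nonneg u) h1]
    have h4 : n ∈ axisSet j t := by
      refine ⟨abs_le.1 ((sq_le_one_iff_abs_le_one n).1 (by linarith [abs_nonneg u])), ?_⟩
      rw [← h2, ← level_abs]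
      exact level_anti hj le_rfl (abs_nonneg u)
    rcases abs_choice u with h | h
    · exact Or.inl ⟨n, h4, by simp only [h3, h]⟩
    · exact Or.inr ⟨n, h4, by simp only [h3, h, neg_neg]⟩
  · have key : ∀ n ∈ axisSet j t, n ^ 2 + 2 * |extent j t n| ≤ 1 ∧
        level j n (extent j t n) = t := by
      rintro n ⟨hn, hl⟩
      refine ⟨?_, level_extent hj ht hl⟩
      have h1 := extent_le ht n (j := j)
      have h2 : 0 ≤ (1 - n ^ 2) / 2 := by nlinarith [hn.1, hn.2]
      rw [max_eq_right h2] at h1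
      rw [abs_of_nonneg (extent_nonneg _ _ _)]
      linarith
    rintro (⟨m, hm, h⟩ | ⟨m, hm, h⟩) <;> obtain ⟨rfl, rfl⟩ := Prod.ext_iff.1 h
    · exact key m hm
    · obtain ⟨h1, h2⟩ := key m hm
      refine ⟨by simpa using h1, ?_⟩
      simp only
      rwa [← level_abs, abs_neg, level_abs]

theorem isConnected_levelCurve {j t : ℝ} (hj : |j| < 1) (ht : t ∈ Icc (0 : ℝ) 1) :
    IsConnected (levelCurve j t) := by
  obtain ⟨n, hn, hnl⟩ := (exists_axis_level hj ht).1
  have hmem : n ∈ axisSet j t := ⟨⟨by linarith [hn.1], hn.2⟩, hnl.ge⟩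
  have hext : extent j t n = 0 :=
    le_antisymm ((extent_le_iff hj ht.1 le_rfl).2 hnl.le) (extent_nonneg _ _ _)
  have hc := continuous_extent hj ht.1
  rw [levelCurve_eq hj ht.1]
  refine ⟨⟨_, Or.inl ⟨n, hmem, rfl⟩⟩, IsPreconnected.union (n, 0) ⟨n, hmem, by simp only [hext]⟩
    ⟨n, hmem, by simp only [hext, neg_zero]⟩ ?_ ?_⟩
  · exact (isPreconnected_axisSet hj t).image _ (by fun_prop)
  · exact (isPreconnected_axisSet hj t).image _ (by fun_prop)

theorem isPreconnected_orbit (z : Phase) : IsPreconnected (range fun θ => rot θ z) :=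
  isPreconnected_range (continuous_rot z)

/-- The common fibres of `fib` and `act` over the open bidisk, and of `act` over the boundary. -/
def fibre (j t : ℝ) : Set Phase := {z | z ∈ bidisk ∧ ang z = j ∧ lev z = t}

theorem isCompact_fibre {j : ℝ} (hj : |j| < 1) (t : ℝ) : IsCompact (fibre j t) := by
  have h1 : IsCompact (bidisk ∩ ang ⁻¹' {j}) :=
    isCompact_bidisk.inter_right (isClosed_singleton.preimage contDiff_ang.continuous)
  have h2 : ContinuousOn lev (bidisk ∩ ang ⁻¹' {j}) := fun z hz =>
    (continuousAt_lev (by rw [show ang z = j from hz.2]; exact hj)).continuousWithinAt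
  have h3 := h2.preimage_isClosed_of_isClosed h1.isClosed (isClosed_singleton (x := t))
  have h4 : fibre j t = (bidisk ∩ ang ⁻¹' {j}) ∩ lev ⁻¹' {t} := by
    ext z
    simp only [fibre, mem_ofPred_eq, mem_inter_iff, mem_preimage, mem_singleton_iff, and_assoc]
  rw [h4]
  exact h1.of_isClosed_subset h3 inter_subset_left

/-- A fibre is mapped onto a level curve, which is connected, and the preimages of points are orbits
of the rotations. -/
theorem isConnected_fibre {j t : ℝ} (hj : |j| < 1) (ht : t ∈ Icc (0 : ℝ) 1) :
    IsConnected (fibre j t) := by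
  have hlt : ∀ z ∈ fibre j t, |ang z| < 1 := fun z hz => by rw [hz.2.1]; exact hj
  refine isConnected_of_fibres (isCompact_fibre hj t) (f := fun z => (nn z, uu z)) (fun z hz =>
    ((contDiffAt_nn (hlt z hz)).continuousAt.prodMk
      (contDiffAt_uu (hlt z hz)).continuousAt).continuousWithinAt) ?_ fun z hz => ?_
  · convert isConnected_levelCurve hj ht using 1
    ext ⟨n, u⟩
    constructor
    · rintro ⟨z, hz, h⟩
      obtain ⟨rfl, rfl⟩ := Prod.ext_iff.1 h
      exact ⟨(mem_reduced_closed_iff (hlt z hz)).2 hz.1, by rw [← hz.2.2, lev, hz.2.1]⟩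
    · rintro ⟨h1, h2⟩
      obtain ⟨z, h3, rfl, rfl⟩ := exists_phase_reduced hj n u
      refine ⟨z, ⟨(mem_reduced_closed_iff (by rwa [h3])).1 h1, h3, ?_⟩, rfl⟩
      rw [lev, h3]; exact h2
  · convert isPreconnected_orbit z using 1
    ext w
    have hjz := hlt z hz
    constructor
    · rintro ⟨hw, hwz⟩
      have hjw := hlt w hw
      obtain ⟨h1, h2⟩ := Prod.ext_iff.1 hwz
      simp only at h1 h2
      have ha : ang z = ang w := hz.2.1.trans hw.2.1.symm
      have hd : dot z = dot w := by rw [← bb_mul_nn hjz, ← bb_mul_nn hjw, ha, h1]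
      have hx : sqP z - sqQ z = sqP w - sqQ w := by
        have e1 := bb_mul_uu hjz
        have e2 := bb_mul_uu hjw
        rw [ha, ← h2, e2] at e1
        linarith
      -- the sum of the squared lengths is determined by their difference and their product
      have hm : sqP z * sqQ z = sqP w * sqQ w := by
        rw [← ang_sq_add_dot_sq, ← ang_sq_add_dot_sq, ha, hd]
      have hs : sqP z + sqQ z = sqP w + sqQ w := by
        refine (sq_eq_sq₀ (by linarith [sqP_nonneg z, sqQ_nonneg z])
          (by linarith [sqP_nonneg w, sqQ_nonneg w])).1 ?_
        linear_combination (sqP z - sqQ z + sqP w - sqQ w) * hx + 4 * hm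
      exact exists_rot_eq hd ha (by linarith) (by linarith)
    · rintro ⟨θ, rfl⟩
      have e1 : nn (rot θ z) = nn z := by simp only [nn, dot_rot, ang_rot]
      have e2 : uu (rot θ z) = uu z := by simp only [uu, sqP_rot, sqQ_rot, ang_rot]
      refine ⟨⟨?_, ?_, ?_⟩, ?_⟩
      · rw [mem_bidisk_iff, sqP_rot, sqQ_rot, ← mem_bidisk_iff]; exact hz.1
      · rw [ang_rot]; exact hz.2.1
      · rw [lev, e1, e2, ang_rot]; exact hz.2.2
      · simp only [mem_preimage, mem_singleton_iff, e1, e2]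

/-- When the angular momentum is `1` or `-1`, the fibre is a single orbit of the rotations. -/
theorem isConnected_act_fibre {b : ℝ × ℝ} (hb : b ∈ region) :
    IsConnected (bidisk ∩ act ⁻¹' {b}) := by
  obtain ⟨m, a⟩ := b
  have hpi : 0 < 2 * Real.pi := by positivity
  obtain ⟨h1, h2, h3⟩ := mem_region_iff.1 hb
  set j := m / (2 * Real.pi) with hj
  have hm : m = 2 * Real.pi * j := by rw [hj]; field_simp
  rcases h1.lt_or_eq with h | h
  · obtain ⟨t, ht, hta⟩ := exists_area_eq h h2 h3
    convert isConnected_fibre h ht using 1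
    ext z
    simp only [fibre, act, mem_inter_iff, mem_preimage, mem_singleton_iff, Prod.mk.injEq,
      mem_ofPred_eq, hm, mul_right_inj' hpi.ne']
    refine and_congr_right fun hz => and_congr_right fun hja => ?_
    rw [hja, ← hta]
    exact (area_strictAntiOn h).injOn.eq_iff (lev_mem z) ht
  · have ha := area_zero_of_abs_eq_one h h2 h3
    obtain ⟨z, hz, hzj⟩ := exists_bidisk_of_abs_eq_one h
    have hset : ∀ w, w ∈ bidisk ∩ act ⁻¹' {(m, a)} ↔ w ∈ bidisk ∧ ang w = j := by
      intro w
      simp only [act, mem_inter_iff, mem_preimage, mem_singleton_iff, Prod.mk.injEq, hm,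
        mul_right_inj' hpi.ne']
      refine and_congr_right fun hw => and_iff_left_of_imp fun hja => ?_
      rw [hja, ha, area_of_abs_eq_one h]
    have hinv : ∀ w ∈ bidisk, ang w = j → dot w = 0 ∧ sqP w = 1 ∧ sqQ w = 1 := by
      intro w hw hwj
      have e1 := ang_sq_add_dot_sq w
      have e2 : ang w ^ 2 = 1 := by rw [hwj, ← sq_abs, h]; norm_num
      obtain ⟨e3, e4⟩ := mem_bidisk_iff.1 hw
      have e5 := sqP_nonneg w
      have e6 := sqQ_nonneg w
      have e7 : dot w ^ 2 = 0 := le_antisymm (by nlinarith) (sq_nonneg _)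
      refine ⟨by simpa using e7, ?_, ?_⟩ <;> nlinarith
    refine ⟨⟨z, (hset z).2 ⟨hz, hzj⟩⟩, ?_⟩
    convert isPreconnected_orbit z using 1
    ext w
    rw [hset]
    obtain ⟨i1, i2, i3⟩ := hinv z hz hzj
    constructor
    · rintro ⟨hw, hwj⟩
      obtain ⟨k1, k2, k3⟩ := hinv w hw hwj
      exact exists_rot_eq (i1.trans k1.symm) (hzj.trans hwj.symm) (i2.trans k2.symm)
        (i3.trans k3.symm)
    · rintro ⟨θ, rfl⟩
      simp only [mem_bidisk_iff, sqP_rot, sqQ_rot, ang_rot]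
      exact ⟨mem_bidisk_iff.1 hz, hzj⟩

/-! ### Smoothness, properness and the bases of the two maps -/

theorem eventually_abs_ang_lt {z : Phase} (h : |ang z| < 1) : ∀ᶠ w in 𝓝 z, |ang w| < 1 :=
  contDiff_ang.continuous.abs.continuousAt.eventually (isOpen_Iio.mem_nhds h)

theorem zz_phase {z : Phase} (h : |ang z| < 1) :
    zz (ang z) (nn z) (uu z) = (sqP z + sqQ z) / 2 := by
  rw [zz, bb_mul_nn h, bb_mul_uu h]
  have h1 := ang_sq_add_dot_sq z
  rw [show ((sqP z - sqQ z) / 2) ^ 2 + dot z ^ 2 + ang z ^ 2 = ((sqP z + sqQ z) / 2) ^ 2 by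
    linear_combination h1]
  exact Real.sqrt_sq (by linarith [sqP_nonneg z, sqQ_nonneg z])

theorem ham_phase_of_ge {z : Phase} (h : |ang z| < 1) (hn : -1 / 4 ≤ nn z) :
    (fib z).2 = 1 / 2 + 17 / 8 * dot z + 15 / 8 * ((sqP z + sqQ z) / 2) + pen (nn z) (uu z) := by
  change ham (ang z) (nn z) (uu z) = _
  rw [ham_eq_outer hn, outer, zz_phase h, bb_mul_nn h]

theorem contDiffAt_fib {z : Phase} (hz : z ∈ openBidisk) : ContDiffAt ℝ ∞ fib z := by
  have hj := abs_ang_lt hz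
  have hm := (mem_reduced_iff hj).2 hz
  refine contDiff_ang.contDiffAt.prodMk ?_
  by_cases h : -1 / 4 < nn z
  · have h1 : (fun z => (fib z).2) =ᶠ[𝓝 z] fun z => 1 / 2 + 17 / 8 * dot z +
        15 / 8 * ((sqP z + sqQ z) / 2) + pen (nn z) (uu z) := by
      filter_upwards [eventually_abs_ang_lt hj,
        (contDiffAt_nn hj).continuousAt.eventually (isOpen_Ioi.mem_nhds h)] with w hw hn
      exact ham_phase_of_ge hw (le_of_lt hn)
    refine ContDiffAt.congr_of_eventuallyEq ?_ h1
    have h2 := contDiff_dot.contDiffAt (x := z)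
    have h3 := contDiff_sqP.contDiffAt (x := z)
    have h4 := contDiff_sqQ.contDiffAt (x := z)
    exact ((contDiffAt_const.add (contDiffAt_const.mul h2)).add
      (contDiffAt_const.mul ((h3.add h4).div_const 2))).add
      (contDiffAt_pen (contDiffAt_nn hj) (contDiffAt_uu hj) hm)
  · exact contDiffAt_ham contDiff_ang.contDiffAt (contDiffAt_nn hj) (contDiffAt_uu hj) hj hm
      (Or.inl (by linarith))

/-- The common base of the fibration, `|j| < 1`, `h ≥ 0`. -/
def base : Set (ℝ × ℝ) := {b | |b.1| < 1 ∧ 0 ≤ b.2}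

/-- The change of coordinates from the base of `fib` to the base diagram. -/
def toDiagram (b : ℝ × ℝ) : ℝ × ℝ := (2 * Real.pi * b.1, area b.1 (1 + b.2)⁻¹)

theorem fib_mem_base {z : Phase} (hz : z ∈ openBidisk) : fib z ∈ base :=
  ⟨abs_ang_lt hz, fib_nonneg hz⟩

theorem act_eq {z : Phase} (hz : z ∈ openBidisk) : act z = toDiagram (fib z) := by
  rw [act, lev_eq hz]; rfl

theorem exists_fib_eq {b : ℝ × ℝ} (hb : b ∈ base) : ∃ z ∈ openBidisk, fib z = b := by
  obtain ⟨z, -, h1, h2⟩ := exists_bidisk_of_level hb.1 (inv_mem_Icc hb.2)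
  have hj : |ang z| < 1 := by rw [h1]; exact hb.1
  have hz : z ∈ openBidisk := by
    have := hb.2
    rw [← lev_pos_iff hj, h2]; positivity
  refine ⟨z, hz, Prod.ext h1 ?_⟩
  rw [lev_eq hz] at h2
  have := inv_injective h2
  linarith

theorem fib_image : fib '' openBidisk = base := by
  ext b
  exact ⟨fun ⟨z, hz, h⟩ => h ▸ fib_mem_base hz, fun hb => exists_fib_eq hb⟩

theorem act_image_open : act '' openBidisk = toDiagram '' base := by
  rw [← fib_image, image_image]
  exact image_congr fun z hz => act_eq hz

theorem fib_fibre {b : ℝ × ℝ} (hb : b ∈ base) :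
    openBidisk ∩ fib ⁻¹' {b} = fibre b.1 (1 + b.2)⁻¹ := by
  have := hb.2
  ext z
  constructor
  · rintro ⟨hz, h⟩
    rw [mem_preimage, mem_singleton_iff] at h
    exact ⟨openBidisk_subset hz, by rw [← h]; rfl, by rw [lev_eq hz, h]⟩
  · rintro ⟨-, h1, h2⟩
    have hj : |ang z| < 1 := by rw [h1]; exact hb.1
    have hz : z ∈ openBidisk := by
      rw [← lev_pos_iff hj, h2]; positivity
    refine ⟨hz, Prod.ext h1 ?_⟩
    rw [lev_eq hz] at h2
    have := inv_injective h2
    linarith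

theorem isConnected_fib_fibre {b : ℝ × ℝ} (hb : b ∈ base) :
    IsConnected (openBidisk ∩ fib ⁻¹' {b}) := by
  rw [fib_fibre hb]
  exact isConnected_fibre hb.1 (inv_mem_Icc hb.2)

theorem isCompact_fib_preimage {K : Set (ℝ × ℝ)} (hK : K ⊆ base) (hc : IsCompact K) :
    IsCompact (openBidisk ∩ fib ⁻¹' K) := by
  -- the preimage is cut out of the closed bidisk by conditions on `(ang, lev)`
  set g : ℝ × ℝ → ℝ × ℝ := fun b => (b.1, (1 + b.2)⁻¹) with hg
  have hgK : IsCompact (g '' K) := hc.image_of_continuousOn (by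
    refine continuousOn_fst.prodMk (ContinuousOn.inv₀ (by fun_prop) fun b hb => ?_)
    have := (hK hb).2
    positivity)
  have hKj : IsCompact (Prod.fst '' K) := hc.image continuous_fst
  have h1 : IsCompact (bidisk ∩ ang ⁻¹' (Prod.fst '' K)) :=
    isCompact_bidisk.inter_right (hKj.isClosed.preimage contDiff_ang.continuous)
  have hlt : ∀ z ∈ bidisk ∩ ang ⁻¹' (Prod.fst '' K), |ang z| < 1 := by
    rintro z ⟨-, b, hb, h⟩
    rw [← h]; exact (hK hb).1
  have h2 : ContinuousOn (fun z => (ang z, lev z)) (bidisk ∩ ang ⁻¹' (Prod.fst '' K)) :=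
    fun z hz => (contDiff_ang.continuous.continuousAt.prodMk
      (continuousAt_lev (hlt z hz))).continuousWithinAt
  have h3 := h2.preimage_isClosed_of_isClosed h1.isClosed hgK.isClosed
  have h4 : openBidisk ∩ fib ⁻¹' K = (bidisk ∩ ang ⁻¹' (Prod.fst '' K)) ∩
      (fun z => (ang z, lev z)) ⁻¹' (g '' K) := by
    ext z
    constructor
    · rintro ⟨hz, h⟩
      exact ⟨⟨openBidisk_subset hz, fib z, h, rfl⟩, fib z, h, by simp only [hg, lev_eq hz]; rfl⟩
    · rintro ⟨h, b, hb, hbz⟩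
      obtain ⟨e1, e2⟩ := Prod.ext_iff.1 hbz
      have : z ∈ openBidisk ∩ fib ⁻¹' {b} := by
        rw [fib_fibre (hK hb)]
        exact ⟨h.1, e1.symm, e2.symm⟩
      exact ⟨this.1, by rw [mem_preimage, show fib z = b from this.2]; exact hb⟩
  rw [h4]
  exact h1.of_isClosed_subset h3 inter_subset_left

theorem area_lt_iff {j h h' : ℝ} (hj : |j| < 1) (hh : 0 ≤ h) (hh' : 0 ≤ h') :
    area j (1 + h)⁻¹ < area j (1 + h')⁻¹ ↔ h < h' := by
  rw [(area_strictAntiOn hj).lt_iff_gt (inv_mem_Icc hh) (inv_mem_Icc hh')]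
  rw [inv_lt_inv₀ (by linarith) (by linarith)]
  constructor <;> intro h <;> linarith

theorem toDiagram_injOn : InjOn toDiagram base := by
  rintro ⟨j, h⟩ hb ⟨j', h'⟩ hb' he
  have hpi : 0 < 2 * Real.pi := by positivity
  obtain ⟨h1, h2⟩ := Prod.ext_iff.1 he
  simp only [toDiagram] at h1 h2
  obtain rfl := mul_left_cancel₀ hpi.ne' h1
  refine Prod.ext rfl ?_
  rcases lt_trichotomy h h' with h3 | h3 | h3
  · exact absurd h2 ((area_lt_iff hb.1 hb.2 hb'.2).2 h3).ne
  · exact h3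
  · exact absurd h2 ((area_lt_iff hb.1 hb'.2 hb.2).2 h3).ne'

theorem continuousOn_area_inv :
    ContinuousOn (fun b : ℝ × ℝ => area b.1 (1 + b.2)⁻¹) base :=
  ContinuousOn.comp (g := fun q : ℝ × ℝ => area q.1 q.2) (f := fun b : ℝ × ℝ => (b.1, (1 + b.2)⁻¹))
    continuousOn_area_aux (continuousOn_fst.prodMk (ContinuousOn.inv₀ (by fun_prop) fun b hb => by
      have := hb.2; positivity)) fun b hb => ⟨hb.1, (inv_mem_Icc hb.2).1⟩

/-- The change of coordinates `toDiagram` as a homeomorphism onto its image. The inverse is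
continuous since `toDiagram` is continuous and monotone on each vertical line. -/
def diagramHomeo : ↥base ≃ₜ ↥(toDiagram '' base) where
  toEquiv := Equiv.Set.imageOfInjOn toDiagram base toDiagram_injOn
  continuous_toFun := by
    refine Continuous.subtype_mk ?_ _
    have h1 : ContinuousOn toDiagram base :=
      (continuousOn_const.mul continuousOn_fst).prodMk continuousOn_area_inv
    exact continuousOn_iff_continuous_domRestrict.1 h1
  continuous_invFun := by
    set e := Equiv.Set.imageOfInjOn toDiagram base toDiagram_injOn with he
    have hpi : 0 < 2 * Real.pi := by positivity
    have hspec : ∀ y : ↥(toDiagram '' base), toDiagram (e.symm y).1 = y.1 := fun y =>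
      congrArg Subtype.val (e.apply_symm_apply y)
    have hfst : ∀ y : ↥(toDiagram '' base), (e.symm y).1.1 = y.1.1 / (2 * Real.pi) := fun y => by
      rw [← hspec y]; simp only [toDiagram]; field_simp
    have hsnd : ∀ y : ↥(toDiagram '' base),
        area (y.1.1 / (2 * Real.pi)) (1 + (e.symm y).1.2)⁻¹ = y.1.2 := fun y => by
      rw [← hfst y, ← hspec y]; rfl
    have hlt : ∀ y : ↥(toDiagram '' base), |y.1.1 / (2 * Real.pi)| < 1 := fun y => by
      rw [← hfst y]; exact (e.symm y).2.1
    have hcont : ∀ c : ℝ, 0 ≤ c → Continuous fun y : ↥(toDiagram '' base) =>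
        area (y.1.1 / (2 * Real.pi)) (1 + c)⁻¹ := fun c hc =>
      ContinuousOn.comp_continuous (f := fun y : ↥(toDiagram '' base) =>
        ((y.1.1 / (2 * Real.pi), c) : ℝ × ℝ)) continuousOn_area_inv (by fun_prop)
        fun y => ⟨hlt y, hc⟩
    refine Continuous.subtype_mk (Continuous.prodMk (f := fun y => (e.symm y).1.1)
      (g := fun y => (e.symm y).1.2) ?_ ?_) _
    · simp only [hfst]; fun_prop
    · refine OrderTopology.continuous_iff.2 fun c => ?_
      by_cases hc : 0 ≤ c
      · constructor
        · convert isOpen_lt (hcont c hc) (continuous_snd.comp continuous_subtype_val) using 1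
          ext y
          change c < (e.symm y).1.2 ↔ _ < y.1.2
          rw [← hsnd y]
          exact (area_lt_iff (hlt y) hc (e.symm y).2.2).symm
        · convert isOpen_lt (continuous_snd.comp continuous_subtype_val) (hcont c hc) using 1
          ext y
          change (e.symm y).1.2 < c ↔ y.1.2 < _
          rw [← hsnd y]
          exact (area_lt_iff (hlt y) (e.symm y).2.2 hc).symm
      · push Not at hc
        constructor
        · convert isOpen_univ using 1
          exact eq_univ_of_forall fun y => hc.trans_le (e.symm y).2.2
        · convert isOpen_empty using 1
          exact eq_empty_of_forall_notMem fun y hy => absurd (e.symm y).2.2 (by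
            have : (e.symm y).1.2 < c := hy
            linarith)

theorem exists_homeo : ∃ ψ : ↥(fib '' openBidisk) ≃ₜ ↥(act '' openBidisk),
    ∀ x (hx : x ∈ openBidisk),
      ψ ⟨fib x, mem_image_of_mem fib hx⟩ = ⟨act x, mem_image_of_mem act hx⟩ := by
  refine ⟨((Homeomorph.setCongr fib_image).trans diagramHomeo).trans
    (Homeomorph.setCongr act_image_open.symm), fun x hx => Subtype.ext ?_⟩
  exact (act_eq hx).symm

/-- The height of the node in the base diagram. -/
def nodeHeight : ℝ := area 0 (1 + 1 / 2)⁻¹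

theorem nodeHeight_pos : 0 < nodeHeight := by
  have h1 := area_strictAnti (j := 0) (by simp) (s := (1 + 1 / 2)⁻¹) (t := 1) (by norm_num)
    (by norm_num) le_rfl
  rwa [area_one] at h1

theorem nodeHeight_lt : nodeHeight < height 0 := by
  have h1 := area_strictAnti (j := 0) (by simp) (s := 0) (t := (1 + 1 / 2)⁻¹) le_rfl
    (by norm_num) (by norm_num)
  rw [area_zero (by simp), mul_zero] at h1
  exact h1

theorem act_not_mem_cut {z : Phase} (hz : z ∈ openBidisk) (h : act z ∉ cut nodeHeight) :
    (fib z).1 ≠ 0 ∨ (fib z).2 < 1 / 2 := by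
  by_contra hc
  push Not at hc
  obtain ⟨h1, h2⟩ := hc
  have hb := fib_mem_base hz
  have hreg : act z ∈ region := act_image ▸ mem_image_of_mem act (openBidisk_subset hz)
  have h0 : (act z).1 = 0 := by
    rw [act_eq hz, toDiagram, h1, mul_zero]
  refine h ⟨h0, ?_, ?_⟩
  · rw [act_eq hz, toDiagram, h1, nodeHeight]
    refine not_lt.1 fun hlt => ?_
    have := (area_lt_iff (j := 0) (by simp) hb.2 (by norm_num)).1 hlt
    linarith
  · rw [← h0]; exact hreg.2.2

theorem isClosed_cut (a : ℝ) : IsClosed (cut a) :=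
  (isClosed_eq continuous_fst continuous_const).inter
    ((isClosed_le continuous_const continuous_snd).inter
      (isClosed_le continuous_snd continuous_const))

/-- Off the branch cut the area is smooth: at the minima it is `π H`, and elsewhere it is the action
integral. -/
theorem contDiffAt_act {z : Phase} (hz : z ∈ openBidisk)
    (h : (fib z).1 ≠ 0 ∨ (fib z).2 < 1 / 2) : ContDiffAt ℝ ∞ act z := by
  have hf := contDiffAt_fib hz
  have hj := abs_ang_lt hz
  have hM := isOpen_openBidisk.mem_nhds hz
  refine ContDiffAt.prodMk (contDiffAt_const.mul contDiff_ang.contDiffAt) ?_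
  rcases (fib_nonneg hz).eq_or_lt with h0 | h0
  · have h1 : ∀ᶠ w in 𝓝 z, (fib w).2 < bb (ang w) ^ 4 / 512 := by
      have hc1 : ContinuousAt (fun w => (fib w).2) z := continuousAt_snd.comp hf.continuousAt
      have hc2 : ContinuousAt (fun w => bb (ang w) ^ 4 / 512) z :=
        (((contDiffAt_bb contDiff_ang.contDiffAt hj).continuousAt).pow 4).div_const _
      refine hc1.eventually_lt hc2 ?_
      rw [← h0]
      have := bb_pos hj
      positivity
    have h2 : (fun w => area (ang w) (lev w)) =ᶠ[𝓝 z] fun w => Real.pi * (fib w).2 := by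
      filter_upwards [hM, h1] with w hw hw1
      rw [lev_eq hw]
      exact area_eq_pi_mul (abs_ang_lt hw) (fib_nonneg hw) hw1
    exact (contDiffAt_const.mul (contDiffAt_snd.comp z hf)).congr_of_eventuallyEq h2
  · have hc : fib z ∈ curveDom := ⟨hj, h0, h⟩
    have h2 : (fun w => area (ang w) (lev w)) =ᶠ[𝓝 z] fun w => action (fib w) := by
      filter_upwards [hM, hf.continuousAt.eventually (isOpen_curveDom.mem_nhds hc)] with w hw hw1
      rw [lev_eq hw]
      exact area_eq_action hw1
    exact ((contDiffAt_action hc).comp z hf).congr_of_eventuallyEq h2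

/-! ### Action-angle coordinates -/

theorem action_injOn {j h h' : ℝ} (hh : (j, h) ∈ curveDom) (hh' : (j, h') ∈ curveDom)
    (he : action (j, h) = action (j, h')) : h = h' := by
  have h1 := area_eq_action hh
  have h2 := area_eq_action hh'
  rw [he, ← h2] at h1
  have e := (area_strictAntiOn hh.1).injOn (inv_mem_Icc hh.2.1.le) (inv_mem_Icc hh'.2.1.le) h1
  have := inv_injective e
  simp only at this
  linarith

/-- The pairs `(j, a)` of values of the two actions off the branch cut. -/
def actionImage : Set (ℝ × ℝ) := {q | ∃ h, (q.1, h) ∈ curveDom ∧ action (q.1, h) = q.2}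

open Classical in
/-- The value of the Hamiltonian in terms of the actions, with the value `0` outside their image. -/
def hInv (q : ℝ × ℝ) : ℝ :=
  if h : ∃ h, (q.1, h) ∈ curveDom ∧ action (q.1, h) = q.2 then h.choose else 0

theorem hInv_spec {q : ℝ × ℝ} (h : q ∈ actionImage) :
    (q.1, hInv q) ∈ curveDom ∧ action (q.1, hInv q) = q.2 := by
  have h' : ∃ h, (q.1, h) ∈ curveDom ∧ action (q.1, h) = q.2 := h
  unfold hInv
  rw [dif_pos h']
  exact h'.choose_spec

theorem hInv_action {j h : ℝ} (hh : (j, h) ∈ curveDom) : hInv (j, action (j, h)) = h := by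
  have h1 := hInv_spec (q := (j, action (j, h))) ⟨h, hh, rfl⟩
  exact action_injOn h1.1 hh h1.2

theorem hInv_smooth : IsOpen actionImage ∧ ContDiffOn ℝ ∞ hInv actionImage :=
  fiber_inverse isOpen_curveDom (g := action) (fun _ hq => (contDiffAt_action hq).contDiffWithinAt)
    (fun _ _ h => (fderiv_action_pos h).ne') (fun _ _ h => hInv_spec h)
    (fun _ h hh => ⟨⟨h, hh, rfl⟩, hInv_action hh⟩)

theorem periodic_iterate {f : ℝ → ℝ} {T c : ℝ} (h : ∀ x, f (x + T) = f x + c) (x : ℝ) (k : ℤ) :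
    f (x + T * k) = f x + c * k := by
  induction k using Int.induction_on with
  | zero => simp
  | succ k ih =>
    have := h (x + T * k)
    push_cast at ih ⊢
    rw [show x + T * (k + 1) = x + T * k + T by ring, this, ih]; ring
  | pred k ih =>
    have := h (x + T * (-k - 1))
    push_cast at ih ⊢
    rw [show x + T * (-k - 1) + T = x + T * -k by ring, ih] at this
    linarith

theorem angleCoord_shift {a : ℝ × ℝ} (h : a ∈ curveDom) (φ : ℝ) (k : ℤ) :
    angleCoord (a, φ + 2 * Real.pi * k) = angleCoord (a, φ) + k := by
  rw [periodic_iterate (f := fun φ => angleCoord (a, φ)) (angleCoord_add_two_pi h), one_mul]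

theorem shift_shift {a : ℝ × ℝ} (h : a ∈ curveDom) (φ : ℝ) (k : ℤ) :
    shift (a, φ + 2 * Real.pi * k) = shift (a, φ) := by
  rw [periodic_iterate (f := fun φ => shift (a, φ)) (c := 0)
    (fun φ => by rw [shift_add_two_pi h, add_zero]), zero_mul, add_zero]

theorem xx_shift (a : ℝ × ℝ) (φ : ℝ) (k : ℤ) :
    xx (a, φ + 2 * Real.pi * k) = xx (a, φ) := by
  rw [periodic_iterate (f := fun φ => xx (a, φ)) (c := 0)
    (fun φ => by rw [xx_add_two_pi, add_zero]), zero_mul, add_zero]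

theorem yy_shift (a : ℝ × ℝ) (φ : ℝ) (k : ℤ) :
    yy (a, φ + 2 * Real.pi * k) = yy (a, φ) := by
  rw [periodic_iterate (f := fun φ => yy (a, φ)) (c := 0)
    (fun φ => by rw [yy_add_two_pi, add_zero]), zero_mul, add_zero]

theorem exists_angleCoord_eq {a : ℝ × ℝ} (h : a ∈ curveDom) (θ : ℝ) :
    ∃ φ, angleCoord (a, φ) = θ := by
  have hpi : 0 < 2 * Real.pi := by positivity
  have hc : Continuous fun φ => angleCoord (a, φ) := continuous_iff_continuousAt.2 fun φ =>
    (contDiffAt_angleCoord (q := (a, φ)) h).continuousAt.comp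
      (continuousAt_const.prodMk continuousAt_id)
  have h0 : angleCoord (a, 0) = 0 := by simp [angleCoord, hCoef_zero h]
  have hv : ∀ k : ℤ, angleCoord (a, 2 * Real.pi * k) = k := fun k => by
    have := angleCoord_shift h 0 k
    rwa [zero_add, h0, zero_add] at this
  have hle : 2 * Real.pi * (⌊θ⌋ : ℝ) ≤ 2 * Real.pi * ((⌊θ⌋ + 1 : ℤ) : ℝ) := by
    refine mul_le_mul_of_nonneg_left ?_ hpi.le
    push_cast; linarith
  obtain ⟨φ, -, hφ⟩ := intermediate_value_Icc hle hc.continuousOn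
    (show θ ∈ Icc _ _ by
      simp only [hv]
      exact ⟨Int.floor_le θ, by push_cast; exact (Int.lt_floor_add_one θ).le⟩)
  exact ⟨φ, hφ⟩

open Classical in
/-- The inverse of the angle coordinate on a level curve. -/
def angleInv (q : (ℝ × ℝ) × ℝ) : ℝ :=
  if h : ∃ φ, angleCoord (q.1, φ) = q.2 then h.choose else 0

theorem angleInv_spec {q : (ℝ × ℝ) × ℝ} (h : q.1 ∈ curveDom) :
    angleCoord (q.1, angleInv q) = q.2 := by
  have h' := exists_angleCoord_eq h q.2
  unfold angleInv
  rw [dif_pos h']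
  exact h'.choose_spec

theorem angleInv_angleCoord {a : ℝ × ℝ} (h : a ∈ curveDom) (φ : ℝ) :
    angleInv (a, angleCoord (a, φ)) = φ :=
  (strictMono_angleCoord h).injective (angleInv_spec (q := (a, angleCoord (a, φ))) h)

theorem contDiffAt_angleInv {q : (ℝ × ℝ) × ℝ} (h : q.1 ∈ curveDom) :
    ContDiffAt ℝ ∞ angleInv q :=
  (fiber_inverse (O' := curveDom ×ˢ univ) (k := angleInv) isOpen_curveDom_prod (g := angleCoord)
    (fun _ hq => (contDiffAt_angleCoord hq.1).contDiffWithinAt)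
    (fun _ _ h => (fderiv_angleCoord_angle h.1).ne')
    (fun _ _ h => ⟨⟨h.1, mem_univ _⟩, angleInv_spec h.1⟩)
    (fun _ φ h => ⟨⟨h.1, mem_univ _⟩, angleInv_angleCoord h.1 φ⟩)).2.contDiffAt
      (isOpen_curveDom_prod.mem_nhds ⟨h, mem_univ _⟩)

/-- The part of the base diagram off the branch cut. -/
def actionDom : Set (ℝ × ℝ) := {I | (I.1 / (2 * Real.pi), I.2) ∈ actionImage}

theorem isOpen_actionDom : IsOpen actionDom :=
  hInv_smooth.1.preimage (f := fun I : ℝ × ℝ => (I.1 / (2 * Real.pi), I.2)) (by fun_prop)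

/-- The point `(j, h)` of the base with given actions. -/
def basePoint (I : ℝ × ℝ) : ℝ × ℝ := (I.1 / (2 * Real.pi), hInv (I.1 / (2 * Real.pi), I.2))

theorem basePoint_mem {I : ℝ × ℝ} (h : I ∈ actionDom) : basePoint I ∈ curveDom := (hInv_spec h).1

theorem action_basePoint {I : ℝ × ℝ} (h : I ∈ actionDom) : action (basePoint I) = I.2 :=
  (hInv_spec h).2

theorem contDiffAt_basePoint {I : ℝ × ℝ} (h : I ∈ actionDom) : ContDiffAt ℝ ∞ basePoint I := by
  have h1 : ContDiffAt ℝ ∞ (fun I : ℝ × ℝ => (I.1 / (2 * Real.pi), I.2)) I := by fun_prop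
  have h2 : ContDiffAt ℝ ∞ hInv (I.1 / (2 * Real.pi), I.2) :=
    hInv_smooth.2.contDiffAt (hInv_smooth.1.mem_nhds h)
  have h3 : ContDiffAt ℝ ∞ (fun I : ℝ × ℝ => hInv (I.1 / (2 * Real.pi), I.2)) I :=
    ContDiffAt.comp (g := hInv) (f := fun I : ℝ × ℝ => (I.1 / (2 * Real.pi), I.2)) I h2 h1
  exact ContDiffAt.prodMk (by fun_prop) h3

/-- The point of a level curve with given actions and second angle. -/
def curvePoint (e : (ℝ × ℝ) × (ℝ × ℝ)) : (ℝ × ℝ) × ℝ :=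
  (basePoint e.1, angleInv (basePoint e.1, e.2.2))

theorem contDiffAt_curvePoint {e : (ℝ × ℝ) × (ℝ × ℝ)} (h : e.1 ∈ actionDom) :
    ContDiffAt ℝ ∞ curvePoint e := by
  have h1 : ContDiffAt ℝ ∞ (fun e : (ℝ × ℝ) × (ℝ × ℝ) => basePoint e.1) e :=
    (contDiffAt_basePoint h).comp e contDiffAt_fst
  have h2 : ContDiffAt ℝ ∞ (fun e : (ℝ × ℝ) × (ℝ × ℝ) => (basePoint e.1, e.2.2)) e :=
    h1.prodMk (by fun_prop)
  have h3 : ContDiffAt ℝ ∞ (fun e : (ℝ × ℝ) × (ℝ × ℝ) => angleInv (basePoint e.1, e.2.2)) e :=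
    ContDiffAt.comp (g := angleInv) (f := fun e : (ℝ × ℝ) × (ℝ × ℝ) => (basePoint e.1, e.2.2)) e
      (contDiffAt_angleInv (q := (basePoint e.1, e.2.2)) (basePoint_mem h)) h2
  exact h1.prodMk h3

/-- Action-angle coordinates: the second angle moves along the level curves of the Hamiltonian, the
first is the angle of rotation, in the coordinates of `lift`. The sign of the first angle and the
twist by `shift` make the map symplectic. -/
def actionAngle (e : (ℝ × ℝ) × (ℝ × ℝ)) : Phase :=
  lift (xx (curvePoint e)) (yy (curvePoint e)) (e.1.1 / (2 * Real.pi))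
    (shift (curvePoint e) - 2 * Real.pi * e.2.1)

theorem yy_slit {q : (ℝ × ℝ) × ℝ} (h : q.1 ∈ curveDom) : yy q < 0 ∨ q.1.1 ≠ 0 :=
  (cn_spec h).1.2.2.imp_left fun h0 => mul_neg_of_pos_of_neg (bb_pos h.1) h0

theorem sqrt_yy {q : (ℝ × ℝ) × ℝ} : √(yy q ^ 2 + q.1.1 ^ 2) = kk q.1.1 (cn q) := rfl

/-- The reduced coordinates of the points `lift` over a level curve. -/
theorem reduced_lift {q : (ℝ × ℝ) × ℝ} (h : q.1 ∈ curveDom) (α : ℝ) :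
    ang (lift (xx q) (yy q) q.1.1 α) = q.1.1 ∧ nn (lift (xx q) (yy q) q.1.1 α) = cn q ∧
      uu (lift (xx q) (yy q) q.1.1 α) = cu q := by
  have hs := yy_slit h
  have hb := bb_pos h.1
  have h1 := ang_lift hs (xx q) α
  have h2 := dot_lift hs (xx q) α
  have hk : 0 < kk q.1.1 (cn q) := kk_pos h.1 (ne_of_slit (cn_spec h).1.2.2)
  refine ⟨h1, ?_, ?_⟩
  · rw [nn, h1, h2, yy]; field_simp
  · rw [uu, h1, sqP_lift hs, sqQ_lift hs, sqrt_yy]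
    have h3 : kk q.1.1 (cn q) * Real.exp (2 * xx q) - kk q.1.1 (cn q) * Real.exp (-(2 * xx q)) =
        2 * kk q.1.1 (cn q) * Real.sinh (2 * xx q) := by rw [Real.sinh_eq]; ring
    rw [h3, xx, xcoord, mul_div_cancel₀ _ two_ne_zero, Real.sinh_arsinh]
    field_simp

theorem fib_lift {q : (ℝ × ℝ) × ℝ} (h : q.1 ∈ curveDom) (α : ℝ) :
    lift (xx q) (yy q) q.1.1 α ∈ openBidisk ∧ fib (lift (xx q) (yy q) q.1.1 α) = q.1 := by
  obtain ⟨h1, h2, h3⟩ := reduced_lift h α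
  refine ⟨(mem_reduced_iff (by rw [h1]; exact h.1)).1 (by rw [h2, h3]; exact (cu_spec h).1.2.1), ?_⟩
  rw [fib, h1, h2, h3, ham_curve h]

theorem act_lift {q : (ℝ × ℝ) × ℝ} (h : q.1 ∈ curveDom) (α : ℝ) :
    act (lift (xx q) (yy q) q.1.1 α) = (2 * Real.pi * q.1.1, action q.1) := by
  obtain ⟨h1, h2⟩ := fib_lift h α
  rw [act_eq h1, h2, toDiagram, area_eq_action h]

theorem exists_lift_curve {z : Phase} (hz : z ∈ openBidisk) (h : fib z ∈ curveDom) :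
    ∃ φ α, lift (xx (fib z, φ)) (yy (fib z, φ)) (fib z).1 α = z := by
  have hj := abs_ang_lt hz
  have hm := (mem_reduced_iff hj).2 hz
  have hs : nn z < 0 ∨ ang z ≠ 0 := by
    rcases h.2.2 with h1 | h1
    · exact Or.inr h1
    · exact Or.inl (neg_of_ham_lt hm h1)
  have hs' : dot z < 0 ∨ ang z ≠ 0 := hs.imp_left fun h0 => by
    rw [← bb_mul_nn hj]; exact mul_neg_of_pos_of_neg (bb_pos hj) h0
  obtain ⟨-, φ, h1, h2⟩ := exists_angle (j := ang z) (n := nn z) (u := uu z)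
    ⟨hj, hm, hs⟩ h.2.1 h.2.2
  obtain ⟨α, hα⟩ := exists_lift_eq hs'
  refine ⟨φ, α, ?_⟩
  rw [← hα]
  have e1 : cn (fib z, φ) = nn z := h1
  have e2 : cu (fib z, φ) = uu z := h2
  rw [hα, xx, yy, e1, e2, xcoord]
  change lift (Real.arsinh (bb (ang z) ^ 2 * uu z / √((bb (ang z) * nn z) ^ 2 + ang z ^ 2)) / 2)
    (bb (ang z) * nn z) (ang z) α = z
  rw [bb_mul_nn hj, bb_mul_uu hj, hα]

/-- Action-angle coordinates exist over the whole complement of the cut in the open base diagram: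
the invariants of `lift`, restricted to the level curves, turn `ω` into `dj ∧ ds + dA ∧ dT + dα ∧
dj` (`omega_fderiv_lift` and `wedge_eq`), and `α = s - 2 π θ₁` leaves `dI₁ ∧ dθ₁ + dI₂ ∧ dθ₂`. -/
theorem isActionAngle : IsActionAngle openBidisk act actionDom actionAngle where
  smooth := by
    rintro e ⟨he, -⟩
    have h1 := contDiffAt_curvePoint he
    have hm : (curvePoint e).1 ∈ curveDom := basePoint_mem he
    exact contDiffWithinAt_lift (j := fun e : (ℝ × ℝ) × (ℝ × ℝ) => e.1.1 / (2 * Real.pi))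
      ((contDiffAt_xx hm).comp e h1).contDiffWithinAt
      ((contDiffAt_yy hm).comp e h1).contDiffWithinAt (by fun_prop)
      (((contDiffAt_shift hm).comp e h1).sub (by fun_prop)).contDiffWithinAt (yy_slit hm)
  maps := by
    intro I hI θ
    have hm : (curvePoint (I, θ)).1 ∈ curveDom := basePoint_mem hI
    refine ⟨(fib_lift hm _).1, (act_lift hm _).trans (Prod.ext ?_ (action_basePoint hI))⟩
    change 2 * Real.pi * (I.1 / (2 * Real.pi)) = I.1
    field_simp
  onto := by
    intro z hz hI
    have hpi : 0 < 2 * Real.pi := by positivity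
    have hj : (act z).1 / (2 * Real.pi) = ang z := by
      rw [act]; field_simp
    have hfib : basePoint (act z) = fib z := by
      refine toDiagram_injOn ⟨(basePoint_mem hI).1, (basePoint_mem hI).2.1.le⟩ (fib_mem_base hz) ?_
      rw [← act_eq hz, toDiagram, area_eq_action (basePoint_mem hI), action_basePoint hI]
      refine Prod.ext ?_ rfl
      change 2 * Real.pi * ((act z).1 / (2 * Real.pi)) = _
      field_simp
    have hd : fib z ∈ curveDom := hfib ▸ basePoint_mem hI
    obtain ⟨φ, α, h⟩ := exists_lift_curve hz hd
    refine ⟨((shift (fib z, φ) - α) / (2 * Real.pi), angleCoord (fib z, φ)), ?_⟩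
    have hq : curvePoint (act z, ((shift (fib z, φ) - α) / (2 * Real.pi), angleCoord (fib z, φ))) =
        (fib z, φ) := by
      rw [curvePoint, hfib, angleInv_angleCoord hd]
    rw [actionAngle, hq, hj]
    have : shift (fib z, φ) - 2 * Real.pi * ((shift (fib z, φ) - α) / (2 * Real.pi)) = α := by
      field_simp; ring
    exact (congrArg _ this).trans h
  periods := by
    intro I hI θ θ'
    have hpi : 0 < 2 * Real.pi := by positivity
    have ha : basePoint I ∈ curveDom := basePoint_mem hI
    set φ := angleInv (basePoint I, θ.2) with hφ
    set φ' := angleInv (basePoint I, θ'.2) with hφ'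
    have hT : angleCoord (basePoint I, φ) = θ.2 := angleInv_spec (q := (basePoint I, θ.2)) ha
    have hT' : angleCoord (basePoint I, φ') = θ'.2 := angleInv_spec (q := (basePoint I, θ'.2)) ha
    have hs := yy_slit (q := (basePoint I, φ)) ha
    have hΨ : ∀ θ'' : ℝ × ℝ, actionAngle (I, θ'') =
      lift (xx (basePoint I, angleInv (basePoint I, θ''.2)))
        (yy (basePoint I, angleInv (basePoint I, θ''.2))) (basePoint I).1
        (shift (basePoint I, angleInv (basePoint I, θ''.2)) - 2 * Real.pi * θ''.1) := fun _ => rfl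
    rw [hΨ, hΨ, ← hφ, ← hφ']
    constructor
    · intro he
      obtain ⟨-, h2, h3⟩ := reduced_lift (q := (basePoint I, φ)) ha
        (shift (basePoint I, φ) - 2 * Real.pi * θ.1)
      obtain ⟨-, h2', h3'⟩ := reduced_lift (q := (basePoint I, φ')) ha
        (shift (basePoint I, φ') - 2 * Real.pi * θ'.1)
      obtain ⟨l, hl⟩ := angle_inj ha (h2.symm.trans ((congrArg nn he).trans h2'))
        (h3.symm.trans ((congrArg uu he).trans h3'))
      rw [hl, xx_shift, yy_shift, shift_shift ha] at he
      obtain ⟨m, hm⟩ := (lift_eq_lift_iff hs _ _ _).1 he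
      refine ⟨-m, l, Prod.ext ?_ ?_⟩
      · have : 2 * Real.pi * θ'.1 = 2 * Real.pi * (θ.1 - m) := by linarith
        have := mul_left_cancel₀ hpi.ne' this
        rw [this]; simp; ring
      · rw [← hT', hl, angleCoord_shift ha, hT]; rfl
    · rintro ⟨k, l, rfl⟩
      have hl : φ' = φ + 2 * Real.pi * l := by
        refine (strictMono_angleCoord ha).injective ?_
        rw [hT', angleCoord_shift ha, hT]; rfl
      rw [hl, xx_shift, yy_shift, shift_shift ha]
      refine (lift_eq_lift_iff hs _ _ _).2 ⟨-k, ?_⟩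
      simp; ring
  symplectic := by
    intro I hI θ v w
    have h1 := contDiffAt_curvePoint (e := (I, θ)) hI
    have hm : (curvePoint (I, θ)).1 ∈ curveDom := basePoint_mem hI
    have hj : ContDiffAt ℝ ∞ (fun e : (ℝ × ℝ) × (ℝ × ℝ) => e.1.1 / (2 * Real.pi)) (I, θ) := by
      fun_prop
    have hα : ContDiffAt ℝ ∞ (fun e : (ℝ × ℝ) × (ℝ × ℝ) =>
        shift (curvePoint e) - 2 * Real.pi * e.2.1) (I, θ) :=
      ((contDiffAt_shift hm).comp (I, θ) h1).sub (by fun_prop)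
    have hmain := omega_fderiv_lift ((contDiffAt_xx hm).comp (I, θ) h1)
      ((contDiffAt_yy hm).comp (I, θ) h1) hj hα (yy_slit hm) v w
    have hd1 := h1.differentiableAt (by simp)
    have hchain : ∀ {G : (ℝ × ℝ) × ℝ → ℝ}, ContDiffAt ℝ ∞ G (curvePoint (I, θ)) →
        ∀ v, fderiv ℝ (G ∘ curvePoint) (I, θ) v =
          fderiv ℝ G (curvePoint (I, θ)) (fderiv ℝ curvePoint (I, θ) v) := fun hG v => by
      rw [fderiv_comp _ (hG.differentiableAt (by simp)) hd1]; rfl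
    have hev : ∀ᶠ e in 𝓝 (I, θ), e.1 ∈ actionDom :=
      continuousAt_fst.eventually (isOpen_actionDom.mem_nhds hI)
    have dJ : ∀ v, fderiv ℝ (fun e : (ℝ × ℝ) × (ℝ × ℝ) => e.1.1 / (2 * Real.pi)) (I, θ) v =
        v.1.1 / (2 * Real.pi) := fun v => by
      have : HasFDerivAt (fun e : (ℝ × ℝ) × (ℝ × ℝ) => e.1.1 / (2 * Real.pi))
        ((2 * Real.pi)⁻¹ • ((ContinuousLinearMap.fst ℝ ℝ ℝ).comp
          (ContinuousLinearMap.fst ℝ (ℝ × ℝ) (ℝ × ℝ)))) (I, θ) :=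
        (((ContinuousLinearMap.fst ℝ ℝ ℝ).comp
          (ContinuousLinearMap.fst ℝ (ℝ × ℝ) (ℝ × ℝ))).hasFDerivAt).mul_const' _ |>.congr_fderiv
          (by ext <;> simp)
      rw [this.fderiv]; simp; ring
    have dκ : ∀ v, (fderiv ℝ curvePoint (I, θ) v).1.1 = v.1.1 / (2 * Real.pi) := fun v => by
      have e1 := hchain (G := fun q => q.1.1) (by fun_prop) v
      rw [show fderiv ℝ (fun q : (ℝ × ℝ) × ℝ => q.1.1) (curvePoint (I, θ)) = dj from
        dj.fderiv] at e1
      rw [← dJ v]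
      exact e1.symm
    have dA : ∀ v, fderiv ℝ action (curvePoint (I, θ)).1 (fderiv ℝ curvePoint (I, θ) v).1 =
        v.1.2 := fun v => by
      rw [← fderiv_action_fst hm, ← hchain (G := fun q => action q.1)
        ((contDiffAt_action hm).comp _ contDiffAt_fst)]
      have e1 : ((fun q : (ℝ × ℝ) × ℝ => action q.1) ∘ curvePoint) =ᶠ[𝓝 (I, θ)]
          fun e => e.1.2 := hev.mono fun e he => action_basePoint he
      rw [e1.fderiv_eq]
      exact congrArg (fun L => L v) (((ContinuousLinearMap.snd ℝ ℝ ℝ).comp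
          (ContinuousLinearMap.fst ℝ (ℝ × ℝ) (ℝ × ℝ))).fderiv (x := (I, θ)))
    have dT : ∀ v, fderiv ℝ angleCoord (curvePoint (I, θ)) (fderiv ℝ curvePoint (I, θ) v) =
        v.2.2 := fun v => by
      rw [← hchain (contDiffAt_angleCoord hm)]
      have e1 : (angleCoord ∘ curvePoint) =ᶠ[𝓝 (I, θ)] fun e => e.2.2 :=
        hev.mono fun e he => angleInv_spec (q := (basePoint e.1, e.2.2)) (basePoint_mem he)
      rw [e1.fderiv_eq]
      exact congrArg (fun L => L v) (((ContinuousLinearMap.snd ℝ ℝ ℝ).comp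
          (ContinuousLinearMap.snd ℝ (ℝ × ℝ) (ℝ × ℝ))).fderiv (x := (I, θ)))
    have dα : ∀ v, fderiv ℝ (fun e : (ℝ × ℝ) × (ℝ × ℝ) =>
        shift (curvePoint e) - 2 * Real.pi * e.2.1) (I, θ) v =
        fderiv ℝ shift (curvePoint (I, θ)) (fderiv ℝ curvePoint (I, θ) v) -
          2 * Real.pi * v.2.1 := fun v => by
      have e1 : HasFDerivAt (fun e : (ℝ × ℝ) × (ℝ × ℝ) => 2 * Real.pi * e.2.1)
        ((2 * Real.pi) • ((ContinuousLinearMap.fst ℝ ℝ ℝ).comp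
          (ContinuousLinearMap.snd ℝ (ℝ × ℝ) (ℝ × ℝ)))) (I, θ) :=
        (((ContinuousLinearMap.fst ℝ ℝ ℝ).comp
          (ContinuousLinearMap.snd ℝ (ℝ × ℝ) (ℝ × ℝ))).hasFDerivAt).const_mul _
      have e2 : HasFDerivAt (fun e => shift (curvePoint e)) _ (I, θ) :=
        HasFDerivAt.comp (I, θ) ((contDiffAt_shift hm).differentiableAt (by simp)).hasFDerivAt
          hd1.hasFDerivAt
      have e3 : HasFDerivAt (fun e : (ℝ × ℝ) × (ℝ × ℝ) =>
        shift (curvePoint e) - 2 * Real.pi * e.2.1) _ (I, θ) := e2.sub e1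
      rw [e3.fderiv]
      simp
    rw [dJ, dJ, dα, dα, hchain (contDiffAt_xx hm), hchain (contDiffAt_xx hm),
      hchain (contDiffAt_yy hm), hchain (contDiffAt_yy hm), wedge_eq hm, dA, dA, dT, dT,
      dκ, dκ] at hmain
    refine hmain.trans ?_
    have := Real.pi_pos.ne'
    field_simp
    ring

theorem mem_actionDom {z : Phase} (hz : z ∈ openBidisk) (h : fib z ∈ curveDom) :
    act z ∈ actionDom := by
  refine ⟨(fib z).2, ?_⟩
  have h1 : (act z).1 / (2 * Real.pi) = (fib z).1 := by
    rw [act_eq hz, toDiagram]; field_simp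
  simp only [h1]
  exact ⟨h, by rw [act_eq hz, toDiagram, area_eq_action h]⟩

theorem isBaseDiagram : IsBaseDiagram openBidisk fib act (cut nodeHeight) where
  homeo := exists_homeo
  isClosed_cut := isClosed_cut _
  smooth := fun z hz => (contDiffAt_act hz.1 (act_not_mem_cut hz.1 hz.2)).contDiffWithinAt
  action := by
    intro b hb hc
    refine ⟨actionDom, actionAngle, isOpen_actionDom, ?_, isActionAngle⟩
    obtain ⟨z, hz, rfl⟩ := interior_subset hb
    -- interior points lie off the horizontal axis, hence away from the elliptic points
    have hpos : 0 < (act z).2 := by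
      have h1 : interior (act '' openBidisk) ⊆ interior {b : ℝ × ℝ | 0 ≤ b.2} :=
        interior_mono (by rintro _ ⟨w, -, rfl⟩; exact area_nonneg _ _)
      have h2 : interior {b : ℝ × ℝ | 0 ≤ b.2} = {b | 0 < b.2} := by
        have : {b : ℝ × ℝ | 0 ≤ b.2} = univ ×ˢ Ici 0 := by ext; simp
        rw [this, interior_prod_eq, interior_univ, interior_Ici]
        ext; simp
      have := h1 hb
      rw [h2] at this
      exact this
    refine mem_actionDom hz ⟨abs_ang_lt hz, ?_, act_not_mem_cut hz hc⟩
    refine (fib_nonneg hz).lt_of_ne fun h0 => ?_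
    rw [act_eq hz, toDiagram, ← h0, add_zero, inv_one, area_one] at hpos
    exact lt_irrefl _ hpos

/-! ### Regular points -/

/-- The coordinate forms `dp₁`, `dp₂` on phase space. -/
def dp (i : Fin 2) : Phase →L[ℝ] ℝ :=
  (EuclideanSpace.proj (𝕜 := ℝ) i).comp (ContinuousLinearMap.fst ℝ Plane Plane)

/-- The coordinate forms `dq₁`, `dq₂` on phase space. -/
def dq (i : Fin 2) : Phase →L[ℝ] ℝ :=
  (EuclideanSpace.proj (𝕜 := ℝ) i).comp (ContinuousLinearMap.snd ℝ Plane Plane)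

theorem dp_apply (i : Fin 2) (v : Phase) : dp i v = v.1 i := rfl

theorem dq_apply (i : Fin 2) (v : Phase) : dq i v = v.2 i := rfl

theorem hasFDerivAt_p (i : Fin 2) (z : Phase) : HasFDerivAt (fun z : Phase => z.1 i) (dp i) z :=
  (dp i).hasFDerivAt

theorem hasFDerivAt_q (i : Fin 2) (z : Phase) : HasFDerivAt (fun z : Phase => z.2 i) (dq i) z :=
  (dq i).hasFDerivAt

theorem fderiv_ang (z v : Phase) : fderiv ℝ ang z v =
    v.1 0 * z.2 1 + z.1 0 * v.2 1 - (v.1 1 * z.2 0 + z.1 1 * v.2 0) := by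
  have h : HasFDerivAt ang _ z := ((hasFDerivAt_p 0 z).mul (hasFDerivAt_q 1 z)).sub
    ((hasFDerivAt_p 1 z).mul (hasFDerivAt_q 0 z))
  rw [h.fderiv]
  simp only [_root_.add_apply, _root_.sub_apply, _root_.smul_apply, smul_eq_mul, dp_apply, dq_apply]
  ring

theorem fderiv_dot (z v : Phase) : fderiv ℝ dot z v =
    v.1 0 * z.2 0 + z.1 0 * v.2 0 + (v.1 1 * z.2 1 + z.1 1 * v.2 1) := by
  have h : HasFDerivAt dot _ z := ((hasFDerivAt_p 0 z).mul (hasFDerivAt_q 0 z)).add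
    ((hasFDerivAt_p 1 z).mul (hasFDerivAt_q 1 z))
  rw [h.fderiv]
  simp only [_root_.add_apply, _root_.smul_apply, smul_eq_mul, dp_apply, dq_apply]
  ring

theorem fderiv_sqP (z v : Phase) : fderiv ℝ sqP z v = 2 * (z.1 0 * v.1 0 + z.1 1 * v.1 1) := by
  have h : HasFDerivAt sqP _ z := ((hasFDerivAt_p 0 z).pow 2).add ((hasFDerivAt_p 1 z).pow 2)
  rw [h.fderiv]
  simp [dp_apply]
  ring

theorem fderiv_sqQ (z v : Phase) : fderiv ℝ sqQ z v = 2 * (z.2 0 * v.2 0 + z.2 1 * v.2 1) := by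
  have h : HasFDerivAt sqQ _ z := ((hasFDerivAt_q 0 z).pow 2).add ((hasFDerivAt_q 1 z).pow 2)
  rw [h.fderiv]
  simp [dq_apply]
  ring

theorem differentiableAt_ang (z : Phase) : DifferentiableAt ℝ ang z :=
  contDiff_ang.contDiffAt.differentiableAt (by simp)

theorem differentiableAt_dot (z : Phase) : DifferentiableAt ℝ dot z :=
  contDiff_dot.contDiffAt.differentiableAt (by simp)

/-- The differentials of the normalised coordinates in directions tangent to the level sets of the
angular momentum. -/
theorem fderiv_nn {z v : Phase} (hj : |ang z| < 1) (hv : fderiv ℝ ang z v = 0) :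
    fderiv ℝ nn z v = fderiv ℝ dot z v / bb (ang z) := by
  have h1 : (fun w => bb (ang w) * nn w) =ᶠ[𝓝 z] dot :=
    (eventually_abs_ang_lt hj).mono fun w hw => bb_mul_nn hw
  have hb : ContDiffAt ℝ ∞ bb (ang z) := contDiffAt_bb (j := fun j : ℝ => j) contDiffAt_id hj
  have h2 : HasFDerivAt (fun w => bb (ang w)) _ z := HasFDerivAt.comp (g := bb) (f := ang) z
    (hb.differentiableAt (by simp)).hasFDerivAt (differentiableAt_ang z).hasFDerivAt
  have h3 := (h2.mul ((contDiffAt_nn hj).differentiableAt (by simp)).hasFDerivAt).fderiv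
  rw [← h1.fderiv_eq, show (fun w => bb (ang w) * nn w) = (fun w => bb (ang w)) * nn from rfl, h3]
  have := (bb_pos hj).ne'
  simp [hv]
  field_simp

theorem fderiv_uu {z v : Phase} (hj : |ang z| < 1) (hv : fderiv ℝ ang z v = 0) :
    fderiv ℝ uu z v = (fderiv ℝ sqP z v - fderiv ℝ sqQ z v) / 2 / bb (ang z) ^ 2 := by
  have h1 : (fun w => bb (ang w) ^ 2 * uu w) =ᶠ[𝓝 z] fun w => (sqP w - sqQ w) * (1 / 2) :=
    (eventually_abs_ang_lt hj).mono fun w hw => (bb_mul_uu hw).trans (by ring)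
  have hb : ContDiffAt ℝ ∞ (fun j => bb j ^ 2) (ang z) :=
    (contDiffAt_bb (j := fun j : ℝ => j) contDiffAt_id hj).pow 2
  have h2 : HasFDerivAt (fun w => bb (ang w) ^ 2) _ z := HasFDerivAt.comp z
    (hb.differentiableAt (by simp)).hasFDerivAt (differentiableAt_ang z).hasFDerivAt
  have h3 := (h2.mul ((contDiffAt_uu hj).differentiableAt (by simp)).hasFDerivAt).fderiv
  have h4 : HasFDerivAt (fun w => (sqP w - sqQ w) * (1 / 2)) _ z :=
    ((contDiff_sqP.contDiffAt.differentiableAt (by simp)).hasFDerivAt.sub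
      (contDiff_sqQ.contDiffAt.differentiableAt (by simp)).hasFDerivAt).mul_const (1 / 2)
  have h5 := congrArg (fun L => L v) (h1.fderiv_eq.trans h4.fderiv)
  have h6 := (congrArg (fun L => L v) h3).symm.trans h5
  have := (bb_pos hj).ne'
  simp [hv] at h6
  field_simp
  linarith

theorem eq_zero_of_sq {z : Phase} (h : sqP z + sqQ z = 0) : z = 0 := by
  have h1 := sqP_nonneg z
  have h2 := sqQ_nonneg z
  have h3 : sqP z = 0 := by linarith
  have h4 : sqQ z = 0 := by linarith
  have key : ∀ {a b : ℝ}, a ^ 2 + b ^ 2 = 0 → a = 0 ∧ b = 0 := fun {a b} h =>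
    ⟨pow_eq_zero_iff two_ne_zero |>.1 (by linarith [sq_nonneg a, sq_nonneg b]),
      pow_eq_zero_iff two_ne_zero |>.1 (by linarith [sq_nonneg a, sq_nonneg b])⟩
  exact phase_ext (key h3).1 (key h3).2 (key h4).1 (key h4).2

theorem sq_add_pos {z : Phase} (h : z ≠ 0) : 0 < sqP z + sqQ z :=
  (add_nonneg (sqP_nonneg z) (sqQ_nonneg z)).lt_of_ne fun h0 => h (eq_zero_of_sq h0.symm)

/-- The generator of the rotations: the Hamiltonian vector field of the angular momentum, up to
sign. -/
def rotVec (z : Phase) : Phase := mkPhase (-z.1 1) (z.1 0) (-z.2 1) (z.2 0)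

theorem omega_rotVec (z v : Phase) : omega (rotVec z) v = fderiv ℝ ang z v := by
  rw [fderiv_ang]
  simp only [omega, rotVec, mkPhase_p0, mkPhase_p1, mkPhase_q0, mkPhase_q1]
  ring

theorem ne_of_ne_zero {z : Phase} (h : z ≠ 0) : nn z ≠ 0 ∨ ang z ≠ 0 ∨ uu z ≠ 0 := by
  by_contra hc
  push Not at hc
  obtain ⟨h1, h2, h3⟩ := hc
  have hj : |ang z| < 1 := by rw [h2]; simp
  have e1 := bb_mul_nn hj
  have e2 := bb_mul_uu hj
  rw [h1, mul_zero] at e1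
  rw [h3, mul_zero] at e2
  have e3 := ang_sq_add_dot_sq z
  rw [h2, ← e1] at e3
  refine h (eq_zero_of_sq ?_)
  have hP := sqP_nonneg z
  have hQ := sqQ_nonneg z
  have e4 : sqP z = sqQ z := by linarith
  rw [e4] at e3
  have : sqQ z = 0 := by nlinarith
  rw [e4, this, add_zero]

/-- The differential of the Hamiltonian in directions tangent to the level sets of the angular
momentum. -/
theorem fderiv_fib_snd {z v : Phase} (hz : z ∈ openBidisk) (h0 : z ≠ 0)
    (hv : fderiv ℝ ang z v = 0) :
    (fderiv ℝ fib z v).2 =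
      fderiv ℝ nn z v * deriv (fun n => ham (ang z) n (uu z)) (nn z) +
      fderiv ℝ uu z v * deriv (fun u => ham (ang z) (nn z) u) (uu z) := by
  have hj := abs_ang_lt hz
  have hm := (mem_reduced_iff hj).2 hz
  have hne := ne_of_ne_zero h0
  have hham : ContDiffAt ℝ ∞ (fun q : ℝ × ℝ × ℝ => ham q.1 q.2.1 q.2.2) (ang z, nn z, uu z) :=
    contDiffAt_ham (j := fun q : ℝ × ℝ × ℝ => q.1) (n := fun q : ℝ × ℝ × ℝ => q.2.1)
      (u := fun q : ℝ × ℝ × ℝ => q.2.2) (by fun_prop) (by fun_prop) (by fun_prop) hj hm hne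
  have hham' := (hham.differentiableAt (by simp)).hasFDerivAt
  have h1 := (differentiableAt_ang z).hasFDerivAt
  have h2 := ((contDiffAt_nn hj).differentiableAt (by simp)).hasFDerivAt
  have h3 := ((contDiffAt_uu hj).differentiableAt (by simp)).hasFDerivAt
  have h4 : HasFDerivAt (fun z => ham (ang z) (nn z) (uu z)) _ z :=
    HasFDerivAt.comp (g := fun q : ℝ × ℝ × ℝ => ham q.1 q.2.1 q.2.2)
      (f := fun z => (ang z, nn z, uu z)) z hham' (h1.prodMk (h2.prodMk h3))
  have h5 : HasFDerivAt fib _ z := h1.prodMk h4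
  have dn : HasDerivAt (fun n => ham (ang z) n (uu z))
      (fderiv ℝ (fun q : ℝ × ℝ × ℝ => ham q.1 q.2.1 q.2.2) (ang z, nn z, uu z) (0, 1, 0)) (nn z) :=
    hham'.comp_hasDerivAt (nn z) (f := fun n : ℝ => (ang z, n, uu z))
      ((hasDerivAt_const _ _).prodMk ((hasDerivAt_id _).prodMk (hasDerivAt_const _ _)))
  have du : HasDerivAt (fun u => ham (ang z) (nn z) u)
      (fderiv ℝ (fun q : ℝ × ℝ × ℝ => ham q.1 q.2.1 q.2.2) (ang z, nn z, uu z) (0, 0, 1)) (uu z) :=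
    hham'.comp_hasDerivAt (uu z) (f := fun u : ℝ => (ang z, nn z, u))
      ((hasDerivAt_const _ _).prodMk ((hasDerivAt_const _ _).prodMk (hasDerivAt_id _)))
  rw [h5.fderiv, dn.deriv, du.deriv]
  change fderiv ℝ (fun q : ℝ × ℝ × ℝ => ham q.1 q.2.1 q.2.2) (ang z, nn z, uu z)
    (fderiv ℝ ang z v, fderiv ℝ nn z v, fderiv ℝ uu z v) = _
  rw [hv, show ((0 : ℝ), fderiv ℝ nn z v, fderiv ℝ uu z v) =
    fderiv ℝ nn z v • ((0, 1, 0) : ℝ × ℝ × ℝ) + fderiv ℝ uu z v • ((0, 0, 1) : ℝ × ℝ × ℝ) by simp,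
    map_add, map_smul, map_smul]
  rfl

theorem fderiv_fib_fst {z : Phase} (hz : z ∈ openBidisk) (v : Phase) :
    (fderiv ℝ fib z v).1 = fderiv ℝ ang z v := by
  have h1 := ((contDiffAt_fib hz).differentiableAt (by simp)).hasFDerivAt.fst.fderiv
  exact (congrArg (fun L => L v) h1).symm

theorem exists_fderiv_ang {z : Phase} (h0 : z ≠ 0) : ∃ v, fderiv ℝ ang z v = 1 := by
  have hpos := sq_add_pos h0
  refine ⟨(sqP z + sqQ z)⁻¹ • mkPhase (z.2 1) (-z.2 0) (-z.1 1) (z.1 0), ?_⟩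
  rw [map_smul, fderiv_ang]
  simp only [mkPhase_p0, mkPhase_p1, mkPhase_q0, mkPhase_q1, smul_eq_mul]
  rw [inv_mul_eq_one₀ hpos.ne']
  unfold sqP sqQ
  ring

/-- Off the minima and the node, the Hamiltonian is regular on the level sets of the angular
momentum. -/
theorem exists_fderiv_ham {z : Phase} (hz : z ∈ openBidisk) (h0 : z ≠ 0)
    (hc : uu z ≠ 0 ∨ nn z ≠ -1 / 2) :
    ∃ v, fderiv ℝ ang z v = 0 ∧ (fderiv ℝ fib z v).2 ≠ 0 := by
  have hj := abs_ang_lt hz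
  have hm := (mem_reduced_iff hj).2 hz
  have hb := bb_pos hj
  have hpos := sq_add_pos h0
  by_cases hu : uu z = 0
  · -- on the axis `u = 0`, move in the direction `(q, p)`
    set v := mkPhase (z.2 0) (z.2 1) (z.1 0) (z.1 1) with hv
    have e1 : fderiv ℝ ang z v = 0 := by
      rw [fderiv_ang, hv]
      simp only [mkPhase_p0, mkPhase_p1, mkPhase_q0, mkPhase_q1]; ring
    have e2 : fderiv ℝ uu z v = 0 := by
      rw [fderiv_uu hj e1, fderiv_sqP, fderiv_sqQ, hv]
      simp only [mkPhase_p0, mkPhase_p1, mkPhase_q0, mkPhase_q1]; ring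
    have e3 : fderiv ℝ nn z v = (sqP z + sqQ z) / bb (ang z) := by
      rw [fderiv_nn hj e1, fderiv_dot, hv]
      simp only [mkPhase_p0, mkPhase_p1, mkPhase_q0, mkPhase_q1, sqP, sqQ]; ring
    refine ⟨v, e1, ?_⟩
    rw [fderiv_fib_snd hz h0 e1, e2, zero_mul, add_zero, e3, hu]
    refine mul_ne_zero (div_pos hpos hb).ne' ?_
    have hn := abs_lt_one_of_mem hm
    rcases lt_or_gt_of_ne (hc.resolve_left (not_not.2 hu)) with h | h
    · obtain ⟨d, hd, hd'⟩ := exists_deriv_axis_neg hj hn h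
      rw [hd'.deriv]; exact hd.ne
    · have h1 : nn z ≠ 0 ∨ ang z ≠ 0 := by
        rcases ne_of_ne_zero h0 with h | h | h
        · exact Or.inl h
        · exact Or.inr h
        · exact absurd hu h
      obtain ⟨d, hd, hd'⟩ := exists_deriv_axis_pos hj hn h h1
      rw [hd'.deriv]; exact hd.ne'
  · -- off the axis, move in the direction `(p, -q)`
    set v := mkPhase (z.1 0) (z.1 1) (-z.2 0) (-z.2 1) with hv
    have e1 : fderiv ℝ ang z v = 0 := by
      rw [fderiv_ang, hv]
      simp only [mkPhase_p0, mkPhase_p1, mkPhase_q0, mkPhase_q1]; ring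
    have e2 : fderiv ℝ nn z v = 0 := by
      rw [fderiv_nn hj e1, fderiv_dot, hv]
      simp only [mkPhase_p0, mkPhase_p1, mkPhase_q0, mkPhase_q1]; ring
    have e3 : fderiv ℝ uu z v = (sqP z + sqQ z) / bb (ang z) ^ 2 := by
      rw [fderiv_uu hj e1, fderiv_sqP, fderiv_sqQ, hv]
      simp only [mkPhase_p0, mkPhase_p1, mkPhase_q0, mkPhase_q1, sqP, sqQ]; ring
    refine ⟨v, e1, ?_⟩
    rw [fderiv_fib_snd hz h0 e1, e2, zero_mul, zero_add, e3]
    refine mul_ne_zero (div_pos hpos (pow_pos hb 2)).ne' ?_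
    rcases lt_or_gt_of_ne hu with h | h
    · obtain ⟨d, hd, hd'⟩ := exists_deriv_ham_neg hj hm h
      rw [hd'.deriv]; exact hd.ne
    · obtain ⟨d, hd, hd'⟩ := exists_deriv_ham hj hm h
      rw [hd'.deriv]; exact hd.ne'

theorem fderiv_fib_rotVec {z : Phase} (hz : z ∈ openBidisk) (h0 : z ≠ 0) :
    fderiv ℝ fib z (rotVec z) = 0 := by
  have hj := abs_ang_lt hz
  have e1 : fderiv ℝ ang z (rotVec z) = 0 := by
    rw [fderiv_ang]; simp only [rotVec, mkPhase_p0, mkPhase_p1, mkPhase_q0, mkPhase_q1]; ring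
  have e2 : fderiv ℝ nn z (rotVec z) = 0 := by
    rw [fderiv_nn hj e1, fderiv_dot]
    simp only [rotVec, mkPhase_p0, mkPhase_p1, mkPhase_q0, mkPhase_q1]; ring
  have e3 : fderiv ℝ uu z (rotVec z) = 0 := by
    rw [fderiv_uu hj e1, fderiv_sqP, fderiv_sqQ]
    simp only [rotVec, mkPhase_p0, mkPhase_p1, mkPhase_q0, mkPhase_q1]; ring
  refine Prod.ext ?_ ?_
  · rw [fderiv_fib_fst hz, e1]; rfl
  · rw [fderiv_fib_snd hz h0 e1, e2, e3]; simp

theorem omega_add_left (u v w : Phase) : omega (u + v) w = omega u w + omega v w := by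
  simp [omega]; ring

theorem omega_smul_left (c : ℝ) (v w : Phase) : omega (c • v) w = c * omega v w := by
  simp [omega]; ring

theorem omega_swap (v w : Phase) : omega v w = -omega w v := by
  simp [omega]; ring

/-- The fibres are Lagrangian because the generator of the rotations is tangent to them and is
`ω`-orthogonal to the level sets of the angular momentum. -/
theorem isRegular {z : Phase} (hz : z ∈ openBidisk) (h0 : z ≠ 0)
    (hc : uu z ≠ 0 ∨ nn z ≠ -1 / 2) : IsRegularLagrangianAt fib z := by
  obtain ⟨v, hv, hv2⟩ := exists_fderiv_ham hz h0 hc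
  obtain ⟨w, hw⟩ := exists_fderiv_ang h0
  have hsurj : Function.Surjective (fderiv ℝ fib z) := by
    rintro ⟨a, b⟩
    refine ⟨a • w + ((b - a * (fderiv ℝ fib z w).2) / (fderiv ℝ fib z v).2) • v, ?_⟩
    rw [map_add, map_smul, map_smul]
    refine Prod.ext ?_ ?_
    · simp [fderiv_fib_fst hz, hv, hw]
    · simp only [Prod.snd_add, Prod.smul_snd, smul_eq_mul]
      field_simp
      ring
  refine ⟨hsurj, fun a b ha hb => ?_⟩
  -- the kernel is a plane, so that `a`, `b` and the generator of the rotations are dependent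
  set L : Phase →ₗ[ℝ] ℝ × ℝ := (fderiv ℝ fib z).toLinearMap with hL
  have hrank : Module.finrank ℝ (LinearMap.ker L) = 2 := by
    have h1 := LinearMap.finrank_range_add_finrank_ker L
    rw [LinearMap.range_eq_top.2 hsurj, finrank_top] at h1
    simp [Module.finrank_prod] at h1
    omega
  have hdep : ¬ LinearIndependent ℝ (fun i : Fin 3 =>
      (![⟨rotVec z, fderiv_fib_rotVec hz h0⟩, ⟨a, ha⟩, ⟨b, hb⟩] i : LinearMap.ker L)) := by
    intro hli
    have := hli.fintype_card_le_finrank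
    rw [hrank] at this
    simp at this
  rw [Fintype.linearIndependent_iff] at hdep
  push Not at hdep
  obtain ⟨g, hg, hne⟩ := hdep
  rw [Fin.sum_univ_three] at hg
  have hg' : g 0 • rotVec z + g 1 • a + g 2 • b = 0 := congrArg Subtype.val hg
  have hja : fderiv ℝ ang z a = 0 := by rw [← fderiv_fib_fst hz, ha]; rfl
  have hjb : fderiv ℝ ang z b = 0 := by rw [← fderiv_fib_fst hz, hb]; rfl
  have key : ∀ c : Phase, g 0 * fderiv ℝ ang z c + g 1 * omega a c + g 2 * omega b c = 0 := by
    intro c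
    rw [← omega_rotVec, ← omega_smul_left, ← omega_smul_left, ← omega_smul_left, ← omega_add_left,
      ← omega_add_left, hg']
    simp [omega]
  have hself : ∀ c : Phase, omega c c = 0 := fun c => by simp [omega]; ring
  have k1 := key b
  have k2 := key a
  rw [hjb, hself, mul_zero, mul_zero, zero_add, add_zero] at k1
  rw [hja, hself, mul_zero, mul_zero, zero_add, zero_add, omega_swap] at k2
  by_contra hab
  have g1 : g 1 = 0 := (mul_eq_zero.1 k1).resolve_right hab
  have g2 : g 2 = 0 := (mul_eq_zero.1 k2).resolve_right (neg_ne_zero.2 hab)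
  rw [g1, g2, zero_smul, zero_smul, add_zero, add_zero] at hg'
  have g0 : g 0 = 0 := by
    refine (smul_eq_zero.1 hg').resolve_right fun hr => h0 ?_
    have r0 := congrArg (fun z : Phase => z.1 0) hr
    have r1 := congrArg (fun z : Phase => z.1 1) hr
    have r2 := congrArg (fun z : Phase => z.2 0) hr
    have r3 := congrArg (fun z : Phase => z.2 1) hr
    simp [rotVec] at r0 r1 r2 r3
    exact phase_ext r1 r0 r3 r2
  obtain ⟨i, hi⟩ := hne
  fin_cases i
  · exact hi g0
  · exact hi g1
  · exact hi g2

/-! ### Elliptic points and the node -/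

theorem omega_nondegenerate {v : Phase} (h : ∀ w, omega v w = 0) : v = 0 := by
  have h0 := h (mkPhase 1 0 0 0)
  have h1 := h (mkPhase 0 1 0 0)
  have h2 := h (mkPhase 0 0 1 0)
  have h3 := h (mkPhase 0 0 0 1)
  simp [omega] at h0 h1 h2 h3
  exact phase_ext h2 h3 h0 h1

/-- A smooth symplectic parametrisation which carries `F` to a model gives a local form. -/
theorem hasLocalForm_of_param {M U : Set Phase} {F G : Phase → ℝ × ℝ} {Φ : Phase → Phase}
    (hU : IsOpen U) (h0 : (0 : Phase) ∈ U) (hΦ : ContDiffOn ℝ ∞ Φ U)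
    (hsymp : ∀ p ∈ U, ∀ v w, omega (fderiv ℝ Φ p v) (fderiv ℝ Φ p w) = omega v w)
    (hM : ∀ p ∈ U, Φ p ∈ M) (χ : (ℝ × ℝ) ≃ₜ (ℝ × ℝ)) (hχ : ContDiff ℝ ∞ χ)
    (hχ' : ContDiff ℝ ∞ χ.symm) (hF : ∀ p ∈ U, χ (F (Φ p)) = G p) :
    HasLocalForm M F G (Φ 0) := by
  have hcd : ∀ p ∈ U, ContDiffAt ℝ ∞ Φ p := fun p hp => hΦ.contDiffAt (hU.mem_nhds hp)
  have hinj : ∀ p ∈ U, Function.Injective (fderiv ℝ Φ p) := fun p hp => by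
    refine (injective_iff_map_eq_zero _).2 fun v hv => omega_nondegenerate fun w => ?_
    rw [← hsymp p hp, hv]; simp [omega]
  -- the derivatives are linear isomorphisms
  have hequiv : ∀ p ∈ U, ∃ L : Phase ≃L[ℝ] Phase, HasFDerivAt Φ (L : Phase →L[ℝ] Phase) p := by
    intro p hp
    refine ⟨(LinearEquiv.ofInjectiveEndo (fderiv ℝ Φ p).toLinearMap
      (hinj p hp)).toContinuousLinearEquiv, ?_⟩
    exact ((hcd p hp).differentiableAt (by simp)).hasFDerivAt.congr_fderiv
      (ContinuousLinearMap.ext fun v => rfl)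
  obtain ⟨L, hL⟩ := hequiv 0 h0
  set e := ((hcd 0 h0).toOpenPartialHomeomorph Φ hL (by simp)).restrOpen U hU with he
  have hcoe : ∀ p, e p = Φ p := fun p => rfl
  have hsrc : e.source ⊆ U := fun p hp => by
    rw [he, OpenPartialHomeomorph.restrOpen_source] at hp; exact hp.2
  have h0s : (0 : Phase) ∈ e.source := by
    rw [he, OpenPartialHomeomorph.restrOpen_source]
    exact ⟨(hcd 0 h0).mem_toOpenPartialHomeomorph_source hL (by simp), h0⟩
  have hsm : ∀ z ∈ e.target, ContDiffAt ℝ ∞ e.symm z := fun z hz => by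
    obtain ⟨L', hL'⟩ := hequiv (e.symm z) (hsrc (e.map_target hz))
    exact e.contDiffAt_symm hz hL' (hcd _ (hsrc (e.map_target hz)))
  refine ⟨e.symm, χ.toOpenPartialHomeomorph, ?_, ?_, ?_, ?_, ?_, ?_, ?_, ?_, ?_⟩
  · exact e.map_source h0s
  · intro z hz
    rw [← e.right_inv hz]
    exact hM _ (hsrc (e.map_target hz))
  · exact e.left_inv h0s
  · exact fun z hz => (hsm z hz).contDiffWithinAt
  · exact hΦ.mono hsrc
  · intro z hz v w
    have hp := hsrc (e.map_target hz)
    have h1 : HasFDerivAt (fun z => Φ (e.symm z)) _ z := HasFDerivAt.comp z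
      ((hcd _ hp).differentiableAt (by simp)).hasFDerivAt
      ((hsm z hz).differentiableAt (by simp)).hasFDerivAt
    have h2 : (fun z => Φ (e.symm z)) =ᶠ[𝓝 z] id :=
      (e.open_target.mem_nhds hz |> fun h => by
        filter_upwards [h] with y hy using e.right_inv hy)
    have h3 := (h1.congr_of_eventuallyEq h2.symm).unique (hasFDerivAt_id z)
    have h4 : ∀ v, fderiv ℝ Φ (e.symm z) (fderiv ℝ e.symm z v) = v := fun v =>
      congrArg (fun L => L v) h3
    rw [← hsymp _ hp, h4, h4]
  · exact hχ.contDiffOn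
  · exact hχ'.contDiffOn
  · intro z hz
    refine ⟨mem_univ _, ?_⟩
    have := hF _ (hsrc (e.map_target hz))
    rwa [← hcoe, e.right_inv hz] at this

/-- The Darboux parametrisation near a minimum of the Hamiltonian: `x₂ = ξ` and `y₂ = η` are the
coordinates of the model in the reduced space, `x₁` is the angular momentum, and `-y₁` the angle of
rotation, corrected by a multiple of `x` which accounts for the dependence of the centre
`y = -bb j / 2` on the angular momentum `j`. -/
def ellipticParam (j α : ℝ) (p : Phase) : Phase :=
  lift (Real.arsinh (2 * p.1 1) / 2) (-(bb (j + p.1 0) / 2) + p.2 1 * √(1 + 4 * p.1 1 ^ 2))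
    (j + p.1 0)
    (α - p.2 0 - (j + p.1 0) / (2 * bb (j + p.1 0)) * (Real.arsinh (2 * p.1 1) / 2))

/-- The domain of the Darboux parametrisation near a minimum. -/
def ellipticDom (j : ℝ) : Set Phase :=
  {p | |j + p.1 0| < 1 ∧ p.1 1 ^ 2 + p.2 1 ^ 2 < bb (j + p.1 0) ^ 4 / 512}

theorem isOpen_ellipticDom (j : ℝ) : IsOpen (ellipticDom j) := by
  have h1 : Continuous fun p : Phase => j + p.1 0 :=
    continuous_const.add (contDiff_fst_coord 0).continuous
  have h2 : Continuous fun p : Phase => p.1 1 ^ 2 + p.2 1 ^ 2 :=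
    ((contDiff_fst_coord 1).continuous.pow 2).add ((contDiff_snd_coord 1).continuous.pow 2)
  have h3 : Continuous bb := by unfold bb; fun_prop
  exact (isOpen_lt h1.abs continuous_const).inter
    (isOpen_lt h2 (((h3.comp h1).pow 4).div_const _))

/-- In the elliptic parametrisation the fibration is the elliptic model, up to a translation of the
angular momentum. -/
theorem reduced_ellipticParam {j : ℝ} (α : ℝ) {p : Phase} (hp : p ∈ ellipticDom j) :
    (-(bb (j + p.1 0) / 2) + p.2 1 * √(1 + 4 * p.1 1 ^ 2) < 0) ∧
    ellipticParam j α p ∈ openBidisk ∧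
      fib (ellipticParam j α p) = (j + p.1 0, p.1 1 ^ 2 + p.2 1 ^ 2) := by
  obtain ⟨hj, hh⟩ := hp
  obtain ⟨⟨-, h2, -⟩, h4, h5⟩ := ham_model hj hh
  unfold ellipticParam
  set J := j + p.1 0 with hJ
  set A := α - p.2 0 - J / (2 * bb J) * (Real.arsinh (2 * p.1 1) / 2)
  set w := √(1 + 4 * p.1 1 ^ 2) with hw
  set n := -1 / 2 + p.2 1 * w / bb J with hn
  have hb := bb_pos hj
  have hy : -(bb J / 2) + p.2 1 * w = bb J * n := by rw [hn]; field_simp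
  rw [hy]
  have hneg : bb J * n < 0 := mul_neg_of_pos_of_neg hb (lt_trans h2 (by norm_num))
  have hs : bb J * n < 0 ∨ J ≠ 0 := Or.inl hneg
  refine ⟨hneg, ?_⟩
  have e1 := ang_lift hs (Real.arsinh (2 * p.1 1) / 2) A
  have e2 : nn (lift (Real.arsinh (2 * p.1 1) / 2) (bb J * n) J A) = n := by
    rw [nn, e1, dot_lift hs]; field_simp
  have e3 : uu (lift (Real.arsinh (2 * p.1 1) / 2) (bb J * n) J A) =
      2 * p.1 1 * kk J n / bb J ^ 2 := by
    rw [uu, e1, sqP_lift hs, sqQ_lift hs]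
    change (kk J n * _ - kk J n * _) / 2 / _ = _
    have h3 : kk J n * Real.exp (2 * (Real.arsinh (2 * p.1 1) / 2)) -
        kk J n * Real.exp (-(2 * (Real.arsinh (2 * p.1 1) / 2))) =
        2 * kk J n * Real.sinh (Real.arsinh (2 * p.1 1)) := by
      rw [mul_div_cancel₀ _ two_ne_zero, Real.sinh_eq]; ring
    rw [h3, Real.sinh_arsinh]
    ring
  refine ⟨(mem_reduced_iff (by rw [e1]; exact hj)).1 (by rw [e2, e3]; exact h4), ?_⟩
  rw [fib, e1, e2, e3, h5]

theorem hasDerivAt_bb {j : ℝ} (hj : |j| < 1) : HasDerivAt bb (-j / bb j) j := by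
  have h1 : HasDerivAt (fun j : ℝ => 1 - j ^ 2) (-(2 * j)) j := by
    simpa using ((hasDerivAt_id j).pow 2).const_sub 1
  have hb := bb_sq hj
  have hb' := bb_pos hj
  have h2 := h1.sqrt (by rw [← hb]; positivity)
  refine HasDerivAt.congr_deriv (f := bb) h2 ?_
  change -(2 * j) / (2 * bb j) = _
  field_simp

/-- The minima of the Hamiltonian on the reduced spaces are elliptic points of corank one. -/
theorem elliptic_local_form {z : Phase} (hz : z ∈ openBidisk) (hu : uu z = 0)
    (hn : nn z = -1 / 2) : HasLocalForm openBidisk fib ellipticOne z := by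
  have hj := abs_ang_lt hz
  have hb := bb_pos hj
  have hd : dot z = -(bb (ang z) / 2) := by rw [← bb_mul_nn hj, hn]; ring
  have hX : (sqP z - sqQ z) / 2 = 0 := by rw [← bb_mul_uu hj, hu, mul_zero]
  obtain ⟨α, hα⟩ := exists_lift_eq (z := z) (Or.inl (by rw [hd]; linarith))
  have hz0 : ellipticParam (ang z) α 0 = z := by
    rw [hX, hd] at hα
    simpa [ellipticParam] using hα
  rw [← hz0]
  have p0 := fun p : Phase => (contDiff_fst_coord 0).contDiffAt (x := p)
  have p1 := fun p : Phase => (contDiff_fst_coord 1).contDiffAt (x := p)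
  have q0 := fun p : Phase => (contDiff_snd_coord 0).contDiffAt (x := p)
  have q1 := fun p : Phase => (contDiff_snd_coord 1).contDiffAt (x := p)
  have cj : ∀ p : Phase, ContDiffAt ℝ ∞ (fun p : Phase => ang z + p.1 0) p := fun p =>
    contDiffAt_const.add (p0 p)
  have cx : ∀ p : Phase, ContDiffAt ℝ ∞ (fun p : Phase => Real.arsinh (2 * p.1 1) / 2) p :=
    fun p => (contDiffAt_const.mul (p1 p)).arsinh.div_const 2
  have cw : ∀ p : Phase, ContDiffAt ℝ ∞ (fun p : Phase => √(1 + 4 * p.1 1 ^ 2)) p := fun p =>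
    ContDiffAt.sqrt (contDiffAt_const.add (contDiffAt_const.mul ((p1 p).pow 2))) (by positivity)
  have cb : ∀ p ∈ ellipticDom (ang z), ContDiffAt ℝ ∞ (fun p : Phase => bb (ang z + p.1 0)) p :=
    fun p hp => contDiffAt_bb (cj p) hp.1
  have cy : ∀ p ∈ ellipticDom (ang z), ContDiffAt ℝ ∞ (fun p : Phase =>
      -(bb (ang z + p.1 0) / 2) + p.2 1 * √(1 + 4 * p.1 1 ^ 2)) p := fun p hp =>
    ((cb p hp).div_const 2).neg.add ((q1 p).mul (cw p))
  have cc : ∀ p ∈ ellipticDom (ang z), ContDiffAt ℝ ∞ (fun p : Phase =>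
      (ang z + p.1 0) / (2 * bb (ang z + p.1 0))) p := fun p hp =>
    (cj p).div (contDiffAt_const.mul (cb p hp)) (mul_pos two_pos (bb_pos hp.1)).ne'
  have cα : ∀ p ∈ ellipticDom (ang z), ContDiffAt ℝ ∞ (fun p : Phase =>
      α - p.2 0 - (ang z + p.1 0) / (2 * bb (ang z + p.1 0)) * (Real.arsinh (2 * p.1 1) / 2)) p :=
    fun p hp => (contDiffAt_const.sub (q0 p)).sub ((cc p hp).mul (cx p))
  refine hasLocalForm_of_param (isOpen_ellipticDom (ang z)) ?_ (fun p hp => ?_) (fun p hp v w => ?_)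
    (fun p hp => (reduced_ellipticParam α hp).2.1) (Homeomorph.addRight (-(ang z, (0 : ℝ)))) ?_ ?_
    fun p hp => ?_
  · refine ⟨by simpa using hj, ?_⟩
    simp
    positivity
  · exact contDiffWithinAt_lift (cx p).contDiffWithinAt (cy p hp).contDiffWithinAt
      (cj p).contDiffWithinAt (cα p hp).contDiffWithinAt (Or.inl (reduced_ellipticParam α hp).1)
  · refine (omega_fderiv_lift (cx p) (cy p hp) (cj p) (cα p hp)
      (Or.inl (reduced_ellipticParam α hp).1) v w).trans ?_
    have hb' := bb_pos hp.1
    have w2 : √(1 + 4 * p.1 1 ^ 2) ^ 2 = 1 + 4 * p.1 1 ^ 2 := Real.sq_sqrt (by positivity)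
    have w0 : 0 < √(1 + 4 * p.1 1 ^ 2) := Real.sqrt_pos.2 (by positivity)
    have dj : HasFDerivAt (fun p : Phase => ang z + p.1 0) (dp 0) p :=
      (hasFDerivAt_p 0 p).const_add _
    have dx : HasFDerivAt (fun p : Phase => Real.arsinh (2 * p.1 1) / 2)
        ((1 / √(1 + 4 * p.1 1 ^ 2)) • dp 1) p := by
      have h1 := ((hasFDerivAt_p 1 p).const_mul 2).arsinh.mul_const (1 / 2)
      have h2 : √(1 + (2 * p.1 1) ^ 2) = √(1 + 4 * p.1 1 ^ 2) := by congr 1; ring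
      rw [h2] at h1
      refine (h1.congr_fderiv ?_).congr_of_eventuallyEq (Eventually.of_forall fun p => ?_)
      · ext v <;> simp <;> ring
      · ring
    have dw : HasFDerivAt (fun p : Phase => √(1 + 4 * p.1 1 ^ 2))
        ((4 * p.1 1 / √(1 + 4 * p.1 1 ^ 2)) • dp 1) p := by
      have h1 := ((((hasFDerivAt_p 1 p).pow 2).const_mul 4).const_add 1).sqrt
        (show 1 + 4 * p.1 1 ^ 2 ≠ 0 by positivity)
      refine h1.congr_fderiv ?_
      ext v <;> simp <;> field_simp
    have db : HasFDerivAt (fun p : Phase => bb (ang z + p.1 0))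
        ((-(ang z + p.1 0) / bb (ang z + p.1 0)) • dp 0) p :=
      HasDerivAt.comp_hasFDerivAt (h₂ := bb) (f := fun p : Phase => ang z + p.1 0) p
        (hasDerivAt_bb hp.1) dj
    have dy : HasFDerivAt (fun p : Phase =>
        -(bb (ang z + p.1 0) / 2) + p.2 1 * √(1 + 4 * p.1 1 ^ 2)) _ p :=
      ((db.mul_const (1 / 2)).neg.congr_of_eventuallyEq
        (Eventually.of_forall fun p => by simp only [Pi.neg_apply]; ring)).add
          ((hasFDerivAt_q 1 p).mul dw)
    have dc := ((cc p hp).differentiableAt (by simp)).hasFDerivAt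
    have dcv : ∀ v, fderiv ℝ (fun p : Phase => (ang z + p.1 0) / (2 * bb (ang z + p.1 0))) p v =
        deriv (fun j => j / (2 * bb j)) (ang z + p.1 0) * v.1 0 := fun v => by
      have h1 : DifferentiableAt ℝ (fun j => j / (2 * bb j)) (ang z + p.1 0) :=
        (differentiableAt_id).div ((hasDerivAt_bb hp.1).differentiableAt.const_mul 2)
          (mul_pos two_pos hb').ne'
      have h2 := (h1.hasDerivAt.comp_hasFDerivAt p dj).fderiv
      exact congrArg (fun L => L v) h2
    have dα : HasFDerivAt (fun p : Phase =>
        α - p.2 0 -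
          (ang z + p.1 0) / (2 * bb (ang z + p.1 0)) * (Real.arsinh (2 * p.1 1) / 2)) _ p :=
      ((hasFDerivAt_q 0 p).const_sub α).sub (dc.mul dx)
    rw [dx.fderiv, dy.fderiv, dj.fderiv, dα.fderiv]
    simp only [_root_.add_apply, _root_.smul_apply, smul_eq_mul, dp_apply, dq_apply,
      _root_.sub_apply, _root_.neg_apply, dcv, omega]
    field_simp
    ring
  · exact contDiff_id.add contDiff_const
  · exact contDiff_id.add contDiff_const
  · rw [(reduced_ellipticParam α hp).2.2]
    simp [ellipticOne]

/-- The linear symplectic parametrisation near the node. It is chosen to turn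
`17/8 p · q + 15/16 (|p|² + |q|²)`, which is `H - 1/2` near the node, into `p · q`. -/
def nodalParam (p : Phase) : Phase :=
  mkPhase ((5 * p.1 0 - 3 * p.2 0) / 4) ((5 * p.1 1 - 3 * p.2 1) / 4)
    ((5 * p.2 0 - 3 * p.1 0) / 4) ((5 * p.2 1 - 3 * p.1 1) / 4)

theorem contDiff_nodalParam : ContDiff ℝ ∞ nodalParam := by
  have p := contDiff_fst_coord
  have q := contDiff_snd_coord
  refine contDiff_iff_contDiffAt.2 fun z => contDiffWithinAt_mkPhase (s := univ) ?_ ?_ ?_ ?_ <;>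
  exact ContDiff.contDiffAt (ContDiff.div_const (ContDiff.sub
    (contDiff_const.mul (by first | exact p _ | exact q _))
    (contDiff_const.mul (by first | exact p _ | exact q _))) 4)

/-- The exchange of the two coordinates of the base, centred at the value `1/2` of the node. -/
def nodalBase : (ℝ × ℝ) ≃ₜ (ℝ × ℝ) :=
  (Homeomorph.addRight ((0 : ℝ), (-(1 / 2) : ℝ))).trans (Homeomorph.prodComm ℝ ℝ)

theorem zero_mem_openBidisk : (0 : Phase) ∈ openBidisk := by simp [openBidisk]

/-- Near the origin the Hamiltonian is `1/2 + 17/8 p · q + 15/16 (|p|² + |q|²)`, which is brought to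
the nodal form by a linear symplectic map. -/
theorem nodal_local_form : HasLocalForm openBidisk fib nodal 0 := by
  have hz0 : nodalParam 0 = 0 := by
    refine phase_ext ?_ ?_ ?_ ?_ <;> simp [nodalParam]
  have hnn0 : nn 0 = 0 := by simp [nn, dot]
  have huu0 : uu 0 = 0 := by simp [uu, sqP, sqQ]
  have hj0 : |ang 0| < 1 := abs_ang_lt zero_mem_openBidisk
  have hgood : ∀ᶠ z in 𝓝 (0 : Phase), z ∈ openBidisk ∧ |nn z| < 1 / 4 ∧ |uu z| < 1 / 8 := by
    refine Filter.Eventually.and (isOpen_openBidisk.eventually_mem zero_mem_openBidisk)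
      (Filter.Eventually.and ?_ ?_)
    · exact (contDiffAt_nn hj0).continuousAt.abs.eventually
        (isOpen_Iio.mem_nhds (by simp [hnn0]))
    · exact (contDiffAt_uu hj0).continuousAt.abs.eventually
        (isOpen_Iio.mem_nhds (by simp [huu0]))
  obtain ⟨W, hW, hWo, h0W⟩ := eventually_nhds_iff.1 hgood
  have hlf := hasLocalForm_of_param (M := openBidisk) (F := fib) (G := nodal)
    (hWo.preimage contDiff_nodalParam.continuous)
    (by rw [mem_preimage, hz0]; exact h0W) contDiff_nodalParam.contDiffOn (fun p _ v w => ?_)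
    (fun p hp => (hW _ hp).1) nodalBase ?_ ?_ fun p hp => ?_
  · rwa [hz0] at hlf
  · have hd := contDiff_nodalParam.contDiffAt.differentiableAt (x := p) (by simp)
    simp only [omega, fderiv_fst_coord hd, fderiv_snd_coord hd]
    have a0 := (((hasFDerivAt_p 0 p).const_mul 5).sub
      ((hasFDerivAt_q 0 p).const_mul 3)).mul_const (4⁻¹ : ℝ)
    have a1 := (((hasFDerivAt_p 1 p).const_mul 5).sub
      ((hasFDerivAt_q 1 p).const_mul 3)).mul_const (4⁻¹ : ℝ)
    have b0 := (((hasFDerivAt_q 0 p).const_mul 5).sub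
      ((hasFDerivAt_p 0 p).const_mul 3)).mul_const (4⁻¹ : ℝ)
    have b1 := (((hasFDerivAt_q 1 p).const_mul 5).sub
      ((hasFDerivAt_p 1 p).const_mul 3)).mul_const (4⁻¹ : ℝ)
    have a0' : fderiv ℝ (fun e => (nodalParam e).1 0) p = _ := a0.fderiv
    have a1' : fderiv ℝ (fun e => (nodalParam e).1 1) p = _ := a1.fderiv
    have b0' : fderiv ℝ (fun e => (nodalParam e).2 0) p = _ := b0.fderiv
    have b1' : fderiv ℝ (fun e => (nodalParam e).2 1) p = _ := b1.fderiv
    rw [a0', a1', b0', b1']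
    simp only [_root_.smul_apply, _root_.sub_apply, smul_eq_mul, dp_apply, dq_apply]
    ring
  · exact (contDiff_snd.add contDiff_const).prodMk (contDiff_fst.add contDiff_const)
  · exact (contDiff_snd.prodMk contDiff_fst).add contDiff_const
  · obtain ⟨hM, hn, hu⟩ := hW _ hp
    have hj := abs_ang_lt hM
    have h1 := ham_phase_of_ge hj (by linarith [(abs_lt.1 hn).1])
    have hn2 : nn (nodalParam p) ^ 2 ≤ 1 / 3 := by
      have := sq_lt_sq' (abs_lt.1 hn).1 (abs_lt.1 hn).2; linarith
    have hu2 : uu (nodalParam p) ^ 2 ≤ 1 / 64 := by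
      have := sq_lt_sq' (abs_lt.1 hu).1 (abs_lt.1 hu).2; linarith
    rw [pen_eq_zero hn2 hu2, add_zero] at h1
    refine Prod.ext ?_ ?_
    · change (fib (nodalParam p)).2 + -(1 / 2) = _
      rw [h1]
      simp only [nodal, dot, sqP, sqQ, nodalParam, mkPhase_p0, mkPhase_p1, mkPhase_q0, mkPhase_q1]
      ring
    · change ang (nodalParam p) + 0 = _
      simp only [nodal, ang, nodalParam, mkPhase_p0, mkPhase_p1, mkPhase_q0, mkPhase_q1]
      ring

theorem fderiv_nodal_zero : HasFDerivAt nodal (0 : Phase →L[ℝ] ℝ × ℝ) 0 := by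
  have h1 : HasFDerivAt dot (0 : Phase →L[ℝ] ℝ) 0 := by
    refine (differentiableAt_dot 0).hasFDerivAt.congr_fderiv ?_
    refine ContinuousLinearMap.ext fun v => ?_
    rw [fderiv_dot]; simp
  have h2 : HasFDerivAt ang (0 : Phase →L[ℝ] ℝ) 0 := by
    refine (differentiableAt_ang 0).hasFDerivAt.congr_fderiv ?_
    refine ContinuousLinearMap.ext fun v => ?_
    rw [fderiv_ang]; simp
  exact (h1.prodMk h2).congr_fderiv (by ext <;> simp)

/-- At a nodal point the differential of the fibration vanishes, while that of the angular momentum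
vanishes at the origin only. -/
theorem eq_zero_of_nodal {z : Phase} (hz : z ∈ openBidisk)
    (h : HasLocalForm openBidisk fib nodal z) : z = 0 := by
  obtain ⟨κ, χ, hzs, -, hκ0, hκ, -, -, -, hχ, hF⟩ := h
  by_contra h0
  obtain ⟨v, hv⟩ := exists_fderiv_ang h0
  have h1 : fib =ᶠ[𝓝 z] fun w => χ.symm (nodal (κ w)) := by
    filter_upwards [κ.open_source.mem_nhds hzs] with w hw
    obtain ⟨h1, h2⟩ := hF w hw
    rw [← h2, χ.left_inv h1]
  have h2 : HasFDerivAt (fun w => nodal (κ w)) (0 : Phase →L[ℝ] ℝ × ℝ) z := by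
    have h3 : HasFDerivAt nodal (0 : Phase →L[ℝ] ℝ × ℝ) (κ z) := by
      rw [hκ0]; exact fderiv_nodal_zero
    have h4 := ((hκ.contDiffAt (κ.open_source.mem_nhds hzs)).differentiableAt (by simp)).hasFDerivAt
    exact (h3.comp z h4).congr_fderiv (by ext <;> simp)
  have ht : nodal (κ z) ∈ χ.target := by
    rw [← (hF z hzs).2]; exact χ.map_source (hF z hzs).1
  have h5 := ((hχ.contDiffAt (χ.open_target.mem_nhds ht)).differentiableAt (by simp)).hasFDerivAt
  have h6 : HasFDerivAt (fun w => χ.symm (nodal (κ w))) _ z := HasFDerivAt.comp z h5 h2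
  have h7 := h1.fderiv_eq.trans h6.fderiv
  have h8 := fderiv_fib_fst hz v
  rw [h7, hv] at h8
  simp at h8

theorem isAlmostToric : IsAlmostToric openBidisk fib where
  isOpen := isOpen_openBidisk
  smooth := fun _ hz => (contDiffAt_fib hz).contDiffWithinAt
  proper := fun K hK hc => isCompact_fib_preimage (by rwa [fib_image] at hK) hc
  connected := fun b hb => isConnected_fib_fibre (by rwa [fib_image] at hb)
  local_form := by
    intro z hz
    by_cases h0 : z = 0
    · exact Or.inr (Or.inr (Or.inr (h0 ▸ nodal_local_form)))
    by_cases hc : uu z ≠ 0 ∨ nn z ≠ -1 / 2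
    · exact Or.inl (isRegular hz h0 hc)
    · push Not at hc
      exact Or.inr (Or.inl (elliptic_local_form hz hc.1 hc.2))

theorem act_zero : act 0 = (0, nodeHeight) := by
  have h1 : fib 0 = (0, 1 / 2) := by
    refine Prod.ext (by simp [fib, ang]) ?_
    have hn : nn 0 = 0 := by simp [nn, dot]
    have hu : uu 0 = 0 := by simp [uu, sqP, sqQ]
    rw [ham_phase_of_ge (abs_ang_lt zero_mem_openBidisk) (by rw [hn]; norm_num), hn, hu,
      pen_eq_zero (by norm_num) (by norm_num)]
    simp [dot, sqP, sqQ]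
  rw [act_eq zero_mem_openBidisk, h1]
  simp [toDiagram, nodeHeight]

end LagBidisk

theorem theorem1p4 :
    ∃ (f F : LagBidisk.Phase → ℝ × ℝ) (x₀ : LagBidisk.Phase) (a₀ : ℝ),
      ContinuousOn f LagBidisk.bidisk ∧
      f '' LagBidisk.bidisk = LagBidisk.region ∧
      (∀ z ∈ LagBidisk.bidisk, (f z).1 = LagBidisk.moment z) ∧
      (∀ b ∈ LagBidisk.region, IsConnected (LagBidisk.bidisk ∩ f ⁻¹' {b})) ∧
      (∀ z ∈ LagBidisk.bidisk,
        (f z).2 = LagBidisk.height (f z).1 ↔ z ∉ LagBidisk.openBidisk) ∧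
      LagBidisk.IsAlmostToric LagBidisk.openBidisk F ∧
      x₀ ∈ LagBidisk.openBidisk ∧
      (∀ x ∈ LagBidisk.openBidisk,
        LagBidisk.HasLocalForm LagBidisk.openBidisk F LagBidisk.nodal x ↔ x = x₀) ∧
      f x₀ = (0, a₀) ∧ 0 < a₀ ∧ a₀ < LagBidisk.height 0 ∧
      LagBidisk.IsBaseDiagram LagBidisk.openBidisk F f (LagBidisk.cut a₀) :=
  ⟨LagBidisk.act, LagBidisk.fib, 0, LagBidisk.nodeHeight, LagBidisk.continuousOn_act,
    LagBidisk.act_image, fun _ _ => rfl, fun _ hb => LagBidisk.isConnected_act_fibre hb,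
    fun _ hz => LagBidisk.act_top_iff hz, LagBidisk.isAlmostToric, LagBidisk.zero_mem_openBidisk,
    fun _ hz => ⟨LagBidisk.eq_zero_of_nodal hz, fun h => h ▸ LagBidisk.nodal_local_form⟩,
    LagBidisk.act_zero, LagBidisk.nodeHeight_pos, LagBidisk.nodeHeight_lt,
    LagBidisk.isBaseDiagram⟩

end
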